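/- **Setting.** Let $G$ be a finite connected graph (loops and parallel edges allowed) with non-negative edge weights $w$, cellularly embedded on an orientable surface of genus $g$ with $b$ boundaries; each boundary (puncture) is regarded as a face of $G$, called a boundary face, so that $g$ is the genus given by Euler's formula when these faces are counted. For a set $U$ of faces, $\partial U$ is the set of edges with a face of $U$ on exactly one side. Two edge sets are ($\mathbb{Z}_2$-)homologous if their symmetric difference is $\partial U$ for some $U$; a closed walk is identified with the set of edges that it uses an odd number of times. For faces $s,t$, an edge set is $st$-separating if it equals $\partial U$ for some $U$ with $s\in U$, $t\notin U$; *the* minimum $st$-separating subgraph is the one of least total weight, assumed to be unique. A cycle decomposition of $S$ is a partition of its edges into simple cycles no two of which cross (i.e. at no vertex do edges of two of them alternate in the cyclic order). A connected edge set $X$ crosses a separating subgraph $S$ if $X$ contains two edges $e,f$ such that both faces incident to $e$ lie in one component of the surface cut along $S$ and both faces incident to $f$ lie in another component. For an edge set $X$, $G$ cut along $X$ is the embedded graph obtained by cutting the surface along $X$: every edge of $X$ is replaced by two copies of the same weight, the faces of $G$ are kept, and the new holes are additional boundary faces. A cycle $C$ is tight if no closed walk homologous to $C$ is shorter (edges of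 a walk counted with multiplicity). An $x$-to-$y$ path $P$ is tight if, after an edge $xy$ is added along a handle joining a face incident with $x$ to a face incident with $y$, $P\cup xy$ is no longer than any cycle $Q\cup xy$ ($Q$ an $x$-to-$y$ walk) homologous to it; this is required for every choice of the two faces. A tight $C$-to-$C$ path is a tight path, in $G$ cut along $C$, from a vertex of one copy of $C$ to a vertex of the other copy; in $G$ it is identified with the edges of which it uses copies. **Lemma.** Let $s,t$ be faces of $G$ and let $S$ be the minimum $st$-separating subgraph of $G$. If $S$ has a cycle decomposition into at most $g$ cycles, then there are a tight simple cycle $C$ and a tight $C$-to-$C$ path $P$ such that 1. $G$ cut along $C\cup P$ is connected, is embedded on a surface of genus $g-1$, and has $b+1$ boundaries; 2. neither $C$ nor $P$ crosses $S$. Moreover, $S$ is the minimum $st$-separating subgraph in $G$ cut along $C\cup P$: there a set $S'$ consisting of exactly one copy of each edge of $S$ is $st$-separating and has minimum weight among all $st$-separating edge sets, and for every $st$-separating set of that same weight the edges of $G$ of which it contains an odd number of copies are exactly those of $S$. -/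

import Mathlib

/-- A graph cellularly embedded on a closed oriented surface, as a combinatorial map. Elements of
`D` are the darts (oriented edges), `opp` reverses a dart, and `next` sends a dart to the dart that
follows it on the boundary walk of the face on its left. Loops and parallel edges are allowed. -/
structure EmbGraph (D : Type*) where
  opp : Equiv.Perm D
  next : Equiv.Perm D
  opp_opp : ∀ d, opp (opp d) = d
  opp_ne : ∀ d, opp d ≠ d

/-- A map that is constant along a permutation is constant on its cycles. -/
theorem eq_of_sameCycle {α β : Type*} {τ : Equiv.Perm α} {f : α → β} (h : ∀ x, f (τ x) = f x)
    {x y : α} (hxy : τ.SameCycle x y) : f x = f y := by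
  have key : ∀ (n : ℕ) (z : α), f ((τ ^ n) z) = f z := by
    intro n
    induction n with
    | zero => intro z; simp
    | succ n ih => intro z; rw [pow_succ, Equiv.Perm.mul_apply, ih, h]
  obtain ⟨i, rfl⟩ := hxy
  obtain ⟨n, rfl | rfl⟩ := i.eq_nat_or_neg
  · rw [zpow_natCast, key]
  · rw [zpow_neg, zpow_natCast]
    conv_lhs => rw [← Equiv.apply_symm_apply (τ ^ n) x]
    rw [key]
    rfl

section FirstReturn

variable {α : Type*} [Finite α]

theorem exists_return (τ : Equiv.Perm α) (X : Set α) (x : X) :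
    ∃ n : ℕ, 0 < n ∧ (τ ^ n) (x : α) ∈ X :=
  ⟨orderOf τ, orderOf_pos τ, by rw [pow_orderOf_eq_one]; exact x.2⟩

open Classical in
/-- The first point of `X` among `τ x, τ² x, τ³ x, …`. -/
noncomputable def firstReturnFun (τ : Equiv.Perm α) (X : Set α) (x : X) : X :=
  ⟨(τ ^ Nat.find (exists_return τ X x)) (x : α), (Nat.find_spec (exists_return τ X x)).2⟩

theorem firstReturnFun_injective (τ : Equiv.Perm α) (X : Set α) :
    Function.Injective (firstReturnFun τ X) := by
  classical
  have aux : ∀ x y : X, ∀ m n : ℕ, 0 < m → m ≤ n → (∀ k, 0 < k → k < n → (τ ^ k) (y : α) ∉ X) →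
      (τ ^ m) (x : α) = (τ ^ n) (y : α) → x = y := by
    intro x y m n hm hmn hmin heq
    obtain ⟨k, rfl⟩ := Nat.exists_eq_add_of_le hmn
    rw [pow_add, Equiv.Perm.mul_apply] at heq
    have hx : (x : α) = (τ ^ k) (y : α) := (τ ^ m).injective heq
    rcases Nat.eq_zero_or_pos k with rfl | hk
    · exact Subtype.ext (by simpa using hx)
    · exact absurd (hx ▸ x.2) (hmin k hk (by omega))
  have hmin : ∀ y : X, ∀ k, 0 < k → k < Nat.find (exists_return τ X y) → (τ ^ k) (y : α) ∉ X :=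
    fun y k hk hlt hmem => Nat.find_min (exists_return τ X y) hlt ⟨hk, hmem⟩
  intro x y hxy
  have hxy' := congrArg Subtype.val hxy
  simp only [firstReturnFun] at hxy'
  rcases le_total (Nat.find (exists_return τ X x)) (Nat.find (exists_return τ X y)) with h | h
  · exact aux x y _ _ (Nat.find_spec (exists_return τ X x)).1 h (hmin y) hxy'
  · exact (aux y x _ _ (Nat.find_spec (exists_return τ X y)).1 h (hmin x) hxy'.symm).symm

/-- The permutation that a permutation `τ` of a finite set induces on a subset `X`. -/
noncomputable def firstReturn (τ : Equiv.Perm α) (X : Set α) : Equiv.Perm X :=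
  Equiv.ofBijective (firstReturnFun τ X)
    (Finite.injective_iff_bijective.mp (firstReturnFun_injective τ X))

end FirstReturn

namespace EmbGraph

variable {D : Type*}

/-- Rotation about the tail of a dart. -/
def rot (G : EmbGraph D) : Equiv.Perm D := G.opp * G.next⁻¹

/-- Vertices: the cycles of the rotation. -/
abbrev Vertex (G : EmbGraph D) := Quotient (Equiv.Perm.SameCycle.setoid G.rot)

/-- Edges: pairs of opposite darts. -/
abbrev Edge (G : EmbGraph D) := Quotient (Equiv.Perm.SameCycle.setoid G.opp)

/-- Faces: the cycles of `next`. -/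
abbrev Face (G : EmbGraph D) := Quotient (Equiv.Perm.SameCycle.setoid G.next)

def tail (G : EmbGraph D) (d : D) : G.Vertex := Quotient.mk _ d

def head (G : EmbGraph D) (d : D) : G.Vertex := G.tail (G.opp d)

def edge (G : EmbGraph D) (d : D) : G.Edge := Quotient.mk _ d

/-- The face to the left of a dart; the face to its right is `G.face (G.opp d)`. -/
def face (G : EmbGraph D) (d : D) : G.Face := Quotient.mk _ d

theorem edge_opp (G : EmbGraph D) (d : D) : G.edge (G.opp d) = G.edge d :=
  Quotient.sound ⟨1, by simp [G.opp_opp]⟩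

/-- The graph (equivalently, the surface) is nonempty and connected. -/
def Connected (G : EmbGraph D) : Prop :=
  Nonempty D ∧ ∀ d e : D, Relation.ReflTransGen (fun x y => y = G.opp x ∨ y = G.next x) d e

/-- The surface is connected and has genus `g`, by Euler's formula `V - E + F = 2 - 2g`. Boundary
components are counted as faces, so this is the genus of the surface with its punctures capped. -/
def HasGenus (G : EmbGraph D) (g : ℤ) : Prop :=
  G.Connected ∧
    (Nat.card G.Vertex : ℤ) - (Nat.card G.Edge : ℤ) + (Nat.card G.Face : ℤ) = 2 - 2 * g

/-- Total weight of a set of edges. -/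
noncomputable def weight (G : EmbGraph D) (w : G.Edge → ℝ) (X : Set G.Edge) : ℝ :=
  ∑ᶠ e ∈ X, w e

/-- `∂U`: the edges with a face of `U` on exactly one side. -/
def bd (G : EmbGraph D) (U : Set G.Face) : Set G.Edge :=
  {e | ∃ d, G.edge d = e ∧ G.face d ∈ U ∧ G.face (G.opp d) ∉ U}

/-- `ℤ₂`-homologous: the symmetric difference is the boundary of a union of faces. -/
def Homologous (G : EmbGraph D) (X Y : Set G.Edge) : Prop :=
  ∃ U : Set G.Face, G.bd U = symmDiff X Y

/-- `X` is `ab`-separating: it is the boundary between a set of faces containing `a` and the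
complementary set, which contains `b`. -/
def IsSeparating (G : EmbGraph D) (a b : G.Face) (X : Set G.Edge) : Prop :=
  ∃ U : Set G.Face, a ∈ U ∧ b ∉ U ∧ X = G.bd U

/-- `S` is the (unique) minimum `ab`-separating subgraph. -/
def IsTheMinSeparating (G : EmbGraph D) (w : G.Edge → ℝ) (a b : G.Face) (S : Set G.Edge) : Prop :=
  G.IsSeparating a b S ∧ ∀ T, G.IsSeparating a b T → T ≠ S → G.weight w S < G.weight w T

/-- `L` is the list of darts of a walk from `x` to `y`. -/
def IsWalk (G : EmbGraph D) : G.Vertex → G.Vertex → List D → Prop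
  | x, y, [] => x = y
  | x, y, d :: L => G.tail d = x ∧ IsWalk G (G.head d) y L

/-- Length of a walk, edges being counted with multiplicity. -/
def walkWeight (G : EmbGraph D) (w : G.Edge → ℝ) (L : List D) : ℝ :=
  (L.map fun d => w (G.edge d)).sum

/-- The edges used by a walk. -/
def walkEdges (G : EmbGraph D) (L : List D) : Set G.Edge := {e | e ∈ L.map G.edge}

open Classical in
/-- The `ℤ₂`-chain of a walk: the edges that it traverses an odd number of times. -/
noncomputable def walkChain (G : EmbGraph D) (L : List D) : Set G.Edge :=
  {e | Odd ((L.map G.edge).count e)}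

/-- `L` is a path from `x` to `y`: a walk without repeated vertices. -/
def IsPath (G : EmbGraph D) (x y : G.Vertex) (L : List D) : Prop :=
  G.IsWalk x y L ∧ (L.map G.tail ++ [y]).Nodup

/-- `C` is the edge set of a simple cycle: a nonempty closed walk that visits each vertex and each
edge at most once. -/
def IsSimpleCycle (G : EmbGraph D) (C : Set G.Edge) : Prop :=
  ∃ (x : G.Vertex) (L : List D), L ≠ [] ∧ G.IsWalk x x L ∧
    (L.map G.tail).Nodup ∧ (L.map G.edge).Nodup ∧ C = G.walkEdges L

/-- Crossing of two edge-disjoint sets of edges: at some vertex, edges of `X` and of `Y` alternate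
in the rotation. -/
def CrossesAtVertex (G : EmbGraph D) (X Y : Set G.Edge) : Prop :=
  ∃ (d : D) (i j k : ℕ), 0 < i ∧ i < j ∧ j < k ∧ k < Function.minimalPeriod G.rot d ∧
    G.edge d ∈ X ∧ G.edge ((G.rot ^ i) d) ∈ Y ∧
    G.edge ((G.rot ^ j) d) ∈ X ∧ G.edge ((G.rot ^ k) d) ∈ Y

/-- A cycle decomposition of `S`: a partition of the edges of `S` into simple cycles no two of
which cross. -/
def IsCycleDecomposition (G : EmbGraph D) (S : Set G.Edge) (𝒞 : Set (Set G.Edge)) : Prop :=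
  (∀ C ∈ 𝒞, G.IsSimpleCycle C) ∧ ⋃₀ 𝒞 = S ∧ 𝒞.PairwiseDisjoint id ∧
    ∀ C ∈ 𝒞, ∀ C' ∈ 𝒞, C ≠ C' → ¬ G.CrossesAtVertex C C'

/-- Two faces lie in the same component of the surface cut along `H`: one passes from one to the
other across edges that are not in `H`. -/
def SameSide (G : EmbGraph D) (H : Set G.Edge) : G.Face → G.Face → Prop :=
  Relation.EqvGen fun f f' => ∃ d, G.edge d ∉ H ∧ G.face d = f ∧ G.face (G.opp d) = f'

/-- A connected set of edges `X` crosses an even separating subgraph `H`: there are two edges of `X`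
such that both faces incident to the first lie in one component of the surface cut along `H`, and
both faces incident to the second lie in another one. -/
def Crosses (G : EmbGraph D) (X H : Set G.Edge) : Prop :=
  ∃ d e : D, G.edge d ∈ X ∧ G.edge e ∈ X ∧
    G.SameSide H (G.face d) (G.face (G.opp d)) ∧ G.SameSide H (G.face e) (G.face (G.opp e)) ∧
    ¬ G.SameSide H (G.face d) (G.face e)

/-- `C` is tight: it is a shortest cycle (closed walk) in its `ℤ₂`-homology class. -/
def IsTightCycle (G : EmbGraph D) (w : G.Edge → ℝ) (C : Set G.Edge) : Prop :=
  ∀ (x : G.Vertex) (L : List D), G.IsWalk x x L → G.Homologous C (G.walkChain L) →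
    G.weight w C ≤ G.walkWeight w L

/-- The face `f` is incident with the vertex `x`. -/
def Incident (G : EmbGraph D) (f : G.Face) (x : G.Vertex) : Prop :=
  ∃ d, G.tail d = x ∧ G.face d = f

/-- `P` is a tight `x`-to-`y` path: when an edge `xy` is added along a handle that joins a face `fx`
incident with `x` to a face `fy` incident with `y`, the cycle `P ∪ xy` is shortest among the cycles
`Q ∪ xy` homologous to it. The handle fuses `fx` and `fy` into one face, so that a union of faces of
the new surface contains both of them or neither. Every choice of `fx` and `fy` is required to
work. -/
def IsTightPath (G : EmbGraph D) (w : G.Edge → ℝ) (x y : G.Vertex) (P : List D) : Prop :=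
  G.IsPath x y P ∧
    ∀ fx fy : G.Face, G.Incident fx x → G.Incident fy y →
      ∀ Q : List D, G.IsWalk x y Q →
        (∃ U : Set G.Face, (fx ∈ U ↔ fy ∈ U) ∧
          G.bd U = symmDiff (G.walkChain P) (G.walkChain Q)) →
        G.walkWeight w P ≤ G.walkWeight w Q

section Cut

/-- The darts of a set of edges. -/
def darts (G : EmbGraph D) (X : Set G.Edge) : Set D := {d | G.edge d ∈ X}

/-- The darts of `G` cut along `X`: those of `G`, each with its face still on its left, and for each
dart `d` of `X` a new dart `inr d`, running opposite to `d` with a new face on its left. -/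
abbrev CutDart (G : EmbGraph D) (X : Set G.Edge) := D ⊕ G.darts X

theorem opp_mem_darts (G : EmbGraph D) (X : Set G.Edge) (d : D) :
    d ∈ G.darts X ↔ G.opp d ∈ G.darts X := by
  simp [darts, edge_opp]

open Classical in
/-- Reversal in the cut graph: an edge `{d, opp d}` of `X` becomes the two edges `{inl d, inr d}`
and `{inl (opp d), inr (opp d)}`; the other edges stay. -/
noncomputable def cutOpp (G : EmbGraph D) (X : Set G.Edge) : G.CutDart X → G.CutDart X
  | .inl d => if h : d ∈ G.darts X then .inr ⟨d, h⟩ else .inl (G.opp d)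
  | .inr d => .inl d

theorem cutOpp_involutive (G : EmbGraph D) (X : Set G.Edge) :
    Function.Involutive (G.cutOpp X) := by
  rintro (d | d)
  · by_cases h : d ∈ G.darts X
    · simp [cutOpp, h]
    · have h' : G.opp d ∉ G.darts X := fun h'' => h ((G.opp_mem_darts X d).mpr h'')
      simp [cutOpp, h, h', G.opp_opp]
  · simp [cutOpp]

theorem cutOpp_ne (G : EmbGraph D) (X : Set G.Edge) (d : G.CutDart X) : G.cutOpp X d ≠ d := by
  rcases d with d | d
  · by_cases h : d ∈ G.darts X
    · simp [cutOpp, h]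
    · simp [cutOpp, h, G.opp_ne]
  · simp [cutOpp]

variable [Finite D]

/-- `G` cut along the edge set `X`. The old faces stay. The boundary walk of a new face continues
after `inr d`, at the tail of `d`, with `inr (opp d')`, where `d'` is the first dart of `X` that is
met when rotating about the tail of `d` from `d`, through the face on the left of `d`. -/
noncomputable def cut (G : EmbGraph D) (X : Set G.Edge) : EmbGraph (G.CutDart X) where
  opp := (G.cutOpp_involutive X).toPerm
  next := Equiv.sumCongr G.next
    ((firstReturn G.rot (G.darts X)).trans (G.opp.subtypeEquiv (G.opp_mem_darts X)))
  opp_opp := G.cutOpp_involutive X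
  opp_ne := G.cutOpp_ne X

/-- A face of `G` as a face of the cut graph. -/
noncomputable def cutFace (G : EmbGraph D) (X : Set G.Edge) : G.Face → (G.cut X).Face :=
  Quotient.lift (fun d => (G.cut X).face (.inl d)) fun _ _ h =>
    eq_of_sameCycle (τ := G.next) (f := fun d => (G.cut X).face (.inl d))
      (fun d => (Quotient.sound ⟨1, by simp [cut]⟩ :
        (G.cut X).face (.inl d) = (G.cut X).face (.inl (G.next d))).symm) h

/-- The edge of `G` of which an edge of the cut graph is a copy. -/
noncomputable def cutProj (G : EmbGraph D) (X : Set G.Edge) : (G.cut X).Edge → G.Edge :=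
  Quotient.lift (Sum.elim G.edge fun d => G.edge d) fun _ _ h =>
    eq_of_sameCycle (τ := (G.cut X).opp) (by
      rintro (d | d)
      · by_cases h : d ∈ G.darts X
        · simp [cut, cutOpp, h]
        · simp [cut, cutOpp, h, edge_opp]
      · simp [cut, cutOpp]) h

/-- Edge weights of the cut graph: copies inherit the weights. -/
noncomputable def cutWeight (G : EmbGraph D) (X : Set G.Edge) (w : G.Edge → ℝ) :
    (G.cut X).Edge → ℝ := w ∘ G.cutProj X

/-- The boundary faces of the cut graph: those of `G`, and the new faces. -/
noncomputable def cutBoundary (G : EmbGraph D) (X : Set G.Edge) (B : Set G.Face) :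
    Set (G.cut X).Face :=
  G.cutFace X '' B ∪ Set.range fun d : G.darts X => (G.cut X).face (.inr d)

/-- `P` is a tight `C`-to-`C` path: a tight path, in `G` cut along `C`, from a vertex `x` of one
copy of `C` to a vertex `y` of another copy of `C`, the copies bounding distinct new faces. -/
def IsTightCycleToCyclePath (G : EmbGraph D) (w : G.Edge → ℝ) (C : Set G.Edge)
    (P : List (G.CutDart C)) : Prop :=
  ∃ d e : G.darts C, (G.cut C).face (.inr d) ≠ (G.cut C).face (.inr e) ∧
    (G.cut C).IsTightPath (G.cutWeight C w) ((G.cut C).tail (.inr d)) ((G.cut C).tail (.inr e)) P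

/-- The edge set in `G` of a walk `P` in `G` cut along `C`. -/
def projWalk (G : EmbGraph D) (C : Set G.Edge) (P : List (G.CutDart C)) : Set G.Edge :=
  G.cutProj C '' (G.cut C).walkEdges P

/-- `S` is the minimum `ab`-separating subgraph in `G` cut along `X`: a set `S'` consisting of one
copy of each edge of `S` is `ab`-separating there and has minimum weight, and every other
`ab`-separating set of that weight represents `S` as well, in the sense that `S` is the set of edges
of which it contains an odd number of copies. -/
def IsTheMinSeparatingInCut (G : EmbGraph D) (w : G.Edge → ℝ) (X : Set G.Edge) (a b : G.Face)
    (S : Set G.Edge) : Prop :=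
  ∃ S' : Set (G.cut X).Edge, Set.BijOn (G.cutProj X) S' S ∧
    (G.cut X).IsSeparating (G.cutFace X a) (G.cutFace X b) S' ∧
    ∀ T, (G.cut X).IsSeparating (G.cutFace X a) (G.cutFace X b) T →
      (G.cut X).weight (G.cutWeight X w) S' ≤ (G.cut X).weight (G.cutWeight X w) T ∧
      ((G.cut X).weight (G.cutWeight X w) T = (G.cut X).weight (G.cutWeight X w) S' →
        {e | Odd {e' ∈ T | G.cutProj X e' = e}.ncard} = S)

end Cut

end EmbGraph

/-! Write S = ∂U with s ∈ U and t ∉ U. The whole construction takes place among the edges incident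
to one of the two sides, U or its complement.

A handle on one side. Take a neighbourhood of `incident U` and cap its boundary walks. If every
cycle of `incident U` bounds there, all components are spheres (`planar_of_forall_mem_subBd`).
Suppose this holds for both sides. The boundary walks of the two neighbourhoods number at most the
faces of G plus the boundary walks of a neighbourhood of S, and a decomposition of S into k
noncrossing cycles bounds the latter number (`finrank_inv_subNext_le`). Euler's formula then gives k
≥ g + 1, contrary to k ≤ g. So one side, say U, carries a cycle that does not bound near it
(`exists_cycle_notMem_subBd`). Faces, boundary walks and components are all counted as dimensions of
spaces of ℤ₂-valued functions on darts that are invariant under permutations.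

Tightness. Let C be a lightest simple cycle of `incident U` that does not bound near U. If a closed
walk L differs from C by ∂W, where t ∉ W may be assumed, then U ∪ W still separates s from t, so ∂(U
∪ W) is at least as heavy as ∂U. By submodularity (`weight_uncross`), C + ∂(W ∩ U) is at most as
heavy as L. This chain stays near U and still does not bound, so it contains a competitor of C.
Since C does not bound near U, its two copies are joined by a path near U in G cut along C
(`IsCycleParam.exists_walk`). A lightest such path P is tight by the same uncrossing, carried out in
the cut graph with the new faces added to U.

Conclusion. Choosing P also with the fewest edges makes it meet the copies of C only at its ends.
Cutting along C ∪ P then makes a single hole, and Euler's formula gives genus g − 1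
(`IsArcParam.cut_face_eq`, `HasGenus.cut`). Edges incident to U cannot cross S because the side U is
connected (`not_crosses`). With a single new face, separating sets of the cut graph project to
separating sets of G without gaining weight, so S remains minimum (`IsTheMinSeparating.inCut`). -/

namespace EmbGraph

/-! ### Incidence of darts, boundaries of face sets, weights and uncrossing. -/

section Basic

variable {D : Type*} (G : EmbGraph D)

theorem edge_eq_iff {d e : D} : G.edge d = G.edge e ↔ e = d ∨ e = G.opp d := by
  constructor
  · intro h
    have hc : G.opp.SameCycle d e := Quotient.exact h
    -- The unordered pair of a dart and its opposite is an invariant of `opp`.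
    have := eq_of_sameCycle (τ := G.opp) (f := fun x => ({x, G.opp x} : Set D))
      (fun x => by simp only [G.opp_opp]; exact Set.pair_comm _ _) hc
    have he : e ∈ ({e, G.opp e} : Set D) := by simp
    rw [← this] at he
    simpa using he
  · rintro (rfl | rfl)
    · rfl
    · exact (G.edge_opp d).symm

theorem opp_eq_comm {d e : D} : G.opp d = e ↔ d = G.opp e := by
  constructor
  · rintro rfl; rw [G.opp_opp]
  · rintro rfl; rw [G.opp_opp]

theorem rot_apply (d : D) : G.rot d = G.opp (G.next⁻¹ d) := rfl

theorem rot_inv_apply (d : D) : G.rot⁻¹ d = G.next (G.opp d) := by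
  rw [Equiv.Perm.inv_eq_iff_eq, rot_apply]
  simp [G.opp_opp]

theorem tail_eq_iff {d e : D} : G.tail d = G.tail e ↔ G.rot.SameCycle d e := Quotient.eq

theorem face_eq_iff {d e : D} : G.face d = G.face e ↔ G.next.SameCycle d e := Quotient.eq

theorem tail_rot (d : D) : G.tail (G.rot d) = G.tail d :=
  G.tail_eq_iff.2 (Equiv.Perm.sameCycle_apply_left.2 (Equiv.Perm.SameCycle.refl _ _))

theorem tail_rot_pow (n : ℕ) (d : D) : G.tail ((G.rot ^ n) d) = G.tail d :=
  G.tail_eq_iff.2 (Equiv.Perm.sameCycle_pow_left.2 (Equiv.Perm.SameCycle.refl _ _))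

theorem face_next (d : D) : G.face (G.next d) = G.face d :=
  G.face_eq_iff.2 (Equiv.Perm.sameCycle_apply_left.2 (Equiv.Perm.SameCycle.refl _ _))

theorem head_opp (d : D) : G.head (G.opp d) = G.tail d := by
  rw [head, G.opp_opp]

theorem tail_next (d : D) : G.tail (G.next d) = G.head d := by
  rw [← G.tail_rot, rot_apply]; simp [head]

theorem face_opp_rot (d : D) : G.face (G.opp (G.rot d)) = G.face d := by
  rw [rot_apply, G.opp_opp, ← G.face_next]; simp

theorem exists_tail (v : G.Vertex) : ∃ d, G.tail d = v := Quotient.exists_rep v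

theorem exists_edge (e : G.Edge) : ∃ d, G.edge d = e := Quotient.exists_rep e

theorem exists_face (f : G.Face) : ∃ d, G.face d = f := Quotient.exists_rep f

theorem edgeSet_ext {X Y : Set G.Edge} (h : ∀ d, G.edge d ∈ X ↔ G.edge d ∈ Y) : X = Y := by
  ext e
  obtain ⟨d, rfl⟩ := G.exists_edge e
  exact h d

theorem mem_bd {U : Set G.Face} {d : D} :
    G.edge d ∈ G.bd U ↔ ¬(G.face d ∈ U ↔ G.face (G.opp d) ∈ U) := by
  constructor
  · rintro ⟨e, he, h1, h2⟩
    rcases G.edge_eq_iff.1 he with rfl | rfl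
    · tauto
    · rw [G.opp_opp]; tauto
  · intro h
    by_cases hd : G.face d ∈ U
    · exact ⟨d, rfl, hd, by tauto⟩
    · exact ⟨G.opp d, G.edge_opp d, by tauto, by rw [G.opp_opp]; exact hd⟩

theorem bd_compl (U : Set G.Face) : G.bd Uᶜ = G.bd U :=
  G.edgeSet_ext fun d => by simp only [mem_bd, Set.mem_compl_iff]; tauto

/-- The edges incident to a face of `U`. -/
def incident (U : Set G.Face) : Set G.Edge := {e | ∃ d, G.edge d = e ∧ G.face d ∈ U}

theorem mem_incident {U : Set G.Face} {d : D} :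
    G.edge d ∈ G.incident U ↔ G.face d ∈ U ∨ G.face (G.opp d) ∈ U := by
  constructor
  · rintro ⟨e, he, h⟩
    rcases G.edge_eq_iff.1 he with rfl | rfl
    · exact Or.inl h
    · rw [G.opp_opp]; exact Or.inr h
  · rintro (h | h)
    · exact ⟨d, rfl, h⟩
    · exact ⟨_, G.edge_opp d, h⟩

variable {G}

theorem isSeparating_symm {a b : G.Face} {X : Set G.Edge} (h : G.IsSeparating a b X) :
    G.IsSeparating b a X := by
  obtain ⟨U, ha, hb, rfl⟩ := h
  exact ⟨Uᶜ, hb, fun h => h ha, (G.bd_compl U).symm⟩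

theorem IsTheMinSeparating.symm {w : G.Edge → ℝ} {a b : G.Face} {X : Set G.Edge}
    (h : G.IsTheMinSeparating w a b X) : G.IsTheMinSeparating w b a X :=
  ⟨isSeparating_symm h.1, fun T hT => h.2 T (isSeparating_symm hT)⟩

theorem IsTheMinSeparatingInCut.symm [Finite D] {w : G.Edge → ℝ} {X : Set G.Edge}
    {a b : G.Face} {S : Set G.Edge} (h : G.IsTheMinSeparatingInCut w X a b S) :
    G.IsTheMinSeparatingInCut w X b a S := by
  obtain ⟨S', h1, h2, h3⟩ := h
  exact ⟨S', h1, isSeparating_symm h2, fun T hT => h3 T (isSeparating_symm hT)⟩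

theorem IsTheMinSeparating.weight_le {w : G.Edge → ℝ} {a b : G.Face} {X T : Set G.Edge}
    (h : G.IsTheMinSeparating w a b X) (hT : G.IsSeparating a b T) :
    G.weight w X ≤ G.weight w T := by
  by_cases hTX : T = X
  · rw [hTX]
  · exact (h.2 T hT hTX).le

variable (G)

open Classical in
theorem two_mul_sum_edge [Fintype D] [Fintype G.Edge] {M : Type*} [AddCommMonoid M]
    (F : G.Edge → M) : ∑ d : D, F (G.edge d) = 2 • ∑ e, F e := by
  rw [← Finset.sum_fiberwise (g := G.edge), Finset.smul_sum]
  refine Finset.sum_congr rfl fun e _ => ?_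
  obtain ⟨d, rfl⟩ := G.exists_edge e
  have : Finset.univ.filter (fun x => G.edge x = G.edge d) = {d, G.opp d} := by
    ext x
    simp only [Finset.mem_filter, Finset.mem_univ, true_and, Finset.mem_insert,
      Finset.mem_singleton]
    rw [eq_comm, edge_eq_iff]
  rw [this, Finset.sum_pair (G.opp_ne d).symm, G.edge_opp, two_nsmul]

theorem card_dart [Finite D] : Nat.card D = 2 * Nat.card G.Edge := by
  have := Fintype.ofFinite D
  have := Fintype.ofFinite G.Edge
  have h := G.two_mul_sum_edge (fun _ => (1 : ℕ))
  simpa [Nat.card_eq_fintype_card] using h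

theorem ncard_darts [Finite D] (X : Set G.Edge) : (G.darts X).ncard = 2 * X.ncard := by
  classical
  have := Fintype.ofFinite D
  have := Fintype.ofFinite G.Edge
  have h := G.two_mul_sum_edge (fun e => if e ∈ X then (1 : ℕ) else 0)
  rw [Finset.sum_boole, Finset.sum_boole] at h
  rw [Set.ncard_eq_toFinset_card' , Set.ncard_eq_toFinset_card' X]
  convert h using 2
  · congr 1
    ext
    rw [Set.mem_toFinset]
    simp [darts]
  · simp only [Nat.cast_id, smul_eq_mul]
    congr 2
    ext; simp

open Classical in
theorem weight_eq_sum [Fintype G.Edge] (w : G.Edge → ℝ) (X : Set G.Edge) :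
    G.weight w X = ∑ e, if e ∈ X then w e else 0 := by
  rw [weight, finsum_mem_def, finsum_eq_sum_of_fintype]
  exact Finset.sum_congr rfl fun e _ => by simp [Set.indicator_apply]

open Classical in
theorem two_mul_weight [Fintype D] (w : G.Edge → ℝ) (X : Set G.Edge) :
    2 * G.weight w X = ∑ d : D, if G.edge d ∈ X then w (G.edge d) else 0 := by
  have := Fintype.ofFinite G.Edge
  rw [G.two_mul_sum_edge (fun e => if e ∈ X then w e else 0), weight_eq_sum]
  simp

variable {G} {w : G.Edge → ℝ}

theorem weight_mono [Finite D] (hw : ∀ e, 0 ≤ w e) {X Y : Set G.Edge} (h : X ⊆ Y) :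
    G.weight w X ≤ G.weight w Y := by
  classical
  have := Fintype.ofFinite G.Edge
  rw [weight_eq_sum, weight_eq_sum]
  refine Finset.sum_le_sum fun e _ => ?_
  by_cases hx : e ∈ X
  · simp [hx, h hx]
  · simp only [hx, if_false]; split_ifs <;> simp [hw]

/-- Uncrossing: a chain among the edges incident to `U` need not leave these edges when it is
changed by a boundary. -/
theorem weight_uncross [Finite D] (hw : ∀ e, 0 ≤ w e) {U : Set G.Face} {c : Set G.Edge}
    (hc : c ⊆ G.incident U) (W : Set G.Face) :
    G.weight w (symmDiff c (G.bd (W ∩ U))) + G.weight w (G.bd (U ∪ W)) ≤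
      G.weight w (symmDiff c (G.bd W)) + G.weight w (G.bd U) := by
  classical
  have := Fintype.ofFinite D
  have h2 : ∀ a b c d : ℝ, 2 * a + 2 * b ≤ 2 * c + 2 * d → a + b ≤ c + d := by
    intros; linarith
  apply h2
  simp only [two_mul_weight, ← Finset.sum_add_distrib]
  refine Finset.sum_le_sum fun d _ => ?_
  have hd := hw (G.edge d)
  -- Counted by darts, the inequality becomes a finite check of membership. It fails only for an
  -- edge of `c` with both faces outside `U` and exactly one of them in `W`; this is what `hc`
  -- excludes.
  have hcd : G.edge d ∈ c → G.face d ∈ U ∨ G.face (G.opp d) ∈ U :=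
    fun h => G.mem_incident.1 (hc h)
  simp only [Set.mem_symmDiff, mem_bd, Set.mem_inter_iff, Set.mem_union]
  by_cases h1 : G.edge d ∈ c <;> by_cases h2 : G.face d ∈ U <;>
    by_cases h3 : G.face (G.opp d) ∈ U <;> by_cases h4 : G.face d ∈ W <;>
    by_cases h5 : G.face (G.opp d) ∈ W <;> simp [h1, h2, h3, h4, h5] at hcd ⊢ <;> linarith

theorem Connected.eq_univ {G : EmbGraph D} (hG : G.Connected) {A : Set D}
    (h1 : ∀ d ∈ A, G.opp d ∈ A) (h2 : ∀ d ∈ A, G.next d ∈ A) (hA : A.Nonempty) :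
    A = Set.univ := by
  obtain ⟨d, hd⟩ := hA
  refine Set.eq_univ_of_forall fun e => ?_
  have := hG.2 d e
  induction this with
  | refl => exact hd
  | tail _ h ih => rcases h with rfl | rfl <;> [exact h1 _ ih; exact h2 _ ih]

theorem connected_of_closed {G : EmbGraph D} [hD : Nonempty D]
    (h : ∀ A : Set D, (∀ d ∈ A, G.opp d ∈ A) → (∀ d ∈ A, G.next d ∈ A) → A.Nonempty →
      A = Set.univ) : G.Connected := by
  refine ⟨hD, fun d e => ?_⟩
  have := h {e | Relation.ReflTransGen (fun x y => y = G.opp x ∨ y = G.next x) d e}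
    (fun d hd => hd.tail (Or.inl rfl)) (fun d hd => hd.tail (Or.inr rfl)) ⟨d, .refl⟩
  exact Set.eq_univ_iff_forall.1 this e

/-- The darts whose left face is in `U` are closed under `next` always, and under `opp` because no
edge separates `U` from its complement. -/
theorem Connected.eq_of_bd_empty {G : EmbGraph D} (hG : G.Connected) {U : Set G.Face}
    (h : G.bd U = ∅) (hU : U.Nonempty) : U = Set.univ := by
  have hb : ∀ d, G.face d ∈ U ↔ G.face (G.opp d) ∈ U := fun d => by
    by_contra hd
    have := G.mem_bd.2 hd
    rw [h] at this
    exact this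
  have := hG.eq_univ (A := {d | G.face d ∈ U}) (fun d hd => (hb d).1 hd)
    (fun d hd => by simpa [face_next] using hd) (by
      obtain ⟨f, hf⟩ := hU
      obtain ⟨d, rfl⟩ := G.exists_face f
      exact ⟨d, hf⟩)
  refine Set.eq_univ_of_forall fun f => ?_
  obtain ⟨d, rfl⟩ := G.exists_face f
  exact Set.eq_univ_iff_forall.1 this d

/-- The side of `a` of the minimum `ab`-separating subgraph is connected. -/
theorem IsTheMinSeparating.sameSide [Finite D] (hG : G.Connected) (hw : ∀ e, 0 ≤ w e)
    {a b : G.Face} {U : Set G.Face} (h : G.IsTheMinSeparating w a b (G.bd U)) (ha : a ∈ U)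
    (hb : b ∉ U) {f : G.Face} (hf : f ∈ U) : G.SameSide (G.bd U) a f := by
  -- The component of `a` in `U`. Its boundary lies in `bd U`, so unique minimality makes the two
  -- equal. What is left of `U` then has empty boundary, hence is empty, since otherwise it would be
  -- everything and contain `b`.
  set U₀ : Set G.Face := {f | f ∈ U ∧ G.SameSide (G.bd U) a f} with hU₀
  have key : ∀ d, G.face d ∈ U₀ → G.face (G.opp d) ∈ U → G.face (G.opp d) ∈ U₀ := by
    intro d hd hd'
    refine ⟨hd', hd.2.trans _ _ _ (.rel _ _ ⟨d, ?_, rfl, rfl⟩)⟩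
    rw [mem_bd]
    have := hd.1
    tauto
  have key' : ∀ d, G.face (G.opp d) ∈ U₀ → G.face d ∈ U → G.face d ∈ U₀ := by
    intro d hd hd'
    have := key (G.opp d)
    rw [G.opp_opp] at this
    exact this hd hd'
  have hsub : U₀ ⊆ U := fun f hf => hf.1
  have hbd : G.bd U₀ ⊆ G.bd U := by
    rintro e ⟨d, rfl, h1, h2⟩
    exact ⟨d, rfl, h1.1, fun h => h2 (key d h1 h)⟩
  have heq : G.bd U₀ = G.bd U := by
    by_contra hne
    exact absurd (h.2 _ ⟨U₀, ⟨ha, .refl _⟩, fun h => hb h.1, rfl⟩ hne)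
      (not_lt.2 (weight_mono hw hbd))
  by_contra hf'
  have hne : G.bd (U \ U₀) = ∅ := by
    refine Set.eq_empty_of_forall_notMem fun e => ?_
    rintro ⟨d, rfl, h1, h2⟩
    by_cases hd : G.face (G.opp d) ∈ U
    · have h3 : G.face (G.opp d) ∈ U₀ := by
        by_contra h3; exact h2 ⟨hd, h3⟩
      exact h1.2 (key' d h3 h1.1)
    · have : G.edge d ∈ G.bd U₀ := by rw [heq, mem_bd]; have := h1.1; tauto
      rw [mem_bd] at this
      have h4 : G.face (G.opp d) ∉ U₀ := fun h => hd h.1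
      have := h1.2
      tauto
  have := hG.eq_of_bd_empty hne ⟨f, hf, fun h => hf' h.2⟩
  exact hb (this ▸ Set.mem_univ b : b ∈ U \ U₀).1

end Basic

end EmbGraph

namespace EmbGraph

/-! ### Walks, paths and their weights. -/

section Walks

variable {D : Type*} {G : EmbGraph D} {w : G.Edge → ℝ}

theorem IsWalk.append {x y z : G.Vertex} {L L' : List D} (h : G.IsWalk x y L)
    (h' : G.IsWalk y z L') : G.IsWalk x z (L ++ L') := by
  induction L generalizing x with
  | nil => cases h; exact h'
  | cons d L ih => exact ⟨h.1, ih h.2⟩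

theorem IsWalk.concat {x : G.Vertex} {L : List D} {d : D} (h : G.IsWalk x (G.tail d) L) :
    G.IsWalk x (G.head d) (L ++ [d]) := h.append ⟨rfl, rfl⟩

theorem IsWalk.exists_vertices {x y : G.Vertex} {L : List D} (h : G.IsWalk x y L) :
    ∃ u : ℕ → G.Vertex, u 0 = x ∧ u L.length = y ∧
      (∀ i (hi : i < L.length), G.tail L[i] = u i ∧ G.head L[i] = u (i + 1)) ∧
      L.map G.tail ++ [y] = (List.range (L.length + 1)).map u := by
  induction L generalizing x with
  | nil => exact ⟨fun _ => x, rfl, h, by simp, by cases h; simp⟩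
  | cons d L ih =>
    obtain ⟨u, h0, hl, hu, hr⟩ := ih h.2
    refine ⟨fun i => Nat.casesOn i x u, rfl, hl, ?_, ?_⟩
    · rintro (_ | i) hi
      · exact ⟨h.1, h0.symm⟩
      · exact hu i (by simpa using hi)
    · rw [List.length_cons, List.range_succ_eq_map, List.map_cons, List.map_cons, List.cons_append,
        hr, h.1, List.map_map]
      rfl

theorem IsPath.exists_vertices {x y : G.Vertex} {L : List D} (h : G.IsPath x y L) :
    ∃ u : ℕ → G.Vertex, u 0 = x ∧ u L.length = y ∧
      (∀ i (hi : i < L.length), G.tail L[i] = u i ∧ G.head L[i] = u (i + 1)) ∧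
      Set.InjOn u (Set.Iic L.length) := by
  obtain ⟨u, h0, hl, hu, hr⟩ := h.1.exists_vertices
  refine ⟨u, h0, hl, hu, ?_⟩
  have := h.2
  rw [hr] at this
  intro i hi j hj hij
  exact List.inj_on_of_nodup_map this (by simpa [Nat.lt_succ_iff] using hi)
    (by simpa [Nat.lt_succ_iff] using hj) hij

theorem IsPath.of_cons {x y : G.Vertex} {d : D} {L : List D} (h : G.IsPath x y (d :: L)) :
    G.IsPath (G.head d) y L := by
  refine ⟨h.1.2, ?_⟩
  have := h.2
  rw [List.map_cons, List.cons_append, List.nodup_cons] at this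
  exact this.2

theorem IsPath.exists_suffix {x y v : G.Vertex} {L : List D} (h : G.IsPath x y L)
    (hv : v ∈ L.map G.tail ++ [y]) : ∃ P, G.IsPath v y P ∧ P <:+ L := by
  induction L generalizing x with
  | nil =>
    have : v = y := by simpa using hv
    subst this
    exact ⟨[], ⟨rfl, by simp⟩, List.suffix_refl _⟩
  | cons d L ih =>
    rw [List.map_cons, List.cons_append, List.mem_cons] at hv
    rcases hv with rfl | hv
    · have := h.1.1
      subst this
      exact ⟨_, h, List.suffix_refl _⟩
    · obtain ⟨P, hP, hs⟩ := ih h.of_cons hv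
      exact ⟨P, hP, hs.trans (List.suffix_cons _ _)⟩

/-- Loop erasure. That the path is a sublist is what later bounds its weight and keeps its edges in
a prescribed set. -/
theorem IsWalk.exists_path {x y : G.Vertex} {L : List D} (h : G.IsWalk x y L) :
    ∃ P, G.IsPath x y P ∧ P.Sublist L := by
  induction L generalizing x with
  | nil => exact ⟨[], ⟨h, by simp⟩, List.Sublist.refl _⟩
  | cons d L ih =>
    obtain ⟨P, hP, hs⟩ := ih h.2
    by_cases hx : x ∈ P.map G.tail ++ [y]
    · obtain ⟨P', hP', hs'⟩ := hP.exists_suffix hx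
      exact ⟨P', hP', (hs'.sublist.trans hs).trans (List.sublist_cons_self _ _)⟩
    · refine ⟨d :: P, ⟨⟨h.1, hP.1⟩, ?_⟩, hs.cons_cons d⟩
      rw [List.map_cons, List.cons_append, List.nodup_cons, h.1]
      exact ⟨hx, hP.2⟩

theorem IsWalk.head_mem {x y : G.Vertex} {L : List D} (h : G.IsWalk x y L) {d : D} (hd : d ∈ L) :
    G.head d ∈ L.map G.tail ++ [y] := by
  induction L generalizing x with
  | nil => simp at hd
  | cons e L ih =>
    rcases List.mem_cons.1 hd with rfl | hd
    · cases L with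
      | nil => cases h.2; simp
      | cons e' L => rw [← h.2.1]; simp
    · have := ih h.2 hd
      rw [List.map_cons, List.cons_append]
      exact List.mem_cons_of_mem _ this

theorem IsPath.nodup_edges {x y : G.Vertex} {L : List D} (h : G.IsPath x y L) :
    (L.map G.edge).Nodup := by
  induction L generalizing x with
  | nil => simp
  | cons d L ih =>
    rw [List.map_cons, List.nodup_cons]
    refine ⟨fun hmem => ?_, ih h.of_cons⟩
    have hnd := h.2
    rw [List.map_cons, List.cons_append, List.nodup_cons] at hnd
    obtain ⟨e, he, hed⟩ := List.mem_map.1 hmem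
    rcases G.edge_eq_iff.1 hed with rfl | rfl
    · exact hnd.1 (List.mem_append_left _ (List.mem_map_of_mem he))
    · have := h.of_cons.1.head_mem he
      exact hnd.1 this

theorem IsPath.nodup {x y : G.Vertex} {L : List D} (h : G.IsPath x y L) : L.Nodup :=
  (List.Nodup.of_map _ (List.nodup_append.1 h.2).1)

theorem mem_walkChain [DecidableEq G.Edge] {L : List D} {e : G.Edge} :
    e ∈ G.walkChain L ↔ Odd ((L.map G.edge).count e) := by
  rw [walkChain, Set.mem_ofPred_eq]
  congr!

theorem walkChain_subset (L : List D) : G.walkChain L ⊆ G.walkEdges L := by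
  classical
  intro e he
  by_contra h
  have h' : e ∉ L.map G.edge := h
  rw [mem_walkChain, List.count_eq_zero_of_not_mem h'] at he
  simp at he

theorem walkChain_eq {L : List D} (h : (L.map G.edge).Nodup) : G.walkChain L = G.walkEdges L := by
  classical
  refine Set.Subset.antisymm (walkChain_subset L) fun e he => ?_
  rw [mem_walkChain, List.count_eq_one_of_mem h he]
  exact odd_one

theorem mem_walkEdges {L : List D} {d : D} :
    G.edge d ∈ G.walkEdges L ↔ d ∈ L ∨ G.opp d ∈ L := by
  change G.edge d ∈ L.map G.edge ↔ _
  rw [List.mem_map]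
  constructor
  · rintro ⟨e, he, h⟩
    rcases G.edge_eq_iff.1 h.symm with rfl | rfl <;> simp [he]
  · rintro (h | h)
    · exact ⟨d, h, rfl⟩
    · exact ⟨_, h, G.edge_opp d⟩

theorem weight_walkEdges_le [Finite D] (hw : ∀ e, 0 ≤ w e) (L : List D) :
    G.weight w (G.walkEdges L) ≤ G.walkWeight w L := by
  classical
  have := Fintype.ofFinite G.Edge
  induction L with
  | nil => simp [weight_eq_sum, walkEdges, walkWeight]
  | cons d L ih =>
    have h1 : G.walkWeight w (d :: L) = w (G.edge d) + G.walkWeight w L := by simp [walkWeight]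
    rw [h1]
    refine le_trans ?_ (add_le_add_right ih _)
    rw [weight_eq_sum, weight_eq_sum, ← Finset.sum_ite_eq' Finset.univ (G.edge d) w |>.trans
      (if_pos (Finset.mem_univ _)), ← Finset.sum_add_distrib]
    refine Finset.sum_le_sum fun e _ => ?_
    have key : ∀ (p q r : Prop) [Decidable p] [Decidable q] [Decidable r], (r ↔ p ∨ q) →
        (if r then w e else 0) ≤ (if p then w e else 0) + if q then w e else 0 := by
      intro p q r _ _ _ hr
      have := hw e
      by_cases hp : p <;> by_cases hq : q <;> simp [hp, hq, hr, this]
    exact key _ _ _ (by simp [walkEdges])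

theorem walkWeight_eq [Finite D] {L : List D} (h : (L.map G.edge).Nodup) :
    G.walkWeight w L = G.weight w (G.walkEdges L) := by
  classical
  have := Fintype.ofFinite G.Edge
  rw [weight_eq_sum, ← Finset.sum_filter, walkWeight]
  have h2 := List.sum_toFinset w h
  rw [List.map_map] at h2
  rw [show (fun d => w (G.edge d)) = w ∘ G.edge from rfl, ← h2]
  refine Finset.sum_congr ?_ fun _ _ => rfl
  ext e
  simp [walkEdges]

theorem walkWeight_le_of_sublist (hw : ∀ e, 0 ≤ w e) {L L' : List D} (h : L.Sublist L') :
    G.walkWeight w L ≤ G.walkWeight w L' := by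
  refine List.Sublist.sum_le_sum (h.map _) fun a ha => ?_
  obtain ⟨d, _, rfl⟩ := List.mem_map.1 ha
  exact hw _

end Walks

/-! ### ℤ₂-chains as functions on darts, and their boundaries. -/

section Chains

variable {D : Type*} (G : EmbGraph D)

open Classical in
/-- The characteristic function, on darts, of a set of edges. -/
noncomputable def chain (X : Set G.Edge) (d : D) : ZMod 2 := if G.edge d ∈ X then 1 else 0

theorem chain_opp (X : Set G.Edge) (d : D) : G.chain X (G.opp d) = G.chain X d := by
  unfold chain; rw [edge_opp]

theorem chain_symmDiff (X Y : Set G.Edge) :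
    G.chain (symmDiff X Y) = G.chain X + G.chain Y := by
  ext d
  by_cases h1 : G.edge d ∈ X <;> by_cases h2 : G.edge d ∈ Y <;>
    simp [chain, Set.mem_symmDiff, h1, h2, CharTwo.add_self_eq_zero]

theorem chain_eq_one {X : Set G.Edge} {d : D} : G.chain X d = 1 ↔ G.edge d ∈ X := by
  simp [chain]

theorem exists_chain_eq {z : D → ZMod 2} (hz : ∀ d, z (G.opp d) = z d) :
    ∃ X, G.chain X = z := by
  refine ⟨{e | ∃ d, G.edge d = e ∧ z d = 1}, ?_⟩
  ext d
  have h : G.edge d ∈ {e | ∃ d, G.edge d = e ∧ z d = 1} ↔ z d = 1 := by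
    constructor
    · rintro ⟨e, he, h⟩
      rcases G.edge_eq_iff.1 he with rfl | rfl
      · exact h
      · rwa [hz]
    · exact fun h => ⟨d, rfl, h⟩
  rw [chain, h]
  have : ∀ a : ZMod 2, (if a = 1 then (1 : ZMod 2) else 0) = a := by decide
  convert this (z d)

theorem chain_walkChain [DecidableEq D] (L : List D) (d : D) : G.chain (G.walkChain L) d =
    (L.map fun e => (if d = e then (1 : ZMod 2) else 0) + if d = G.opp e then 1 else 0).sum := by
  classical
  have h1 : G.chain (G.walkChain L) d = ((L.map G.edge).count (G.edge d) : ZMod 2) := by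
    by_cases h : Odd ((L.map G.edge).count (G.edge d))
    · rw [(ZMod.natCast_eq_one_iff_odd).2 h, chain_eq_one, mem_walkChain]
      exact h
    · rw [(ZMod.natCast_eq_zero_iff_even).2 (Nat.not_odd_iff_even.1 h), chain, if_neg]
      rwa [mem_walkChain]
  rw [h1]
  clear h1
  induction L with
  | nil => simp
  | cons e L ih =>
    rw [List.map_cons, List.count_cons, Nat.cast_add, ih, List.map_cons, List.sum_cons, add_comm]
    congr 1
    have h2 : ∀ e, e ≠ G.opp e := fun e => (G.opp_ne e).symm
    by_cases h : G.edge e = G.edge d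
    · rcases G.edge_eq_iff.1 h with rfl | rfl
      · simp [h2]
      · simp [edge_opp, (h2 _).symm]
    · have h3 : d ≠ e := fun h' => h (by rw [h'])
      have h4 : d ≠ G.opp e := fun h' => h (by rw [h', edge_opp])
      simp [h, h3, h4]

variable [Fintype D]

/-- The pairing of the boundary of a chain with a function on the vertices. -/
noncomputable def bdry (z : D → ZMod 2) (φ : G.Vertex → ZMod 2) : ZMod 2 :=
  ∑ d, z d * φ (G.tail d)

theorem bdry_add (z z' : D → ZMod 2) (φ : G.Vertex → ZMod 2) :
    G.bdry (z + z') φ = G.bdry z φ + G.bdry z' φ := by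
  simp [bdry, add_mul, Finset.sum_add_distrib]

/-- Around a vertex, the face to the right of a dart is the face to the left of the preceding dart
in the rotation. Reindexing by `rot` therefore turns the sum over right faces into the sum over left
faces, and the two cancel. -/
theorem bdry_bd (U : Set G.Face) (φ : G.Vertex → ZMod 2) : G.bdry (G.chain (G.bd U)) φ = 0 := by
  classical
  have h : ∀ d, G.chain (G.bd U) d =
      (if G.face d ∈ U then 1 else 0) + if G.face (G.opp d) ∈ U then 1 else 0 := by
    intro d
    simp only [chain, mem_bd]
    by_cases h1 : G.face d ∈ U <;> by_cases h2 : G.face (G.opp d) ∈ U <;>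
      simp [h1, h2, CharTwo.add_self_eq_zero]
  simp only [bdry, h, add_mul, Finset.sum_add_distrib]
  rw [← Equiv.sum_comp G.rot (fun d => (if G.face (G.opp d) ∈ U then (1 : ZMod 2) else 0) *
    φ (G.tail d))]
  simp only [face_opp_rot, tail_rot]
  exact CharTwo.add_self_eq_zero _

theorem bdry_walkChain {x y : G.Vertex} {L : List D} (h : G.IsWalk x y L)
    (φ : G.Vertex → ZMod 2) : G.bdry (G.chain (G.walkChain L)) φ = φ x + φ y := by
  classical
  simp only [bdry, chain_walkChain]
  induction L generalizing x with
  | nil => cases h; simp [CharTwo.add_self_eq_zero]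
  | cons e L ih =>
    simp only [List.map_cons, List.sum_cons, add_mul, Finset.sum_add_distrib, ih h.2]
    simp only [ite_mul, one_mul, zero_mul, Finset.sum_ite_eq', Finset.mem_univ, if_true, h.1]
    rw [show G.tail (G.opp e) = G.head e from rfl, add_assoc, ← add_assoc (φ (G.head e)),
      CharTwo.add_self_eq_zero, zero_add]

variable {G}

/-- Pair the chain with the indicator of the vertices reachable from `x` along `X`. Every edge of
`X` has both or neither end reachable, so the pairing vanishes, and `y` must be reachable along with
`x`. -/
theorem exists_walk_of_bdry {x y : G.Vertex} {X : Set G.Edge}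
    (h : ∀ φ, G.bdry (G.chain X) φ = φ x + φ y) :
    ∃ L, G.IsWalk x y L ∧ ∀ d ∈ L, G.edge d ∈ X := by
  classical
  set R : Set G.Vertex := {v | ∃ L, G.IsWalk x v L ∧ ∀ d ∈ L, G.edge d ∈ X} with hR
  have hx : x ∈ R := ⟨[], rfl, by simp⟩
  have step : ∀ d, G.edge d ∈ X → G.tail d ∈ R → G.head d ∈ R := by
    rintro d hd ⟨L, hL, hL'⟩
    refine ⟨L ++ [d], hL.concat, fun e he => ?_⟩
    rcases List.mem_append.1 he with he | he
    · exact hL' e he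
    · rw [List.mem_singleton.1 he]; exact hd
  have step' : ∀ d, G.edge d ∈ X → (G.tail d ∈ R ↔ G.head d ∈ R) := fun d hd =>
    ⟨step d hd, fun h => by
      have := step (G.opp d) (by rwa [edge_opp]) h
      rwa [head_opp] at this⟩
  have h0 : G.bdry (G.chain X) (fun v => if v ∈ R then 1 else 0) = 0 := by
    refine Finset.sum_involution (fun d _ => G.opp d) (fun d _ => ?_) (fun d _ _ => G.opp_ne d)
      (fun d _ => Finset.mem_univ _) fun d _ => G.opp_opp d
    rw [chain_opp]
    by_cases hd : G.edge d ∈ X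
    · have : G.tail (G.opp d) ∈ R ↔ G.tail d ∈ R := (step' d hd).symm
      simp only [if_congr this rfl rfl]
      exact CharTwo.add_self_eq_zero _
    · simp [chain, hd]
  rw [h, if_pos hx] at h0
  by_contra hy
  have hy' : y ∉ R := hy
  rw [if_neg hy'] at h0
  exact absurd h0 (by decide)

end Chains

end EmbGraph

namespace EmbGraph

/-! ### Simple cycles: cyclic parametrization, and extraction from ℤ₂-cycles. -/

section Cycles

variable {D : Type*} {G : EmbGraph D}

/-- `c` lists the darts of the simple cycle `C` in cyclic order. -/
structure IsCycleParam (G : EmbGraph D) (C : Set G.Edge) {n : ℕ} (c : ZMod n → D) : Prop where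
  head_eq : ∀ i, G.head (c i) = G.tail (c (i + 1))
  tail_inj : ∀ i j, G.tail (c i) = G.tail (c j) → i = j
  ne_opp : ∀ i j, c i ≠ G.opp (c j)
  mem_iff : ∀ d, G.edge d ∈ C ↔ ∃ i, d = c i ∨ d = G.opp (c i)

theorem IsSimpleCycle.exists_param {C : Set G.Edge} (h : G.IsSimpleCycle C) :
    ∃ (n : ℕ) (_ : NeZero n) (c : ZMod n → D), G.IsCycleParam C c := by
  obtain ⟨x, L, hne, hw, ht, he, rfl⟩ := h
  have hn : L.length ≠ 0 := by simpa using hne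
  have : NeZero L.length := ⟨hn⟩
  obtain ⟨u, hu0, hul, hu, -⟩ := hw.exists_vertices
  have hlt : ∀ i : ZMod L.length, i.val < L.length := fun i => ZMod.val_lt i
  have huinj : ∀ i j, i < L.length → j < L.length → u i = u j → i = j := by
    intro i j hi hj hij
    have h1 := (hu i hi).1
    have h2 := (hu j hj).1
    rw [← h1, ← h2] at hij
    exact (List.Nodup.getElem_inj_iff ht (hi := by simpa using hi) (hj := by simpa using hj)).1
      (by simpa using hij)
  refine ⟨L.length, this, fun i => L[i.val]'(hlt i), fun i => ?_, fun i j hij => ?_,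
    fun i j hij => ?_, fun d => ?_⟩
  · rw [(hu _ (hlt i)).2, (hu _ (hlt _)).1]
    by_cases hi : i.val + 1 < L.length
    · have : (i + 1).val = i.val + 1 := by
        have h2 : ((i.val + 1 : ℕ) : ZMod L.length) = i + 1 := by
          rw [Nat.cast_add, ZMod.natCast_zmod_val, Nat.cast_one]
        rw [← h2, ZMod.val_natCast, Nat.mod_eq_of_lt hi]
      rw [this]
    · have h1 : i.val + 1 = L.length := le_antisymm (hlt i) (not_lt.1 hi)
      have h2 : i + 1 = 0 := by
        have h2 : ((i.val + 1 : ℕ) : ZMod L.length) = i + 1 := by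
          rw [Nat.cast_add, ZMod.natCast_zmod_val, Nat.cast_one]
        rw [← h2, h1]; simp
      rw [h2, h1, hul, ZMod.val_zero, hu0]
  · rw [(hu _ (hlt i)).1, (hu _ (hlt j)).1] at hij
    exact ZMod.val_injective _ (huinj _ _ (hlt i) (hlt j) hij)
  · have h1 : G.edge (L[i.val]'(hlt i)) = G.edge (L[j.val]'(hlt j)) := by
      rw [hij, edge_opp]
    have h2 : i.val = j.val :=
      (List.Nodup.getElem_inj_iff he (hi := by simpa using hlt i) (hj := by simpa using hlt j)).1
        (by simpa using h1)
    have h3 := ZMod.val_injective _ h2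
    subst h3
    exact G.opp_ne _ hij.symm
  · rw [mem_walkEdges]
    have key : ∀ e, e ∈ L ↔ ∃ i : ZMod L.length, e = L[i.val]'(hlt i) := by
      intro e
      rw [List.mem_iff_getElem]
      constructor
      · rintro ⟨i, hi, rfl⟩
        refine ⟨(i : ZMod L.length), ?_⟩
        congr 1
        rw [ZMod.val_natCast, Nat.mod_eq_of_lt hi]
      · rintro ⟨i, rfl⟩
        exact ⟨i.val, hlt i, rfl⟩
    rw [key, key, ← exists_or]
    simp only [opp_eq_comm]

namespace IsCycleParam

variable {C : Set G.Edge} {n : ℕ} {c : ZMod n → D}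

theorem mem (h : G.IsCycleParam C c) (i : ZMod n) : G.edge (c i) ∈ C :=
  (h.mem_iff _).2 ⟨i, Or.inl rfl⟩

theorem mem_opp (h : G.IsCycleParam C c) (i : ZMod n) : G.edge (G.opp (c i)) ∈ C :=
  (h.mem_iff _).2 ⟨i, Or.inr rfl⟩

theorem eq_or_of_tail (h : G.IsCycleParam C c) {d : D} (hd : G.edge d ∈ C) {i : ZMod n}
    (ht : G.tail d = G.tail (c (i + 1))) : d = c (i + 1) ∨ d = G.opp (c i) := by
  obtain ⟨j, rfl | rfl⟩ := (h.mem_iff d).1 hd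
  · rw [h.tail_inj _ _ ht]; exact Or.inl rfl
  · have h1 : G.head (c j) = G.tail (c (i + 1)) := ht
    rw [h.head_eq] at h1
    rw [add_right_cancel (h.tail_inj _ _ h1)]
    exact Or.inr rfl

theorem inj (h : G.IsCycleParam C c) : Function.Injective c :=
  fun i j hij => h.tail_inj i j (by rw [hij])

end IsCycleParam

/-- A function on a cyclic order that may jump at one place only has no jump there either. This lets
each side of a cycle be treated as one piece although an arc ends on it. -/
theorem eq_of_succ_of_ne {α : Type*} {n : ℕ} [NeZero n] (f : ZMod n → α) (i₀ : ZMod n)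
    (h : ∀ i, i ≠ i₀ → f (i + 1) = f i) (i : ZMod n) : f i = f (i₀ + 1) := by
  have key : ∀ k : ℕ, k < n → f (i₀ + 1 + k) = f (i₀ + 1) := by
    intro k
    induction k with
    | zero => simp
    | succ k ih =>
      intro hk
      rw [Nat.cast_succ, ← add_assoc, h, ih (by omega)]
      intro h0
      have h1 : ((k + 1 : ℕ) : ZMod n) = 0 := by
        push_cast
        have : i₀ + ((k : ZMod n) + 1) = i₀ + 0 := by rw [add_zero]; nth_rw 2 [← h0]; ring
        exact add_left_cancel this
      rw [ZMod.natCast_eq_zero_iff] at h1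
      exact absurd (Nat.le_of_dvd (by omega) h1) (by omega)
  have := key (i - i₀ - 1).val (ZMod.val_lt _)
  rwa [ZMod.natCast_zmod_val, show i₀ + 1 + (i - i₀ - 1) = i by ring] at this

theorem isWalk_map_range {s : ℕ → D} (hs : ∀ k, G.head (s k) = G.tail (s (k + 1))) (a n : ℕ) :
    G.IsWalk (G.tail (s a)) (G.tail (s (a + n))) ((List.range n).map fun k => s (a + k)) := by
  induction n with
  | zero => exact rfl
  | succ n ih =>
    rw [List.range_succ, List.map_append, ← add_assoc, ← hs]
    exact ih.concat

theorem bdry_simpleCycle [Fintype D] {C : Set G.Edge} (h : G.IsSimpleCycle C)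
    (φ : G.Vertex → ZMod 2) : G.bdry (G.chain C) φ = 0 := by
  obtain ⟨x, L, -, hw, -, he, rfl⟩ := h
  rw [← walkChain_eq he, G.bdry_walkChain hw, CharTwo.add_self_eq_zero]

/-- No vertex meets a ℤ₂-cycle in exactly one dart, so a walk in `X` can always be continued without
turning back. Its portion up to the first repeated vertex contains a simple cycle. -/
theorem exists_simpleCycle [Fintype D] {X : Set G.Edge}
    (h : ∀ φ, G.bdry (G.chain X) φ = 0) (hX : X.Nonempty) :
    ∃ C ⊆ X, G.IsSimpleCycle C := by
  classical
  have hnx : ∀ d : {d // G.edge d ∈ X}, ∃ e : {d // G.edge d ∈ X},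
      G.tail e.1 = G.head d.1 ∧ e.1 ≠ G.opp d.1 := by
    rintro ⟨d, hd⟩
    by_contra hcon
    push Not at hcon
    have h0 := h (fun v => if v = G.head d then 1 else 0)
    rw [bdry, Finset.sum_eq_single (G.opp d)] at h0
    · simp [chain, edge_opp, hd, head] at h0
    · intro e _ he
      by_cases he' : G.edge e ∈ X
      · have : G.tail e ≠ G.head d := fun ht => he (hcon ⟨e, he'⟩ ht)
        simp [this]
      · simp [chain, he']
    · simp
  choose nx hnx1 hnx2 using hnx
  obtain ⟨e, he⟩ := hX
  obtain ⟨d₀, rfl⟩ := G.exists_edge e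
  set s : ℕ → {d // G.edge d ∈ X} := fun k => nx^[k] ⟨d₀, he⟩ with hs
  have hsucc : ∀ k, s (k + 1) = nx (s k) := fun k => Function.iterate_succ_apply' _ _ _
  have hwalk : ∀ k, G.head (s k).1 = G.tail (s (k + 1)).1 := fun k => by rw [hsucc, hnx1]
  have hnb : ∀ k, (s (k + 1)).1 ≠ G.opp (s k).1 := fun k => by rw [hsucc]; exact hnx2 _
  have hrep : ∃ j, ∃ i < j, G.tail (s i).1 = G.tail (s j).1 := by
    obtain ⟨i, j, hij, h⟩ :=
      Finite.exists_ne_map_eq_of_infinite (fun k : ℕ => G.tail (s k).1)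
    rcases lt_or_gt_of_ne hij with h' | h'
    · exact ⟨j, i, h', h⟩
    · exact ⟨i, j, h', h.symm⟩
  obtain ⟨i, hij, hv⟩ := Nat.find_spec hrep
  set j := Nat.find hrep with hj
  have hinj : ∀ a b, a < b → b < j → G.tail (s a).1 ≠ G.tail (s b).1 :=
    fun a b hab hb h => Nat.find_min hrep hb ⟨a, hab, h⟩
  have hinj' : ∀ a b, a < j → b < j → G.tail (s a).1 = G.tail (s b).1 → a = b := by
    intro a b ha hb hab
    rcases lt_trichotomy a b with h | h | h
    · exact absurd hab (hinj a b h hb)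
    · exact h
    · exact absurd hab.symm (hinj b a h ha)
  -- An edge used in both directions before a vertex repeats would have to be used at consecutive
  -- steps, which is a turn back.
  have hedge : ∀ a b, a < b → b < j → G.edge (s a).1 ≠ G.edge (s b).1 := by
    intro a b hab hb h
    rcases G.edge_eq_iff.1 h with h | h
    · exact hinj a b hab hb (by rw [h])
    · have h1 : G.tail (s b).1 = G.tail (s (a + 1)).1 := by rw [h, ← hwalk]; rfl
      have h2 := hinj' b (a + 1) hb (by omega) h1
      subst h2
      exact hnb a h
  set L := (List.range (j - i)).map fun k => (s (i + k)).1 with hL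
  have hLw : G.IsWalk (G.tail (s i).1) (G.tail (s i).1) L := by
    have := isWalk_map_range (s := fun k => (s k).1) hwalk i (j - i)
    rwa [Nat.add_sub_cancel' hij.le, ← hv] at this
  refine ⟨G.walkEdges L, ?_, _, L, ?_, hLw, ?_, ?_, rfl⟩
  · intro e he
    obtain ⟨d, hd, rfl⟩ := List.mem_map.1 (show e ∈ L.map G.edge from he)
    obtain ⟨k, _, rfl⟩ := List.mem_map.1 hd
    exact (s (i + k)).2
  · rw [ne_eq, ← List.length_eq_zero_iff, hL, List.length_map, List.length_range]
    omega
  · rw [hL, List.map_map]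
    refine List.Nodup.map_on ?_ List.nodup_range
    intro a ha b hb hab
    have := hinj' (i + a) (i + b) (by have := List.mem_range.1 ha; omega)
      (by have := List.mem_range.1 hb; omega) hab
    omega
  · rw [hL, List.map_map]
    refine List.Nodup.map_on ?_ List.nodup_range
    intro a ha b hb hab
    have ha' := List.mem_range.1 ha
    have hb' := List.mem_range.1 hb
    rcases lt_trichotomy a b with h | h | h
    · exact absurd hab (hedge (i + a) (i + b) (by omega) (by omega))
    · exact h
    · exact absurd hab.symm (hedge (i + b) (i + a) (by omega) (by omega))

end Cycles

end EmbGraph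

namespace EmbGraph

/-! ### Dimensions of spaces of invariant functions. -/

section Invariants

variable {D : Type*}

/-- The functions that are constant on the cycles of `τ`. -/
def inv (τ : Equiv.Perm D) : Submodule (ZMod 2) (D → ZMod 2) where
  carrier := {ψ | ∀ d, ψ (τ d) = ψ d}
  add_mem' := fun {a b} ha hb d => by rw [Pi.add_apply, Pi.add_apply, ha d, hb d]
  zero_mem' := fun _ => rfl
  smul_mem' := fun c a ha d => by rw [Pi.smul_apply, Pi.smul_apply, ha d]

theorem finrank_inv [Finite D] (τ : Equiv.Perm D) :
    Module.finrank (ZMod 2) (inv τ) = Nat.card (Quotient (Equiv.Perm.SameCycle.setoid τ)) := by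
  classical
  have := Fintype.ofFinite (Quotient (Equiv.Perm.SameCycle.setoid τ))
  let e : inv τ ≃ₗ[ZMod 2] (Quotient (Equiv.Perm.SameCycle.setoid τ) → ZMod 2) :=
    { toFun := fun ψ => Quotient.lift ψ.1 fun _ _ h => eq_of_sameCycle ψ.2 h
      map_add' := fun a b => by ext x; induction x using Quotient.inductionOn; rfl
      map_smul' := fun a b => by ext x; induction x using Quotient.inductionOn; rfl
      invFun := fun f => ⟨fun d => f (Quotient.mk _ d), fun d => congrArg f (Quotient.sound
        (Equiv.Perm.sameCycle_apply_left.2 (Equiv.Perm.SameCycle.refl _ _)))⟩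
      left_inv := fun ψ => rfl
      right_inv := fun f => by ext x; induction x using Quotient.inductionOn; rfl }
  rw [e.finrank_eq, Module.finrank_fintype_fun_eq_card, Nat.card_eq_fintype_card]

/-- The map `ψ ↦ ψ + ψ ∘ τ`. -/
def addComp (τ : Equiv.Perm D) : (D → ZMod 2) →ₗ[ZMod 2] (D → ZMod 2) :=
  LinearMap.id + LinearMap.funLeft (ZMod 2) (ZMod 2) τ

theorem addComp_apply (τ : Equiv.Perm D) (ψ : D → ZMod 2) (d : D) :
    addComp τ ψ d = ψ d + ψ (τ d) := rfl

theorem mem_ker_addComp {τ : Equiv.Perm D} {ψ : D → ZMod 2} :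
    ψ ∈ LinearMap.ker (addComp τ) ↔ ψ ∈ inv τ := by
  rw [LinearMap.mem_ker, funext_iff]
  refine forall_congr' fun d => ?_
  rw [addComp_apply, Pi.zero_apply, CharTwo.add_eq_zero, eq_comm]

theorem finrank_map_add_finrank_inf_ker {K V W : Type*} [Field K] [AddCommGroup V] [Module K V]
    [AddCommGroup W] [Module K W] [FiniteDimensional K V] (f : V →ₗ[K] W) (p : Submodule K V) :
    Module.finrank K (p.map f) + Module.finrank K (p ⊓ LinearMap.ker f : Submodule K V) =
      Module.finrank K p := by
  rw [← (f.domRestrict p).finrank_range_add_finrank_ker, LinearMap.range_domRestrict,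
    LinearMap.ker_domRestrict, ← Submodule.map_comap_subtype]
  congr 1
  exact (Submodule.finrank_map_subtype_eq _ _)

/-- The functions with support in `X`. -/
def supportedOn (X : Set D) : Submodule (ZMod 2) (D → ZMod 2) where
  carrier := {ψ | ∀ d, d ∉ X → ψ d = 0}
  add_mem' := fun {a b} ha hb d hd => by simp [ha d hd, hb d hd]
  zero_mem' := fun _ _ => rfl
  smul_mem' := fun c a ha d hd => by simp [ha d hd]

theorem finrank_supportedOn [Finite D] (X : Set D) :
    Module.finrank (ZMod 2) (supportedOn X) = X.ncard := by
  classical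
  have := Fintype.ofFinite D
  let e : supportedOn X ≃ₗ[ZMod 2] (X → ZMod 2) :=
    { toFun := fun ψ x => ψ.1 x
      map_add' := fun a b => rfl
      map_smul' := fun a b => rfl
      invFun := fun f => ⟨fun d => if h : d ∈ X then f ⟨d, h⟩ else 0, fun d hd => dif_neg hd⟩
      left_inv := fun ψ => by
        ext d
        by_cases h : d ∈ X
        · simp [h]
        · simp [h, ψ.2 d h]
      right_inv := fun f => by ext x; simp }
  rw [e.finrank_eq, Module.finrank_fintype_fun_eq_card, ← Nat.card_eq_fintype_card]
  exact Nat.card_coe_set_eq X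

/-- For an involution of `X`, half of the functions on `X` are invariant. -/
theorem ncard_le_finrank_inv [Finite D] {τ : Equiv.Perm D} (hτ : ∀ d, τ (τ d) = d) {X : Set D}
    (hX : ∀ d, d ∈ X → τ d ∈ X) :
    X.ncard ≤ 2 * Module.finrank (ZMod 2) (supportedOn X ⊓ inv τ : Submodule (ZMod 2) _) := by
  have h := finrank_map_add_finrank_inf_ker (addComp τ) (supportedOn X)
  -- For an involution the image of `addComp τ` lies in the invariants, which are also its kernel.
  -- Rank-nullity then gives half of the dimension.
  have h1 : (supportedOn X).map (addComp τ) ≤ supportedOn X ⊓ inv τ := by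
    rintro _ ⟨ψ, hψ, rfl⟩
    refine ⟨fun d hd => ?_, fun d => ?_⟩
    · have : τ d ∉ X := fun h => hd (by have := hX _ h; rwa [hτ] at this)
      rw [addComp_apply, hψ d hd, hψ _ this, add_zero]
    · rw [addComp_apply, addComp_apply, hτ, add_comm]
  have h2 : supportedOn X ⊓ LinearMap.ker (addComp τ) = supportedOn X ⊓ inv τ := by
    ext ψ
    rw [Submodule.mem_inf, Submodule.mem_inf, mem_ker_addComp]
  rw [h2, finrank_supportedOn] at h
  have := Submodule.finrank_mono h1
  omega

/-- If the involution has no fixed point in `X`, the invariant functions are sums of the functions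
`1_x + 1_(τ x)`. -/
theorem inf_inv_le_map [Finite D] {τ : Equiv.Perm D} (hτ : ∀ d, τ (τ d) = d) {X : Set D}
    (hX : ∀ d, d ∈ X → τ d ∈ X) (hne : ∀ d ∈ X, τ d ≠ d) :
    supportedOn X ⊓ inv τ ≤ (supportedOn X).map (addComp τ) := by
  classical
  have := Fintype.ofFinite D
  rintro φ ⟨hφX, hφ⟩
  let e := Fintype.equivFin D
  -- In each two-element orbit keep the value at one point only; an enumeration of `D` makes the
  -- choice.
  refine ⟨fun d => if e d < e (τ d) then φ d else 0, fun d hd => ?_, ?_⟩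
  · simp [hφX d hd]
  · ext d
    rw [addComp_apply]
    by_cases hd : d ∈ X
    · have h1 : e d ≠ e (τ d) := fun h => hne d hd (e.injective h).symm
      simp only [hτ, hφ d]
      rcases lt_or_gt_of_ne h1 with h | h
      · simp [h, h.not_gt]
      · simp [h, h.not_gt]
    · have : τ d ∉ X := fun h => hd (by have := hX _ h; rwa [hτ] at this)
      simp [hφX d hd, hφX _ this]

theorem finrank_orthogonal_dot [Fintype D] (W : Submodule (ZMod 2) (D → ZMod 2)) :
    Module.finrank (ZMod 2) W +
      Module.finrank (ZMod 2)
        (LinearMap.BilinForm.orthogonal (dotProductBilin (ZMod 2) (ZMod 2)) W) =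
      Fintype.card D := by
  classical
  rw [LinearMap.BilinForm.finrank_add_finrank_orthogonal', Module.finrank_fintype_fun_eq_card]
  have : LinearMap.ker (dotProductBilin (m := D) (A := ZMod 2) (ZMod 2) (ZMod 2)) = ⊥ := by
    rw [LinearMap.ker_eq_bot']
    intro z hz
    ext d
    have := LinearMap.congr_fun hz (Pi.single d 1)
    simpa [dotProductBilin] using this
  have h2 : W ⊓ LinearMap.ker (dotProductBilin (m := D) (A := ZMod 2) (ZMod 2) (ZMod 2)) = ⊥ := by
    rw [this, inf_bot_eq]
  erw [h2]
  simp

end Invariants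

/-! ### Neighbourhoods of spanning subgraphs, and the planarity criterion. -/

section Ribbon

variable {D : Type*} (G : EmbGraph D)

open Classical in
/-- Reversal of the darts of `H`; the other darts are fixed. -/
noncomputable def partOpp (H : Set G.Edge) : Equiv.Perm D :=
  Function.Involutive.toPerm (fun d => if G.edge d ∈ H then G.opp d else d) fun d => by
    by_cases h : G.edge d ∈ H
    · simp [h, edge_opp, G.opp_opp]
    · simp [h]

theorem partOpp_of_mem {H : Set G.Edge} {d : D} (h : G.edge d ∈ H) : G.partOpp H d = G.opp d :=
  if_pos h

theorem partOpp_of_notMem {H : Set G.Edge} {d : D} (h : G.edge d ∉ H) : G.partOpp H d = d :=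
  if_neg h

/-- The boundary walks of a neighbourhood of the spanning subgraph `H`: the walk goes along the
darts of `H`, and past the other darts. -/
noncomputable def subNext (H : Set G.Edge) : Equiv.Perm D := G.rot⁻¹ * G.partOpp H

theorem subNext_of_mem {H : Set G.Edge} {d : D} (h : G.edge d ∈ H) :
    G.subNext H d = G.next d := by
  rw [subNext, Equiv.Perm.mul_apply, G.partOpp_of_mem h, rot_inv_apply, G.opp_opp]

theorem subNext_of_notMem {H : Set G.Edge} {d : D} (h : G.edge d ∉ H) :
    G.subNext H d = G.next (G.opp d) := by
  rw [subNext, Equiv.Perm.mul_apply, G.partOpp_of_notMem h, rot_inv_apply]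

/-- The chains in `H` that bound in a neighbourhood of `H` whose boundary walks are capped. -/
noncomputable def subBd (H : Set G.Edge) : Submodule (ZMod 2) (D → ZMod 2) :=
  (inv (G.subNext H)).map (addComp (G.partOpp H))

theorem mem_subBd {H : Set G.Edge} {z : D → ZMod 2} :
    z ∈ G.subBd H ↔ ∃ ψ ∈ inv (G.subNext H), ∀ d, z d = ψ d + ψ (G.partOpp H d) := by
  constructor
  · rintro ⟨ψ, hψ, rfl⟩
    exact ⟨ψ, hψ, fun d => rfl⟩
  · rintro ⟨ψ, hψ, h⟩
    exact ⟨ψ, hψ, (funext h).symm⟩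

theorem mem_inv_rot {φ : D → ZMod 2} :
    φ ∈ inv G.rot ↔ ∃ f : G.Vertex → ZMod 2, φ = fun d => f (G.tail d) := by
  constructor
  · intro h
    exact ⟨Quotient.lift φ fun _ _ h' => eq_of_sameCycle h h', rfl⟩
  · rintro ⟨f, rfl⟩ d
    change f _ = f _
    rw [tail_rot]

/-- If every cycle in `H` bounds in a neighbourhood of `H`, then the neighbourhood is planar. -/
theorem planar_of_forall_mem_subBd [Fintype D] {H : Set G.Edge}
    (h : ∀ X ⊆ H, (∀ φ, G.bdry (G.chain X) φ = 0) → G.chain X ∈ G.subBd H) :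
    (G.darts H).ncard +
      4 * Module.finrank (ZMod 2) (inv G.rot ⊓ inv (G.partOpp H) : Submodule (ZMod 2) _) ≤
      2 * Module.finrank (ZMod 2) (inv (G.subNext H)) +
      2 * Module.finrank (ZMod 2) (inv G.rot) := by
  set B : LinearMap.BilinForm (ZMod 2) (D → ZMod 2) := dotProductBilin (ZMod 2) (ZMod 2) with hB
  have hBapply : ∀ a b, B a b = ∑ d, a d * b d := fun a b => rfl
  -- `E` consists of the chains in `H`, `R` of the functions with zero boundary, and `I` of the
  -- functions constant on the components of the spanning subgraph `H`. Write |H|, V, f and c for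
  -- the numbers of edges of `H`, vertices, boundary walks and components. As `E ⊔ R` is orthogonal
  -- to `I`, the cycle space `E ⊓ R` has dimension at least |H| − V + c. It lies in `subBd H`, whose
  -- dimension is at most f − c, since `I` is killed by `addComp`.
  set E : Submodule (ZMod 2) (D → ZMod 2) := supportedOn (G.darts H) ⊓ inv G.opp with hE
  set R := B.orthogonal (inv G.rot) with hR
  set I : Submodule (ZMod 2) (D → ZMod 2) := inv G.rot ⊓ inv (G.partOpp H) with hI
  have h1 : (G.darts H).ncard ≤ 2 * Module.finrank (ZMod 2) E :=
    ncard_le_finrank_inv G.opp_opp fun d hd => (G.opp_mem_darts H d).1 hd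
  have h2 := finrank_orthogonal_dot (inv G.rot)
  have h3 := finrank_orthogonal_dot I
  have h4 := Submodule.finrank_sup_add_finrank_inf_eq E R
  have h5 : E ⊔ R ≤ B.orthogonal I := by
    refine sup_le ?_ (LinearMap.BilinForm.orthogonal_le inf_le_left)
    rintro z ⟨hz1, hz2⟩ φ ⟨-, hφ⟩
    change B φ z = 0
    rw [hBapply]
    refine Finset.sum_involution (fun d _ => G.opp d) (fun d _ => ?_) (fun d _ _ => G.opp_ne d)
      (fun d _ => Finset.mem_univ _) fun d _ => G.opp_opp d
    by_cases hd : G.edge d ∈ H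
    · have := hφ d
      rw [G.partOpp_of_mem hd] at this
      rw [this, hz2 d]
      exact CharTwo.add_self_eq_zero _
    · rw [hz2 d, hz1 d hd]; simp
  have h6 : E ⊓ R ≤ G.subBd H := by
    rintro z ⟨⟨hz1, hz2⟩, hz3⟩
    obtain ⟨X, rfl⟩ := G.exists_chain_eq hz2
    refine h X (fun e he => ?_) fun φ => ?_
    · obtain ⟨d, rfl⟩ := G.exists_edge e
      by_contra hd
      have := hz1 d hd
      rw [G.chain_eq_one.2 he] at this
      exact one_ne_zero this
    · have := hz3 _ (G.mem_inv_rot.2 ⟨φ, rfl⟩)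
      change B _ _ = 0 at this
      rw [hBapply] at this
      rw [bdry, ← this]
      exact Finset.sum_congr rfl fun d _ => mul_comm _ _
  have h7 := finrank_map_add_finrank_inf_ker (addComp (G.partOpp H)) (inv (G.subNext H))
  have h8 : I ≤ inv (G.subNext H) ⊓ LinearMap.ker (addComp (G.partOpp H)) := by
    rintro φ ⟨hφ1, hφ2⟩
    refine ⟨fun d => ?_, mem_ker_addComp.2 hφ2⟩
    rw [subNext, Equiv.Perm.mul_apply, ← hφ1 (G.rot⁻¹ _)]
    exact (congrArg φ (G.rot.apply_symm_apply _)).trans (hφ2 d)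
  have h5' := Submodule.finrank_mono h5
  have h6' := Submodule.finrank_mono h6
  have h8' := Submodule.finrank_mono h8
  have h9 : Module.finrank (ZMod 2) (G.subBd H) =
    Module.finrank (ZMod 2) ((inv (G.subNext H)).map (addComp (G.partOpp H))) := rfl
  change Module.finrank (ZMod 2) (inv G.rot) + Module.finrank (ZMod 2) R = _ at h2
  change Module.finrank (ZMod 2) I + Module.finrank (ZMod 2) (B.orthogonal I) = _ at h3
  omega

end Ribbon

end EmbGraph

namespace EmbGraph

/-! ### Boundary walks of the two sides, untouched vertices, and cycles at a vertex. -/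

section Counting

variable {D : Type*} (G : EmbGraph D)

/-- The vertices that are not incident to an edge of `H`. -/
def untouched (H : Set G.Edge) : Set G.Vertex := {v | ∀ d, G.tail d = v → G.edge d ∉ H}

/-- A boundary walk near `U` either runs along a face of `U` or stays on darts whose left face is
outside `U`; likewise for the complement. The pieces inside their own side are old faces. The other
pieces are boundary walks of a neighbourhood of `bd U`. -/
theorem finrank_inv_subNext_incident_le [Finite D] (U : Set G.Face) :
    Module.finrank (ZMod 2) (inv (G.subNext (G.incident U))) +
      Module.finrank (ZMod 2) (inv (G.subNext (G.incident Uᶜ))) ≤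
    Module.finrank (ZMod 2) (inv G.next) +
      Module.finrank (ZMod 2) (inv (G.subNext (G.bd U))) := by
  classical
  set A := inv (G.subNext (G.incident U))
  set B := inv (G.subNext (G.incident Uᶜ))
  have hface : ∀ d, G.face (G.next d) ∈ U ↔ G.face d ∈ U := fun d => by rw [face_next]
  have hA1 : ∀ ψ ∈ A, ∀ d, G.face d ∈ U ∨ G.face (G.opp d) ∈ U → ψ (G.next d) = ψ d := by
    intro ψ hψ d hd
    rw [← G.subNext_of_mem (G.mem_incident.2 hd)]; exact hψ d
  have hA2 : ∀ ψ ∈ A, ∀ d, G.face d ∉ U → G.face (G.opp d) ∉ U →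
      ψ (G.next (G.opp d)) = ψ d := by
    intro ψ hψ d hd hd'
    rw [← G.subNext_of_notMem (H := G.incident U) (by rw [mem_incident]; tauto)]; exact hψ d
  have hB1 : ∀ ψ ∈ B, ∀ d, G.face d ∉ U ∨ G.face (G.opp d) ∉ U → ψ (G.next d) = ψ d := by
    intro ψ hψ d hd
    rw [← G.subNext_of_mem (H := G.incident Uᶜ) (G.mem_incident.2 hd)]; exact hψ d
  have hB2 : ∀ ψ ∈ B, ∀ d, G.face d ∈ U → G.face (G.opp d) ∈ U →
      ψ (G.next (G.opp d)) = ψ d := by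
    intro ψ hψ d hd hd'
    rw [← G.subNext_of_notMem (H := G.incident Uᶜ)
      (by simp only [mem_incident, Set.mem_compl_iff]; tauto)]
    exact hψ d
  -- The pair is recombined according to the side of the left face: the first component takes `A` on
  -- `U` and `B` off `U`, the second takes the opposite. Nothing is lost, whence injectivity.
  let Φ : (A × B) →ₗ[ZMod 2] (inv G.next × inv (G.subNext (G.bd U))) :=
    { toFun := fun p =>
        (⟨fun d => if G.face d ∈ U then p.1.1 d else p.2.1 d, fun d => by
            by_cases h : G.face d ∈ U
            · simp only [hface, h, if_true]; exact hA1 _ p.1.2 d (Or.inl h)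
            · simp only [hface, h, if_false]; exact hB1 _ p.2.2 d (Or.inl h)⟩,
         ⟨fun d => if G.face d ∈ U then p.2.1 d else p.1.1 d, fun d => by
            by_cases h : G.face d ∈ U <;> by_cases h' : G.face (G.opp d) ∈ U
            · rw [G.subNext_of_notMem (by rw [mem_bd]; tauto)]
              simp only [hface, h, h', if_true]; exact hB2 _ p.2.2 d h h'
            · rw [G.subNext_of_mem (G.mem_bd.2 (by tauto))]
              simp only [hface, h, if_true]; exact hB1 _ p.2.2 d (Or.inr h')
            · rw [G.subNext_of_mem (G.mem_bd.2 (by tauto))]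
              simp only [hface, h, if_false]; exact hA1 _ p.1.2 d (Or.inr h')
            · rw [G.subNext_of_notMem (by rw [mem_bd]; tauto)]
              simp only [hface, h, h', if_false]; exact hA2 _ p.1.2 d h h'⟩)
      map_add' := fun p q => by
        refine Prod.ext (Subtype.ext (funext fun d => ?_)) (Subtype.ext (funext fun d => ?_)) <;>
          by_cases h : G.face d ∈ U <;> simp [h]
      map_smul' := fun a p => by
        refine Prod.ext (Subtype.ext (funext fun d => ?_)) (Subtype.ext (funext fun d => ?_)) <;>
          by_cases h : G.face d ∈ U <;> simp [h] }
  have hΦ : Function.Injective Φ := by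
    intro p q hpq
    have h1 : ∀ d, (if G.face d ∈ U then p.1.1 d else p.2.1 d) =
        if G.face d ∈ U then q.1.1 d else q.2.1 d :=
      fun d => congrFun (congrArg (fun x => x.1.1) hpq) d
    have h2 : ∀ d, (if G.face d ∈ U then p.2.1 d else p.1.1 d) =
        if G.face d ∈ U then q.2.1 d else q.1.1 d :=
      fun d => congrFun (congrArg (fun x => x.2.1) hpq) d
    refine Prod.ext (Subtype.ext (funext fun d => ?_)) (Subtype.ext (funext fun d => ?_))
    · have h1 := h1 d
      have h2 := h2 d
      by_cases h : G.face d ∈ U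
      · simpa [h] using h1
      · simpa [h] using h2
    · have h1 := h1 d
      have h2 := h2 d
      by_cases h : G.face d ∈ U
      · simpa [h] using h2
      · simpa [h] using h1
  have := LinearMap.finrank_le_finrank_of_injective hΦ
  rwa [Module.finrank_prod, Module.finrank_prod] at this

/-- The right-hand side counts the components of the spanning subgraph `H`: each untouched vertex is
one by itself, and at least one more contains an edge. -/
theorem one_add_untouched_le [Finite D] {H : Set G.Edge} (hH : H.Nonempty) :
    1 + (G.untouched H).ncard ≤
      Module.finrank (ZMod 2) (inv G.rot ⊓ inv (G.partOpp H) : Submodule (ZMod 2) _) := by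
  classical
  have := Fintype.ofFinite (G.untouched H)
  let Φ : (Option (G.untouched H) → ZMod 2) →ₗ[ZMod 2]
      (inv G.rot ⊓ inv (G.partOpp H) : Submodule (ZMod 2) _) :=
    { toFun := fun f => ⟨fun d => if h : G.tail d ∈ G.untouched H then f (some ⟨_, h⟩)
          else f none, fun d => by simp only [tail_rot], fun d => by
            by_cases hd : G.edge d ∈ H
            · have h1 : G.tail d ∉ G.untouched H := fun h => h d rfl hd
              have h2 : G.tail (G.opp d) ∉ G.untouched H :=
                fun h => h (G.opp d) rfl (by rwa [edge_opp])
              simp only [G.partOpp_of_mem hd, h1, h2, dif_neg, not_false_eq_true]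
            · rw [G.partOpp_of_notMem hd]⟩
      map_add' := fun f g => by
        refine Subtype.ext (funext fun d => ?_)
        by_cases h : G.tail d ∈ G.untouched H <;> simp [h]
      map_smul' := fun a g => by
        refine Subtype.ext (funext fun d => ?_)
        by_cases h : G.tail d ∈ G.untouched H <;> simp [h] }
  have hΦ : Function.Injective Φ := by
    intro f g hfg
    have h1 : ∀ d, (if h : G.tail d ∈ G.untouched H then f (some ⟨_, h⟩) else f none) =
        if h : G.tail d ∈ G.untouched H then g (some ⟨_, h⟩) else g none :=
      fun d => congrFun (congrArg (fun x => x.1) hfg) d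
    ext (_ | ⟨v, hv⟩)
    · obtain ⟨e, he⟩ := hH
      obtain ⟨d, rfl⟩ := G.exists_edge e
      have h2 : G.tail d ∉ G.untouched H := fun h => h d rfl he
      simpa [h2] using h1 d
    · obtain ⟨d, rfl⟩ := G.exists_tail v
      simpa [hv] using h1 d
  have := LinearMap.finrank_le_finrank_of_injective hΦ
  rw [Module.finrank_fintype_fun_eq_card, Fintype.card_option, ← Nat.card_eq_fintype_card,
    Nat.card_coe_set_eq] at this
  omega

/-- At a vertex that `bd U` misses, all surrounding faces lie on the same side, so no edge there is
incident to the other side. -/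
theorem ncard_untouched_bd_le [Finite D] (U : Set G.Face) :
    (G.untouched (G.bd U)).ncard ≤
      (G.untouched (G.incident U)).ncard + (G.untouched (G.incident Uᶜ)).ncard := by
  refine le_trans (Set.ncard_le_ncard ?_ (Set.toFinite _)) (Set.ncard_union_le _ _)
  intro v hv
  by_contra hcon
  rw [Set.mem_union, not_or] at hcon
  have key : ∀ x y, G.tail x = v → G.tail y = v → (G.face x ∈ U ↔ G.face y ∈ U) := by
    intro x y hx hy
    have := eq_of_sameCycle (τ := G.rot) (f := fun z => (G.tail z = v → G.face z ∈ U))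
      (fun z => by
        rw [G.tail_rot]
        refine propext (forall_congr' fun hz => ?_)
        have := hv (G.rot z) (by rw [G.tail_rot, hz])
        rw [mem_bd, face_opp_rot] at this
        tauto) (G.tail_eq_iff.1 (hx.trans hy.symm))
    simpa [hx, hy] using this
  have h1 : ∃ x, G.tail x = v ∧ G.face x ∈ U := by
    by_contra h
    push Not at h
    refine hcon.1 fun d hd hd' => ?_
    have := hv d hd
    rw [mem_bd] at this
    rcases G.mem_incident.1 hd' with h' | h'
    · exact h d hd h'
    · exact h d hd (by tauto)
  have h2 : ∃ x, G.tail x = v ∧ G.face x ∉ U := by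
    by_contra h
    push Not at h
    refine hcon.2 fun d hd hd' => ?_
    have := hv d hd
    rw [mem_bd] at this
    rcases G.mem_incident.1 hd' with h' | h'
    · exact h' (h d hd)
    · exact h' (by have := h d hd; tauto)
  obtain ⟨x, hx, hxU⟩ := h1
  obtain ⟨y, hy, hyU⟩ := h2
  exact hyU ((key x y hx hy).1 hxU)

/-- The functions on darts that only change at darts of `S` along the rotation. -/
def rotInvOff (S : Set G.Edge) : Submodule (ZMod 2) (D → ZMod 2) where
  carrier := {ψ | ∀ d, G.edge d ∉ S → ψ (G.rot⁻¹ d) = ψ d}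
  add_mem' := fun {a b} ha hb d hd => by
    rw [Pi.add_apply, Pi.add_apply, ha d hd, hb d hd]
  zero_mem' := fun _ _ => rfl
  smul_mem' := fun c a ha d hd => by rw [Pi.smul_apply, Pi.smul_apply, ha d hd]

variable {G}

/-- Such a function takes at each dart the value at the last preceding dart of `S` in the rotation.
At a vertex without darts of `S` it is constant, so one representative determines it. -/
theorem eq_zero_of_mem_rotInvOff [Finite D] {S : Set G.Edge} {ψ : D → ZMod 2}
    (hψ : ψ ∈ G.rotInvOff S) (h1 : ∀ d, G.edge d ∈ S → ψ d = 0)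
    (h2 : ∀ v ∈ G.untouched S, ψ v.out = 0) : ψ = 0 := by
  classical
  have hrot : ∀ d, G.edge (G.rot d) ∉ S → ψ (G.rot d) = ψ d := by
    intro d hd
    rw [← hψ _ hd]
    exact congrArg ψ (G.rot.symm_apply_apply d)
  ext d
  by_cases hd : G.tail d ∈ G.untouched S
  · have h3 : G.tail (G.tail d).out = G.tail d := Quotient.out_eq _
    have := eq_of_sameCycle (τ := G.rot) (f := fun x => if G.tail x ∈ G.untouched S then ψ x else 0)
      (fun x => by
        by_cases hx : G.tail x ∈ G.untouched S
        · simp only [tail_rot, hx, if_true]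
          exact hrot x (hx _ (G.tail_rot x))
        · simp only [tail_rot, hx, if_false]) (G.tail_eq_iff.1 h3)
    rw [if_pos (by rwa [h3]), if_pos hd, h2 _ hd] at this
    exact this.symm
  · have : ∃ e, G.tail e = G.tail d ∧ G.edge e ∈ S := by
      by_contra h
      push Not at h
      exact hd h
    obtain ⟨e, he, heS⟩ := this
    obtain ⟨n, rfl⟩ := (G.tail_eq_iff.1 he).exists_nat_pow_eq
    clear hd he
    induction n with
    | zero => exact h1 e heS
    | succ n ih =>
      rw [pow_succ', Equiv.Perm.mul_apply]
      by_cases h : G.edge (G.rot ((G.rot ^ n) e)) ∈ S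
      · exact h1 _ h
      · rw [hrot _ h]; exact ih

theorem finrank_rotInvOff_le [Finite D] (S : Set G.Edge) :
    Module.finrank (ZMod 2) (G.rotInvOff S) ≤ (G.darts S).ncard + (G.untouched S).ncard := by
  classical
  have := Fintype.ofFinite (G.darts S)
  have := Fintype.ofFinite (G.untouched S)
  let Φ : G.rotInvOff S →ₗ[ZMod 2] ((G.darts S → ZMod 2) × (G.untouched S → ZMod 2)) :=
    { toFun := fun ψ => (fun d => ψ.1 d, fun v => ψ.1 v.1.out)
      map_add' := fun _ _ => rfl
      map_smul' := fun _ _ => rfl }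
  have hΦ : Function.Injective Φ := by
    rw [injective_iff_map_eq_zero]
    rintro ⟨ψ, hψ⟩ h0
    refine Subtype.ext (eq_zero_of_mem_rotInvOff hψ (fun d hd => ?_) fun v hv => ?_)
    · exact congrFun (congrArg Prod.fst h0) ⟨d, hd⟩
    · exact congrFun (congrArg Prod.snd h0) ⟨v, hv⟩
  have := LinearMap.finrank_le_finrank_of_injective hΦ
  rwa [Module.finrank_prod, Module.finrank_fintype_fun_eq_card, Module.finrank_fintype_fun_eq_card,
    ← Nat.card_eq_fintype_card, ← Nat.card_eq_fintype_card, Nat.card_coe_set_eq,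
    Nat.card_coe_set_eq] at this

/-- A simple cycle has two darts at each of its vertices; a function on darts that takes the same
value at the darts that follow and precede a vertex of the cycle is determined by two values. -/
theorem IsSimpleCycle.exists_partner {C : Set G.Edge} (hC : G.IsSimpleCycle C) :
    ∃ (π : D → D) (d₀ : D), G.edge d₀ ∈ C ∧ (∀ d, G.edge d ∈ C → G.edge (π d) ∈ C ∧ π d ≠ d ∧
      G.tail (π d) = G.tail d ∧
      ∀ e, G.edge e ∈ C → G.tail e = G.tail d → e = d ∨ e = π d) ∧
      ∀ ψ : D → ZMod 2, (∀ d, G.edge d ∈ C → ψ (π d) = ψ (G.opp d)) → ψ d₀ = 0 →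
        ψ (G.opp d₀) = 0 → ∀ d, G.edge d ∈ C → ψ d = 0 := by
  classical
  obtain ⟨n, _, c, hc⟩ := hC.exists_param
  have hex : ∀ d : D, ∃ e, G.edge d ∈ C → G.edge e ∈ C ∧ e ≠ d ∧ G.tail e = G.tail d ∧
      ∀ e', G.edge e' ∈ C → G.tail e' = G.tail d → e' = d ∨ e' = e := by
    intro d
    by_cases hd : G.edge d ∈ C
    · obtain ⟨i, rfl | rfl⟩ := (hc.mem_iff d).1 hd
      · obtain ⟨j, rfl⟩ : ∃ j, i = j + 1 := ⟨i - 1, by ring⟩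
        exact ⟨G.opp (c j), fun _ => ⟨hc.mem_opp j, (hc.ne_opp _ _).symm, hc.head_eq j,
          fun e' he' ht => hc.eq_or_of_tail he' ht⟩⟩
      · exact ⟨c (i + 1), fun _ => ⟨hc.mem _, hc.ne_opp _ _, (hc.head_eq i).symm,
          fun e' he' ht => (hc.eq_or_of_tail he' (ht.trans (hc.head_eq i))).symm⟩⟩
    · exact ⟨d, fun h => absurd h hd⟩
  choose π hπ using hex
  have h1 : ∀ i, π (c (i + 1)) = G.opp (c i) := fun i =>
    (((hπ _ (hc.mem (i + 1))).2.2.2 _ (hc.mem_opp i) (hc.head_eq i)).resolve_left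
      (hc.ne_opp _ _).symm).symm
  have h2 : ∀ i, π (G.opp (c i)) = c (i + 1) := fun i =>
    (((hπ _ (hc.mem_opp i)).2.2.2 _ (hc.mem (i + 1)) (hc.head_eq i).symm).resolve_left
      (hc.ne_opp _ _)).symm
  -- The condition on `ψ` carries its value from each dart of the cycle to the next, on each of the
  -- two sides separately. One value per side is therefore enough.
  refine ⟨π, c (0 + 1), hc.mem _, hπ, fun ψ hψ h0 h0' d hd => ?_⟩
  obtain ⟨i, rfl | rfl⟩ := (hc.mem_iff d).1 hd
  · rw [eq_of_succ_of_ne (fun i => ψ (c i)) 0 (fun i _ => ?_) i, h0]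
    have := hψ _ (hc.mem_opp i)
    rwa [h2, G.opp_opp] at this
  · rw [eq_of_succ_of_ne (fun i => ψ (G.opp (c i))) 0 (fun i _ => ?_) i, h0']
    have := hψ _ (hc.mem (i + 1))
    rw [h1] at this
    exact this.symm

end Counting

end EmbGraph

namespace EmbGraph

/-! ### Noncrossing matchings at vertices, and the Euler count that yields a handle. -/

section Counting

variable {D : Type*} {G : EmbGraph D}

/-- A noncrossing matching of the darts of `S` at each vertex: the matching and the rotation
together have as many cycles as in the plane. -/
theorem finrank_inv_noncrossing [Finite D] {S : Set G.Edge} {σ : Equiv.Perm D}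
    (hσ : ∀ d, σ (σ d) = d) (hS : ∀ d, G.edge d ∈ S → G.edge (σ d) ∈ S)
    (hne : ∀ d, G.edge d ∈ S → σ d ≠ d) (ht : ∀ d, G.tail (σ d) = G.tail d)
    (hnc : ∀ q i a j, G.edge q ∈ S → 0 < i → i < a → a < j →
      j < Function.minimalPeriod G.rot q → σ q = (G.rot ^ a) q →
      σ ((G.rot ^ i) q) ≠ (G.rot ^ j) q) :
    (G.darts S).ncard + 2 * Module.finrank (ZMod 2) (inv G.rot) ≤
      2 * Module.finrank (ZMod 2) (inv (G.rot⁻¹ * σ)) := by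
  classical
  have := Fintype.ofFinite D
  -- The kernel of `addComp σ` on `inv (rot⁻¹ * σ)` contains `inv rot`. It remains to see that its
  -- image contains the functions 1_q + 1_(σ q), which span a space of at least half as many
  -- dimensions as `S` has darts.
  have hmap : (supportedOn (G.darts S)).map (addComp σ) ≤
      (inv (G.rot⁻¹ * σ)).map (addComp σ) := by
    have key : ∀ q, G.edge q ∈ S →
        addComp σ (Pi.single q 1) ∈ (inv (G.rot⁻¹ * σ)).map (addComp σ) := by
      intro q hq
      set p := Function.minimalPeriod G.rot q with hp
      have hper : Function.IsPeriodicPt G.rot (orderOf G.rot) q := by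
        rw [Function.IsPeriodicPt, Function.IsFixedPt, ← Equiv.Perm.coe_pow, pow_orderOf_eq_one]
        rfl
      have hp0 : 0 < p := hper.minimalPeriod_pos (orderOf_pos _)
      have hinj : ∀ i j, i < p → j < p → (G.rot ^ i) q = (G.rot ^ j) q → i = j := by
        intro i j hi hj hij
        rw [Equiv.Perm.coe_pow, Equiv.Perm.coe_pow] at hij
        exact Function.iterate_injOn_Iio_minimalPeriod hi hj hij
      have hperp : (G.rot ^ p) q = q := by
        rw [Equiv.Perm.coe_pow]; exact Function.iterate_minimalPeriod
      have hex : ∀ d, G.tail d = G.tail q → ∃ i < p, (G.rot ^ i) q = d := by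
        intro d hd
        obtain ⟨i, rfl⟩ := (G.tail_eq_iff.1 hd.symm).exists_nat_pow_eq
        refine ⟨i % p, Nat.mod_lt _ hp0, ?_⟩
        rw [Equiv.Perm.coe_pow, Equiv.Perm.coe_pow, Function.iterate_mod_minimalPeriod_eq]
      obtain ⟨a, ha, haq⟩ := hex (σ q) (ht q)
      have ha0 : 0 < a := by
        rcases Nat.eq_zero_or_pos a with rfl | h
        · exact absurd haq.symm (hne q hq)
        · exact h
      have hidx : ∀ i j, i < p → j < p → σ ((G.rot ^ i) q) = (G.rot ^ j) q → 0 < i → i < a →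
          0 < j ∧ j < a := by
        intro i j hi hj hij h0 hia
        refine ⟨Nat.pos_of_ne_zero ?_, ?_⟩
        · rintro rfl
          have h1 : (G.rot ^ i) q = σ q := by rw [← hσ ((G.rot ^ i) q), hij]; rfl
          have := hinj _ _ hi ha (h1.trans haq.symm)
          omega
        · rcases lt_trichotomy j a with h | h | h
          · exact h
          · subst h
            rw [haq] at hij
            have := hinj i 0 hi hp0 (σ.injective hij)
            omega
          · exact absurd hij (hnc q i a j hq h0 hia h hj haq.symm)
      have hidx' : ∀ i j, i < p → j < p → σ ((G.rot ^ i) q) = (G.rot ^ j) q →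
          (0 < i ∧ i < a ↔ 0 < j ∧ j < a) := fun i j hi hj hij =>
        ⟨fun h => hidx i j hi hj hij h.1 h.2, fun h => hidx j i hj hi (by rw [← hij, hσ]) h.1 h.2⟩
      have h0a : ∀ i j, i < p → j < p → σ ((G.rot ^ i) q) = (G.rot ^ j) q → (i = 0 ↔ j = a) := by
        intro i j hi hj hij
        constructor
        · rintro rfl
          exact hinj j a hj ha (by rw [← hij, haq]; rfl)
        · rintro rfl
          rw [haq] at hij
          exact hinj i 0 hi hp0 (σ.injective hij)
      -- The indicator of the half-open arc of the rotation from `q` up to, but excluding, `σ q`.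
      -- Noncrossing says that `σ` maps the open arc between `q` and `σ q` to itself, so `ψ` is
      -- invariant under `rot⁻¹ * σ`, and `ψ + ψ ∘ σ` is supported at `q` and `σ q`.
      set ψ : D → ZMod 2 := fun d => if ∃ i < a, (G.rot ^ i) q = d then 1 else 0 with hψ
      have hψi : ∀ i < p, ψ ((G.rot ^ i) q) = if i < a then 1 else 0 := by
        intro i hi
        have : (∃ k < a, (G.rot ^ k) q = (G.rot ^ i) q) ↔ i < a :=
          ⟨fun ⟨k, hk, h⟩ => hinj k i (hk.trans ha) hi h ▸ hk, fun h => ⟨i, h, rfl⟩⟩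
        simp only [hψ, this]
      have hψ0 : ∀ d, G.tail d ≠ G.tail q → ψ d = 0 := by
        intro d hd
        refine if_neg ?_
        rintro ⟨i, -, rfl⟩
        exact hd (G.tail_rot_pow i q)
      have hψrot : ∀ i < p, ψ (G.rot⁻¹ ((G.rot ^ i) q)) = if 0 < i ∧ i ≤ a then 1 else 0 := by
        rintro (_ | i) hi
        · have : G.rot⁻¹ ((G.rot ^ 0) q) = (G.rot ^ (p - 1)) q := by
            rw [Equiv.Perm.inv_eq_iff_eq, ← Equiv.Perm.mul_apply, ← pow_succ',
              Nat.sub_add_cancel hp0, hperp]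
            rfl
          rw [this, hψi _ (by omega), if_neg (by omega), if_neg (by omega)]
        · have : G.rot⁻¹ ((G.rot ^ (i + 1)) q) = (G.rot ^ i) q := by
            rw [Equiv.Perm.inv_eq_iff_eq, ← Equiv.Perm.mul_apply, ← pow_succ']
          rw [this, hψi _ (by omega)]
          exact if_congr (by omega) rfl rfl
      refine ⟨ψ, fun d => ?_, ?_⟩
      · rw [Equiv.Perm.mul_apply]
        by_cases hd : G.tail d = G.tail q
        · obtain ⟨i, hi, rfl⟩ := hex d hd
          obtain ⟨j, hj, hij⟩ := hex (σ ((G.rot ^ i) q)) ((ht _).trans hd)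
          rw [← hij, hψrot j hj, hψi i hi]
          have h1 := hidx' i j hi hj hij.symm
          have h2 := h0a i j hi hj hij.symm
          exact if_congr (by omega) rfl rfl
        · rw [hψ0 d hd, hψ0]
          rw [← tail_rot]
          intro h
          apply hd
          rw [← ht d, ← h]
          exact congrArg G.tail (G.rot.apply_symm_apply _).symm
      · ext d
        rw [addComp_apply, addComp_apply]
        by_cases hd : G.tail d = G.tail q
        · obtain ⟨i, hi, rfl⟩ := hex d hd
          obtain ⟨j, hj, hij⟩ := hex (σ ((G.rot ^ i) q)) ((ht _).trans hd)
          have hs : ∀ k < p, (Pi.single q 1 : D → ZMod 2) ((G.rot ^ k) q) =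
              if k = 0 then 1 else 0 := by
            intro k hk
            rw [Pi.single_apply]
            exact if_congr ⟨fun h => hinj k 0 hk hp0 h, fun h => by rw [h]; rfl⟩ rfl rfl
          rw [← hij, hψi i hi, hψi j hj, hs i hi, hs j hj]
          have h1 := hidx' i j hi hj hij.symm
          have h2 := h0a i j hi hj hij.symm
          have h3 := h0a j i hj hi (by rw [hij, hσ])
          by_cases hi0 : i = 0
          · have : j = a := h2.1 hi0
            subst this
            simp [hi0, ha0, ha0.ne']
          · by_cases hj0 : j = 0
            · have : i = a := h3.1 hj0
              subst this
              simp [hj0, ha0, ha0.ne']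
            · by_cases hia : i < a
              · have : j < a := (h1.1 ⟨Nat.pos_of_ne_zero hi0, hia⟩).2
                simp [hi0, hj0, hia, this, CharTwo.add_self_eq_zero]
              · have : ¬ j < a := fun h => hia (h1.2 ⟨Nat.pos_of_ne_zero hj0, h⟩).2
                simp [hi0, hj0, hia, this]
        · have hd' : G.tail (σ d) ≠ G.tail q := by rwa [ht]
          have e1 : d ≠ q := fun h => hd (by rw [h])
          have e2 : σ d ≠ q := fun h => hd' (by rw [h])
          rw [hψ0 d hd, hψ0 _ hd', Pi.single_apply, Pi.single_apply, if_neg e1, if_neg e2]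
    rintro _ ⟨φ, hφ, rfl⟩
    rw [pi_eq_sum_univ' φ, map_sum]
    refine Submodule.sum_mem _ fun q _ => ?_
    rw [map_smul]
    by_cases hq : G.edge q ∈ S
    · refine Submodule.smul_mem _ _ ?_
      convert key q hq using 2
    · rw [hφ q hq, zero_smul]; exact Submodule.zero_mem _
  have h1 := finrank_map_add_finrank_inf_ker (addComp σ) (inv (G.rot⁻¹ * σ))
  have h2 : inv G.rot ≤ inv (G.rot⁻¹ * σ) ⊓ LinearMap.ker (addComp σ) := by
    intro φ hφ
    have hσφ : ∀ d, φ (σ d) = φ d := fun d => by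
      obtain ⟨f, rfl⟩ := G.mem_inv_rot.1 hφ
      exact congrArg f (ht d)
    refine ⟨fun d => ?_, mem_ker_addComp.2 hσφ⟩
    rw [Equiv.Perm.mul_apply, ← hφ (G.rot⁻¹ _)]
    exact (congrArg φ (G.rot.apply_symm_apply _)).trans (hσφ d)
  have h3 := ncard_le_finrank_inv hσ (X := G.darts S) hS
  have h4 := (inf_inv_le_map hσ (X := G.darts S) hS hne).trans hmap
  have h2' := Submodule.finrank_mono h2
  have h4' := Submodule.finrank_mono h4
  omega

/-- The number of boundary walks of a neighbourhood of `S`, when `S` has a decomposition into `k`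
noncrossing cycles. -/
theorem finrank_inv_subNext_le [Finite D] {S : Set G.Edge} {𝒞 : Set (Set G.Edge)}
    (h𝒞 : G.IsCycleDecomposition S 𝒞) :
    2 * Module.finrank (ZMod 2) (inv (G.subNext S)) + 2 * Module.finrank (ZMod 2) (inv G.rot) ≤
      4 * 𝒞.ncard + 4 * (G.untouched S).ncard + (G.darts S).ncard := by
  classical
  obtain ⟨hcyc, hunion, hdisj, hcross⟩ := h𝒞
  have hmemS : ∀ C ∈ 𝒞, ∀ d, G.edge d ∈ C → G.edge d ∈ S := fun C hC d hd =>
    hunion ▸ Set.mem_sUnion_of_mem hd hC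
  have hexC : ∀ d, G.edge d ∈ S → ∃ C ∈ 𝒞, G.edge d ∈ C := fun d hd => by
    rw [← hunion] at hd; exact hd
  have huniq : ∀ C ∈ 𝒞, ∀ C' ∈ 𝒞, ∀ e, e ∈ C → e ∈ C' → C = C' := by
    intro C hC C' hC' e h h'
    by_contra hne
    exact Set.disjoint_left.1 (hdisj hC hC' hne) h h'
  choose π d₀ hd₀ hπ hzero using fun C : 𝒞 => (hcyc C C.2).exists_partner
  have hexC' : ∀ d : {d // G.edge d ∈ S}, ∃ C : 𝒞, G.edge d.1 ∈ C.1 := fun d => by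
    obtain ⟨C, hC, hd⟩ := hexC d.1 d.2
    exact ⟨⟨C, hC⟩, hd⟩
  choose K hK using hexC'
  set σf : D → D := fun d => if h : G.edge d ∈ S then π (K ⟨d, h⟩) d else d with hσf
  have hσC : ∀ (C : 𝒞) d, G.edge d ∈ C.1 → σf d = π C d := by
    intro C d hd
    have hdS := hmemS C C.2 d hd
    have : K ⟨d, hdS⟩ = C := Subtype.ext (huniq _ (K ⟨d, hdS⟩).2 _ C.2 _ (hK ⟨d, hdS⟩) hd)
    simp only [hσf, hdS, dif_pos, this]
  have hσS : ∀ d, G.edge d ∉ S → σf d = d := fun d hd => dif_neg hd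
  have hσσ : Function.Involutive σf := by
    intro d
    by_cases hd : G.edge d ∈ S
    · obtain ⟨C, hC⟩ : ∃ C : 𝒞, G.edge d ∈ C.1 := ⟨_, hK ⟨d, hd⟩⟩
      obtain ⟨h1, h2, h3, h4⟩ := hπ C d hC
      rw [hσC C d hC, hσC C _ h1]
      exact ((hπ C _ h1).2.2.2 d hC h3.symm).elim (fun h => absurd h.symm h2) Eq.symm
    · rw [hσS d hd, hσS d hd]
  set σ : Equiv.Perm D := hσσ.toPerm with hσ
  have hσC' : ∀ (C : 𝒞) d, G.edge d ∈ C.1 → σ d = π C d := hσC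
  have hS : ∀ d, G.edge d ∈ S → G.edge (σ d) ∈ S := by
    intro d hd
    rw [hσC' _ d (hK ⟨d, hd⟩)]
    exact hmemS _ (K ⟨d, hd⟩).2 _ (hπ _ d (hK ⟨d, hd⟩)).1
  have hne : ∀ d, G.edge d ∈ S → σ d ≠ d := by
    intro d hd
    rw [hσC' _ d (hK ⟨d, hd⟩)]
    exact (hπ _ d (hK ⟨d, hd⟩)).2.1
  have ht : ∀ d, G.tail (σ d) = G.tail d := by
    intro d
    by_cases hd : G.edge d ∈ S
    · rw [hσC' _ d (hK ⟨d, hd⟩)]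
      exact (hπ _ d (hK ⟨d, hd⟩)).2.2.1
    · exact congrArg G.tail (hσS d hd)
  have hnc := finrank_inv_noncrossing (σ := σ) hσσ hS hne ht (by
    intro q i a j hq hi hia haj hj haq hij
    set y := (G.rot ^ i) q with hy
    have hinj : ∀ i j, i < Function.minimalPeriod G.rot q → j < Function.minimalPeriod G.rot q →
        (G.rot ^ i) q = (G.rot ^ j) q → i = j := by
      intro i j hi hj hij
      rw [Equiv.Perm.coe_pow, Equiv.Perm.coe_pow] at hij
      exact Function.iterate_injOn_Iio_minimalPeriod hi hj hij
    have hyS : G.edge y ∈ S := by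
      by_contra hyS
      have h1 : y = (G.rot ^ j) q := (hσS y hyS).symm.trans hij
      have := hinj i j (by omega) hj h1
      omega
    obtain ⟨C, hC⟩ : ∃ C : 𝒞, G.edge q ∈ C.1 := ⟨_, hK ⟨q, hq⟩⟩
    obtain ⟨C', hC'⟩ : ∃ C : 𝒞, G.edge y ∈ C.1 := ⟨_, hK ⟨y, hyS⟩⟩
    by_cases hCC : C = C'
    · subst hCC
      rcases (hπ C q hC).2.2.2 y hC' (G.tail_rot_pow i q) with h | h
      · have := hinj i 0 (by omega) (by omega) h
        omega
      · rw [← hσC' C q hC, haq] at h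
        have := hinj i a (by omega) (by omega) h
        omega
    · refine hcross C C.2 C' C'.2 (fun h => hCC (Subtype.ext h))
        ⟨q, i, a, j, hi, hia, haj, hj, hC, hC', ?_, ?_⟩
      · rw [← haq, hσC' C q hC]; exact (hπ C q hC).1
      · rw [← hij, hσC' C' y hC']; exact (hπ C' y hC').1)
  set A := inv (G.rot⁻¹ * σ) with hA
  set B := inv (G.subNext S) with hB
  have hsum := Submodule.finrank_sup_add_finrank_inf_eq A B
  -- Off `S` both permutations act as `rot⁻¹`. Thus `A ⊔ B` has dimension at most the number of
  -- darts of `S` plus untouched vertices; with the lower bound on `A` and an upper bound on `A ⊓ B`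
  -- this bounds `B`.
  have hsup : A ⊔ B ≤ G.rotInvOff S := by
    refine sup_le (fun ψ hψ d hd => ?_) fun ψ hψ d hd => ?_
    · have := hψ d
      rw [Equiv.Perm.mul_apply, show σ d = d from hσS d hd] at this
      exact this
    · have := hψ d
      rw [subNext, Equiv.Perm.mul_apply, G.partOpp_of_notMem hd] at this
      exact this
  have hsup' := (Submodule.finrank_mono hsup).trans (finrank_rotInvOff_le S)
  -- Invariance under both permutations makes a function constant along each of the two sides of
  -- every cycle, which leaves two values per cycle and one per untouched vertex.
  have hinf : Module.finrank (ZMod 2) (A ⊓ B : Submodule (ZMod 2) _) ≤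
      2 * 𝒞.ncard + (G.untouched S).ncard := by
    have := Fintype.ofFinite 𝒞
    have := Fintype.ofFinite (G.untouched S)
    let Φ : (A ⊓ B : Submodule (ZMod 2) _) →ₗ[ZMod 2]
        ((𝒞 → ZMod 2) × (𝒞 → ZMod 2)) × (G.untouched S → ZMod 2) :=
      { toFun := fun ψ => ((fun C => ψ.1 (d₀ C), fun C => ψ.1 (G.opp (d₀ C))),
          fun v => ψ.1 v.1.out)
        map_add' := fun _ _ => rfl
        map_smul' := fun _ _ => rfl }
    have hΦ : Function.Injective Φ := by
      rw [injective_iff_map_eq_zero]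
      rintro ⟨ψ, hψA, hψB⟩ h0
      have h1 : ∀ C, ψ (d₀ C) = 0 := fun C => congrFun (congrArg (fun x => x.1.1) h0) C
      have h2 : ∀ C, ψ (G.opp (d₀ C)) = 0 := fun C => congrFun (congrArg (fun x => x.1.2) h0) C
      have h3 : ∀ v : G.untouched S, ψ v.1.out = 0 := fun v => congrFun (congrArg (fun x => x.2) h0) v
      refine Subtype.ext (eq_zero_of_mem_rotInvOff (hsup (Submodule.mem_sup_left hψA))
        (fun d hd => ?_) fun v hv => h3 ⟨v, hv⟩)
      refine hzero (K ⟨d, hd⟩) ψ (fun e he => ?_) (h1 _) (h2 _) d (hK ⟨d, hd⟩)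
      rw [← hσC' _ e he]
      have heS := hmemS _ (K ⟨d, hd⟩).2 e he
      have e4 := hψA (σ e)
      rw [Equiv.Perm.mul_apply] at e4
      have e7 := hψB (G.opp e)
      rw [subNext, Equiv.Perm.mul_apply, G.partOpp_of_mem (by rwa [edge_opp]), G.opp_opp] at e7
      rw [show σ (σ e) = e from hσσ e] at e4
      rw [← e4, e7]
    have := LinearMap.finrank_le_finrank_of_injective hΦ
    rw [Module.finrank_prod, Module.finrank_prod, Module.finrank_fintype_fun_eq_card,
      Module.finrank_fintype_fun_eq_card, ← Nat.card_eq_fintype_card, ← Nat.card_eq_fintype_card,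
      Nat.card_coe_set_eq, Nat.card_coe_set_eq] at this
    omega
  omega

/-- The key counting step: on one side of `bd U` there is a handle. -/
theorem exists_cycle_notMem_subBd [Fintype D] {U : Set G.Face} {g : ℕ} (hg : G.HasGenus g)
    (hU : U.Nonempty) (hU' : Uᶜ.Nonempty) {𝒞 : Set (Set G.Edge)}
    (h𝒞 : G.IsCycleDecomposition (G.bd U) 𝒞) (hk : 𝒞.ncard ≤ g) :
    (∃ X ⊆ G.incident U, (∀ φ, G.bdry (G.chain X) φ = 0) ∧
      G.chain X ∉ G.subBd (G.incident U)) ∨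
    (∃ X ⊆ G.incident Uᶜ, (∀ φ, G.bdry (G.chain X) φ = 0) ∧
      G.chain X ∉ G.subBd (G.incident Uᶜ)) := by
  by_contra hcon
  rw [not_or] at hcon
  push Not at hcon
  have hne : ∀ W : Set G.Face, W.Nonempty → (G.incident W).Nonempty := by
    rintro W ⟨f, hf⟩
    obtain ⟨d, rfl⟩ := G.exists_face f
    exact ⟨G.edge d, d, rfl, hf⟩
  -- With f for numbers of boundary walks, u for numbers of untouched vertices and k for the number
  -- of cycles, planarity of both sides gives 2V − E − |S| + f(U) + f(Uᶜ) ≥ 4 + 2u(U) + 2u(Uᶜ).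
  -- Substituting f(U) + f(Uᶜ) ≤ F + f(S), f(S) ≤ 2k + 2u(S) + |S| − V and u(S) ≤ u(U) + u(Uᶜ)
  -- leaves V − E + F + 2k ≥ 4, that is, k ≥ g + 1.
  have h1 := G.planar_of_forall_mem_subBd hcon.1
  have h2 := G.planar_of_forall_mem_subBd hcon.2
  have h3 := G.finrank_inv_subNext_incident_le U
  have h4 := finrank_inv_subNext_le h𝒞
  have h5 := G.one_add_untouched_le (hne U hU)
  have h6 := G.one_add_untouched_le (hne _ hU')
  have h7 := G.ncard_untouched_bd_le U
  have h8 : (G.darts (G.incident U)).ncard + (G.darts (G.incident Uᶜ)).ncard =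
      Nat.card D + (G.darts (G.bd U)).ncard := by
    rw [← Set.ncard_union_add_ncard_inter _ _ (Set.toFinite _) (Set.toFinite _), ← Set.ncard_univ]
    congr 2
    · refine Set.eq_univ_of_forall fun d => ?_
      by_cases h : G.face d ∈ U
      · exact Or.inl ⟨d, rfl, h⟩
      · exact Or.inr ⟨d, rfl, h⟩
    · ext d
      change G.edge d ∈ G.incident U ∧ G.edge d ∈ G.incident Uᶜ ↔ G.edge d ∈ G.bd U
      simp only [mem_bd, mem_incident, Set.mem_compl_iff]
      tauto
  have h9 := G.card_dart
  have h10 := finrank_inv G.rot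
  have h11 := finrank_inv G.next
  have h12 := hg.2
  have h13 : Nat.card G.Vertex = Nat.card (Quotient (Equiv.Perm.SameCycle.setoid G.rot)) := rfl
  have h14 : Nat.card G.Face = Nat.card (Quotient (Equiv.Perm.SameCycle.setoid G.next)) := rfl
  omega

end Counting

end EmbGraph

/-! ### First return maps and the parity of a pair. -/

section FirstReturn

variable {α : Type*} [Finite α] {τ : Equiv.Perm α} {X : Set α}

theorem firstReturn_spec (τ : Equiv.Perm α) (x : X) :
    ∃ n : ℕ, 0 < n ∧ (τ ^ n) (x : α) = firstReturn τ X x ∧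
      ∀ k, 0 < k → k < n → (τ ^ k) (x : α) ∉ X := by
  classical
  exact ⟨_, (Nat.find_spec (exists_return τ X x)).1, rfl,
    fun k hk hlt hmem => Nat.find_min (exists_return τ X x) hlt ⟨hk, hmem⟩⟩

theorem firstReturn_eq {x y : X} {n : ℕ} (hn : 0 < n) (h : (τ ^ n) (x : α) = y)
    (hmin : ∀ k, 0 < k → k < n → (τ ^ k) (x : α) ∉ X) : firstReturn τ X x = y := by
  obtain ⟨m, hm, h', hmin'⟩ := firstReturn_spec τ x
  have : m = n := by
    rcases lt_trichotomy m n with hlt | heq | hlt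
    · exact absurd (h' ▸ (firstReturn τ X x).2) (hmin m hm hlt)
    · exact heq
    · exact absurd (h ▸ y.2) (hmin' n hn hlt)
  subst this
  exact Subtype.ext (h'.symm.trans h)

theorem sameCycle_firstReturn (x : X) : τ.SameCycle (x : α) (firstReturn τ X x) := by
  obtain ⟨n, -, h, -⟩ := firstReturn_spec τ x
  rw [← h]
  exact Equiv.Perm.sameCycle_pow_right.2 (Equiv.Perm.SameCycle.refl _ _)

/-- If `x` returned first to itself, its whole orbit would meet `X` in `x` alone. -/
theorem firstReturn_ne {x y : X} (hxy : x ≠ y) (h : τ.SameCycle (x : α) y) :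
    firstReturn τ X x ≠ x := by
  intro hx
  obtain ⟨n, hn, h', hmin⟩ := firstReturn_spec τ x
  rw [hx] at h'
  obtain ⟨m, hm⟩ := h.exists_nat_pow_eq
  have h1 : (τ ^ (m % n)) (x : α) = y := by
    have h2 : ∀ k : ℕ, ((τ ^ n) ^ k) (x : α) = x := by
      intro k
      induction k with
      | zero => rfl
      | succ k ih => rw [pow_succ, Equiv.Perm.mul_apply, h', ih]
    rw [← hm]
    conv_rhs => rw [← Nat.mod_add_div m n, pow_add, Equiv.Perm.mul_apply, pow_mul, h2]
  rcases Nat.eq_zero_or_pos (m % n) with h0 | h0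
  · rw [h0] at h1
    exact hxy (Subtype.ext h1)
  · exact hmin _ h0 (Nat.mod_lt _ hn) (h1 ▸ y.2)

end FirstReturn

theorem odd_ncard_pair {α : Type*} {T : Set α} {x y : α} (h : x ≠ y) :
    Odd {e | e ∈ T ∧ (e = x ∨ e = y)}.ncard ↔ ¬(x ∈ T ↔ y ∈ T) := by
  by_cases hx : x ∈ T <;> by_cases hy : y ∈ T
  · have : {e | e ∈ T ∧ (e = x ∨ e = y)} = {x, y} := by
      ext e
      constructor
      · exact fun h => h.2
      · rintro (rfl | rfl)
        exacts [⟨hx, Or.inl rfl⟩, ⟨hy, Or.inr rfl⟩]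
    rw [this, Set.ncard_pair h]
    exact iff_of_false (by decide) (by simp [hx, hy])
  · have : {e | e ∈ T ∧ (e = x ∨ e = y)} = {x} := by
      ext e
      constructor
      · rintro ⟨he, rfl | rfl⟩
        exacts [rfl, absurd he hy]
      · rintro rfl
        exact ⟨hx, Or.inl rfl⟩
    rw [this, Set.ncard_singleton]
    exact iff_of_true odd_one (by simp [hx, hy])
  · have : {e | e ∈ T ∧ (e = x ∨ e = y)} = {y} := by
      ext e
      constructor
      · rintro ⟨he, rfl | rfl⟩
        exacts [absurd he hx, rfl]
      · rintro rfl
        exact ⟨hy, Or.inr rfl⟩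
    rw [this, Set.ncard_singleton]
    exact iff_of_true odd_one (by simp [hx, hy])
  · have : {e | e ∈ T ∧ (e = x ∨ e = y)} = ∅ := by
      refine Set.eq_empty_of_forall_notMem ?_
      rintro e ⟨he, rfl | rfl⟩
      exacts [hx he, hy he]
    rw [this, Set.ncard_empty]
    exact iff_of_false (by decide) (by simp [hx, hy])

namespace EmbGraph

/-! ### Faces, edges and separating sets of the cut graph. -/

section Cut

variable {D : Type*} [Finite D] (G : EmbGraph D) (X : Set G.Edge)

/-- The first dart of `X` after the dart `d` of `X` in the rotation. -/
noncomputable abbrev nextDart (d : G.darts X) : G.darts X := firstReturn G.rot (G.darts X) d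

/-- The opposite of a dart of `X`. -/
def oppDart (d : G.darts X) : G.darts X := ⟨G.opp d, (G.opp_mem_darts X d).1 d.2⟩

variable {X}

theorem cut_opp_inl_of_mem {d : D} (h : d ∈ G.darts X) :
    (G.cut X).opp (.inl d) = .inr ⟨d, h⟩ := by
  change G.cutOpp X (.inl d) = _
  rw [cutOpp, dif_pos h]

theorem cut_opp_inl_of_notMem {d : D} (h : d ∉ G.darts X) :
    (G.cut X).opp (.inl d) = .inl (G.opp d) := by
  change G.cutOpp X (.inl d) = _
  rw [cutOpp, dif_neg h]

theorem cut_opp_inr (d : G.darts X) : (G.cut X).opp (.inr d) = .inl (d : D) := rfl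

theorem cut_next_inl (d : D) : (G.cut X).next (.inl d) = .inl (G.next d) := rfl

theorem cut_next_inr (d : G.darts X) :
    (G.cut X).next (.inr d) = .inr (G.oppDart X (G.nextDart X d)) := rfl

theorem cut_face_inr (d : G.darts X) :
    (G.cut X).face (.inr (G.oppDart X (G.nextDart X d))) = (G.cut X).face (.inr d) :=
  (G.cut X).face_next (.inr d)

theorem cutFace_face (d : D) : G.cutFace X (G.face d) = (G.cut X).face (.inl d) := rfl

theorem cut_face_inl_ne_inr (d : D) (e : G.darts X) :
    (G.cut X).face (.inl d) ≠ (G.cut X).face (.inr e) := by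
  intro h
  have := eq_of_sameCycle (τ := (G.cut X).next) (f := Sum.isLeft)
    (by rintro (x | x) <;> rfl) ((G.cut X).face_eq_iff.1 h)
  simp at this

theorem cutFace_injective : Function.Injective (G.cutFace X) := by
  intro f f' h
  obtain ⟨d, rfl⟩ := G.exists_face f
  obtain ⟨d', rfl⟩ := G.exists_face f'
  have := eq_of_sameCycle (τ := (G.cut X).next)
    (f := Sum.elim (fun d => some (G.face d)) fun _ => none)
    (by
      rintro (x | x)
      · rw [cut_next_inl]; simp [face_next]
      · rfl) ((G.cut X).face_eq_iff.1 h)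
  simpa using this

theorem cut_face_cases (f : (G.cut X).Face) :
    (∃ f', f = G.cutFace X f') ∨ ∃ d, f = (G.cut X).face (.inr d) := by
  obtain ⟨d | d, rfl⟩ := (G.cut X).exists_face f
  · exact Or.inl ⟨G.face d, rfl⟩
  · exact Or.inr ⟨d, rfl⟩

theorem cut_edge_inr (d : G.darts X) :
    (G.cut X).edge (.inr d) = (G.cut X).edge (.inl (d : D)) :=
  ((G.cut X).edge_opp (.inr d)).symm

theorem cut_edge_cases (e : (G.cut X).Edge) : ∃ d : D, e = (G.cut X).edge (.inl d) := by
  obtain ⟨d | d, rfl⟩ := (G.cut X).exists_edge e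
  · exact ⟨d, rfl⟩
  · exact ⟨d, G.cut_edge_inr d⟩

theorem cutProj_inl (d : D) : G.cutProj X ((G.cut X).edge (.inl d)) = G.edge d := rfl

theorem cut_edge_inl_eq {d e : D} (h : (G.cut X).edge (.inl d) = (G.cut X).edge (.inl e)) :
    d = e ∨ d ∉ G.darts X ∧ e = G.opp d := by
  rcases (G.cut X).edge_eq_iff.1 h with h | h
  · exact Or.inl (Sum.inl_injective h).symm
  · by_cases hd : d ∈ G.darts X
    · rw [G.cut_opp_inl_of_mem hd] at h; cases h
    · rw [G.cut_opp_inl_of_notMem hd] at h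
      exact Or.inr ⟨hd, Sum.inl_injective h⟩

theorem cut_edge_opp_of_notMem {d : D} (h : d ∉ G.darts X) :
    (G.cut X).edge (.inl (G.opp d)) = (G.cut X).edge (.inl d) := by
  rw [← G.cut_opp_inl_of_notMem h, edge_opp]

theorem mem_bd_cut_of_mem {W : Set (G.cut X).Face} {d : D} (h : d ∈ G.darts X) :
    (G.cut X).edge (.inl d) ∈ (G.cut X).bd W ↔
      ¬((G.cut X).face (.inl d) ∈ W ↔ (G.cut X).face (.inr ⟨d, h⟩) ∈ W) := by
  rw [mem_bd, G.cut_opp_inl_of_mem h]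

theorem mem_bd_cut_of_notMem {W : Set (G.cut X).Face} {d : D} (h : d ∉ G.darts X) :
    (G.cut X).edge (.inl d) ∈ (G.cut X).bd W ↔
      ¬((G.cut X).face (.inl d) ∈ W ↔ (G.cut X).face (.inl (G.opp d)) ∈ W) := by
  rw [mem_bd, G.cut_opp_inl_of_notMem h]

variable (X) in
/-- The faces of `U`, and all new faces. -/
def cutUp (U : Set G.Face) : Set (G.cut X).Face :=
  G.cutFace X '' U ∪ Set.range fun d : G.darts X => (G.cut X).face (.inr d)

theorem inl_mem_cutUp {U : Set G.Face} {d : D} :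
    (G.cut X).face (.inl d) ∈ G.cutUp X U ↔ G.face d ∈ U := by
  constructor
  · rintro (⟨f, hf, h⟩ | ⟨e, h⟩)
    · rwa [← G.cutFace_injective (h.trans (G.cutFace_face d).symm)]
    · exact absurd h.symm (G.cut_face_inl_ne_inr d e)
  · exact fun h => Or.inl ⟨_, h, rfl⟩

theorem inr_mem_cutUp {U : Set G.Face} (d : G.darts X) :
    (G.cut X).face (.inr d) ∈ G.cutUp X U := Or.inr ⟨d, rfl⟩

/-- The edges of which the boundary of `W` has an odd number of copies, when all new faces are on
the same side. -/
theorem odd_bd_cut {W : Set (G.cut X).Face}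
    (hW : ∀ d e : G.darts X, (G.cut X).face (.inr d) ∈ W → (G.cut X).face (.inr e) ∈ W) :
    {e | Odd {e' ∈ (G.cut X).bd W | G.cutProj X e' = e}.ncard} =
      G.bd {f | G.cutFace X f ∈ W} := by
  classical
  refine G.edgeSet_ext fun d => ?_
  rw [Set.mem_ofPred_eq, mem_bd]
  simp only [Set.mem_ofPred_eq, cutFace_face]
  have hfib : ∀ e', G.cutProj X e' = G.edge d ↔
      e' = (G.cut X).edge (.inl d) ∨ e' = (G.cut X).edge (.inl (G.opp d)) := by
    intro e'
    obtain ⟨x, rfl⟩ := G.cut_edge_cases e'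
    rw [cutProj_inl]
    constructor
    · intro h
      rcases G.edge_eq_iff.1 h.symm with rfl | rfl
      · exact Or.inl rfl
      · exact Or.inr rfl
    · rintro (h | h)
      · have := congrArg (G.cutProj X) h
        exact this
      · have := congrArg (G.cutProj X) h
        exact this.trans (G.edge_opp d)
  simp only [hfib]
  by_cases hd : d ∈ G.darts X
  · have hd' := (G.opp_mem_darts X d).1 hd
    have hne : (G.cut X).edge (.inl d) ≠ (G.cut X).edge (.inl (G.opp d)) := by
      intro h
      rcases G.cut_edge_inl_eq h with h | ⟨h, -⟩
      · exact G.opp_ne d h.symm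
      · exact h hd
    -- The two copies of a cut edge have new faces on their far sides, and these are both in `W` or
    -- both outside. They cancel modulo 2, so only the two old faces matter.
    have h3 : (G.cut X).face (.inr ⟨_, hd'⟩) ∈ W ↔ (G.cut X).face (.inr ⟨d, hd⟩) ∈ W :=
      ⟨hW _ _, hW _ _⟩
    rw [odd_ncard_pair hne, G.mem_bd_cut_of_mem hd, G.mem_bd_cut_of_mem hd', h3, not_iff_not]
    by_cases h : (G.cut X).face (.inr ⟨d, hd⟩) ∈ W
    · simp only [h, iff_true, not_iff_not]
    · simp only [h, iff_false, not_not]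
  · rw [G.cut_edge_opp_of_notMem hd, ← G.mem_bd_cut_of_notMem hd]
    simp only [or_self]
    by_cases ha : (G.cut X).edge (.inl d) ∈ (G.cut X).bd W
    · have : {e' | e' ∈ (G.cut X).bd W ∧ e' = (G.cut X).edge (.inl d)} =
          {(G.cut X).edge (.inl d)} := by
        ext e'
        exact ⟨fun h => h.2, fun h => ⟨h ▸ ha, h⟩⟩
      rw [this, Set.ncard_singleton]
      exact iff_of_true odd_one ha
    · have : {e' | e' ∈ (G.cut X).bd W ∧ e' = (G.cut X).edge (.inl d)} = ∅ :=
        Set.eq_empty_of_forall_notMem fun e' h => ha (h.2 ▸ h.1)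
      rw [this, Set.ncard_empty]
      exact iff_of_false (by decide) ha

variable {G} {w : G.Edge → ℝ}

theorem weight_le_cut (hw : ∀ e, 0 ≤ w e) {Y : Set G.Edge} {T : Set (G.cut X).Edge}
    (h : Y ⊆ G.cutProj X '' T) :
    G.weight w Y ≤ (G.cut X).weight (G.cutWeight X w) T := by
  obtain ⟨T', hT', hb⟩ := Set.SurjOn.exists_bijOn_subset h
  have : G.weight w Y = (G.cut X).weight (G.cutWeight X w) T' :=
    (finsum_mem_eq_of_bijOn _ hb fun _ _ => rfl).symm
  rw [this]
  exact weight_mono (fun e => hw _) hT'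

/-- An edge with an odd number of copies in a set has at least one copy there, so passing to
parities does not increase weight. -/
theorem weight_bd_le_cut (hw : ∀ e, 0 ≤ w e) {W : Set (G.cut X).Face}
    (hW : ∀ d e : G.darts X, (G.cut X).face (.inr d) ∈ W → (G.cut X).face (.inr e) ∈ W) :
    G.weight w (G.bd {f | G.cutFace X f ∈ W}) ≤
      (G.cut X).weight (G.cutWeight X w) ((G.cut X).bd W) := by
  refine weight_le_cut hw ?_
  rw [← G.odd_bd_cut hW]
  intro e he
  have : {e' ∈ (G.cut X).bd W | G.cutProj X e' = e}.ncard ≠ 0 := by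
    rintro h
    rw [Set.mem_ofPred_eq, h] at he
    exact absurd he (by decide)
  obtain ⟨e', he'⟩ := Set.nonempty_of_ncard_ne_zero this
  exact ⟨e', he'⟩

/-- Each copy of an edge of `X` lies between an old face and a face of `cutUp`, so it is in the
boundary exactly when its old face is outside `U`. As edges of `X` have a face in `U`, at most one
copy qualifies, and one does precisely for edges of `bd U`. -/
theorem bijOn_bd_cutUp {U : Set G.Face} (hX : X ⊆ G.incident U) :
    Set.BijOn (G.cutProj X) ((G.cut X).bd (G.cutUp X U)) (G.bd U) := by
  have hmem : ∀ d, (hd : d ∈ G.darts X) →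
      ((G.cut X).edge (.inl d) ∈ (G.cut X).bd (G.cutUp X U) ↔ G.face d ∉ U) := by
    intro d hd
    rw [G.mem_bd_cut_of_mem hd, inl_mem_cutUp]
    have := G.inr_mem_cutUp (U := U) ⟨d, hd⟩
    tauto
  have hinc : ∀ d, d ∈ G.darts X → G.face d ∈ U ∨ G.face (G.opp d) ∈ U :=
    fun d hd => G.mem_incident.1 (hX hd)
  refine ⟨fun e he => ?_, fun e he e' he' h => ?_, fun e he => ?_⟩
  · obtain ⟨d, rfl⟩ := G.cut_edge_cases e
    rw [cutProj_inl, mem_bd]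
    by_cases hd : d ∈ G.darts X
    · have := hinc d hd
      rw [hmem d hd] at he
      tauto
    · rw [G.mem_bd_cut_of_notMem hd, inl_mem_cutUp, inl_mem_cutUp] at he
      exact he
  · obtain ⟨d, rfl⟩ := G.cut_edge_cases e
    obtain ⟨d', rfl⟩ := G.cut_edge_cases e'
    rcases G.edge_eq_iff.1 h with rfl | rfl
    · rfl
    · by_cases hd : d ∈ G.darts X
      · have := hinc d hd
        rw [hmem d hd] at he
        rw [hmem _ ((G.opp_mem_darts X d).1 hd)] at he'
        tauto
      · exact (G.cut_edge_opp_of_notMem hd).symm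
  · obtain ⟨d, rfl⟩ := G.exists_edge e
    by_cases hd : d ∈ G.darts X
    · by_cases hdU : G.face d ∈ U
      · refine ⟨(G.cut X).edge (.inl (G.opp d)), (hmem _ ((G.opp_mem_darts X d).1 hd)).2 ?_,
          G.edge_opp d⟩
        rw [mem_bd] at he
        tauto
      · exact ⟨(G.cut X).edge (.inl d), (hmem _ hd).2 hdU, rfl⟩
    · refine ⟨(G.cut X).edge (.inl d), ?_, rfl⟩
      rw [G.mem_bd_cut_of_notMem hd, inl_mem_cutUp, inl_mem_cutUp]
      exact G.mem_bd.1 he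

theorem weight_bd_cutUp {U : Set G.Face} (hX : X ⊆ G.incident U) :
    (G.cut X).weight (G.cutWeight X w) ((G.cut X).bd (G.cutUp X U)) = G.weight w (G.bd U) :=
  finsum_mem_eq_of_bijOn _ (bijOn_bd_cutUp hX) fun _ _ => rfl

/-- A single new face lies on one side of every `W`, so the odd part of `bd W` is an `ab`-separating
set of G that is no heavier than `bd W`. Equality of weights passes to G, where the minimum is
unique. -/
theorem IsTheMinSeparating.inCut (hw : ∀ e, 0 ≤ w e) {a b : G.Face} {U : Set G.Face}
    (h : G.IsTheMinSeparating w a b (G.bd U)) (ha : a ∈ U) (hb : b ∉ U)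
    (hX : X ⊆ G.incident U)
    (hface : ∀ d e : G.darts X, (G.cut X).face (.inr d) = (G.cut X).face (.inr e)) :
    G.IsTheMinSeparatingInCut w X a b (G.bd U) := by
  have hb' : G.cutFace X b ∉ G.cutUp X U := by
    obtain ⟨d, rfl⟩ := G.exists_face b
    rwa [cutFace_face, inl_mem_cutUp]
  refine ⟨(G.cut X).bd (G.cutUp X U), bijOn_bd_cutUp hX, ⟨_, Or.inl ⟨a, ha, rfl⟩, hb', rfl⟩, ?_⟩
  rintro _ ⟨W, haW, hbW, rfl⟩
  have hW : ∀ d e : G.darts X, (G.cut X).face (.inr d) ∈ W → (G.cut X).face (.inr e) ∈ W :=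
    fun d e hd => hface d e ▸ hd
  have h1 := weight_bd_le_cut hw hW
  have hsep : G.IsSeparating a b (G.bd {f | G.cutFace X f ∈ W}) := ⟨_, haW, hbW, rfl⟩
  have h2 := h.weight_le hsep
  rw [weight_bd_cutUp hX]
  refine ⟨h2.trans h1, fun heq => ?_⟩
  rw [G.odd_bd_cut hW]
  by_contra hne
  have := h.2 _ hsep hne
  linarith

end Cut

end EmbGraph

namespace EmbGraph

/-! ### Vertices, connectedness and genus of the cut graph. -/

section CutVertices

variable {D : Type*} [Finite D] (G : EmbGraph D) {X : Set G.Edge}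

theorem cut_rot_inl_of_notMem {d : D} (h : G.rot d ∉ G.darts X) :
    (G.cut X).rot (.inl d) = .inl (G.rot d) := by
  rw [← Equiv.Perm.eq_inv_iff_eq, rot_inv_apply, G.cut_opp_inl_of_notMem h, cut_next_inl]
  congr 1
  rw [rot_apply, G.opp_opp]
  exact (G.next.apply_symm_apply d).symm

theorem cut_rot_inl_of_mem {d : D} (h : G.rot d ∈ G.darts X) :
    (G.cut X).rot (.inl d) = .inr (G.oppDart X ⟨_, h⟩) := by
  rw [← Equiv.Perm.eq_inv_iff_eq, rot_inv_apply, cut_opp_inr, cut_next_inl]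
  congr 1
  change d = G.next (G.opp (G.rot d))
  rw [rot_apply, G.opp_opp]
  exact (G.next.apply_symm_apply d).symm

theorem cut_rot_inr (c : G.darts X) :
    (G.cut X).rot (.inr (G.oppDart X (G.nextDart X c))) = .inl (c : D) := by
  rw [← Equiv.Perm.eq_inv_iff_eq, rot_inv_apply, G.cut_opp_inl_of_mem c.2, cut_next_inr]

theorem cut_tail_inr (c : G.darts X) :
    (G.cut X).tail (.inr (G.oppDart X (G.nextDart X c))) = (G.cut X).tail (.inl (c : D)) := by
  rw [← cut_rot_inr, tail_rot]

theorem cut_tail_rot_pow (c : G.darts X) {k : ℕ}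
    (h : ∀ i, 0 < i → i ≤ k → (G.rot ^ i) (c : D) ∉ G.darts X) :
    (G.cut X).tail (.inl ((G.rot ^ k) (c : D))) = (G.cut X).tail (.inl (c : D)) := by
  induction k with
  | zero => rfl
  | succ k ih =>
    have h1 := h (k + 1) (by omega) le_rfl
    rw [pow_succ', Equiv.Perm.mul_apply] at h1 ⊢
    rw [← G.cut_rot_inl_of_notMem h1, tail_rot]
    exact ih fun i hi hik => h i hi (by omega)

/-- The vertices of the cut graph at a vertex of `X` correspond to the sectors between consecutive
darts of `X`. -/
theorem cut_tail_inl_eq {d : D} (c : G.darts X)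
    (h : (G.cut X).tail (.inl d) = (G.cut X).tail (.inl (c : D))) :
    ∃ k, d = (G.rot ^ k) (c : D) ∧ ∀ i, 0 < i → i ≤ k → (G.rot ^ i) (c : D) ∉ G.darts X := by
  -- The full rotation cycle of a sector: the darts from `c` up to the next dart of `X`, then the
  -- new dart over that one, from which the rotation returns to `c`.
  set A : Set (G.CutDart X) := {x | (∃ k, x = .inl ((G.rot ^ k) (c : D)) ∧
    ∀ i, 0 < i → i ≤ k → (G.rot ^ i) (c : D) ∉ G.darts X) ∨
      x = .inr (G.oppDart X (G.nextDart X c))} with hA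
  have hstep : ∀ x ∈ A, (G.cut X).rot x ∈ A := by
    rintro x (⟨k, rfl, hk⟩ | rfl)
    · by_cases hm : G.rot ((G.rot ^ k) (c : D)) ∈ G.darts X
      · refine Or.inr ?_
        rw [G.cut_rot_inl_of_mem hm]
        congr 2
        refine (firstReturn_eq (n := k + 1) (by omega) ?_ fun i hi hik => hk i hi (by omega)).symm
        rw [pow_succ', Equiv.Perm.mul_apply]
      · refine Or.inl ⟨k + 1, ?_, fun i hi hik => ?_⟩
        · rw [G.cut_rot_inl_of_notMem hm, pow_succ', Equiv.Perm.mul_apply]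
        · rcases hik.lt_or_eq with h | rfl
          · exact hk i hi (by omega)
          · rw [pow_succ', Equiv.Perm.mul_apply]; exact hm
    · exact Or.inl ⟨0, G.cut_rot_inr c, fun i hi hi0 => absurd hi (by omega)⟩
  obtain ⟨n, hn⟩ := ((G.cut X).tail_eq_iff.1 h.symm).exists_nat_pow_eq
  have hmem : ∀ n : ℕ, ((G.cut X).rot ^ n) (.inl (c : D)) ∈ A := by
    intro n
    induction n with
    | zero => exact Or.inl ⟨0, rfl, fun i hi hi0 => absurd hi (by omega)⟩
    | succ n ih => rw [pow_succ', Equiv.Perm.mul_apply]; exact hstep _ ih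
  have := hmem n
  rw [hn] at this
  rcases this with ⟨k, hk, hk'⟩ | h'
  · exact ⟨k, Sum.inl_injective hk, hk'⟩
  · cases h'

theorem cut_tail_inl_injOn (c c' : G.darts X)
    (h : (G.cut X).tail (.inl (c : D)) = (G.cut X).tail (.inl (c' : D))) : c = c' := by
  obtain ⟨k, hk, hk'⟩ := G.cut_tail_inl_eq c' h
  rcases Nat.eq_zero_or_pos k with rfl | h0
  · exact Subtype.ext hk
  · exact absurd (hk ▸ c.2) (hk' k h0 le_rfl)

theorem exists_cut_tail_eq {d e : D} (he : e ∈ G.darts X) (h : G.tail d = G.tail e) :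
    ∃ c : G.darts X, (G.cut X).tail (.inl d) = (G.cut X).tail (.inl (c : D)) := by
  obtain ⟨n, rfl⟩ := (G.tail_eq_iff.1 h.symm).exists_nat_pow_eq
  clear h
  induction n with
  | zero => exact ⟨⟨e, he⟩, rfl⟩
  | succ n ih =>
    rw [pow_succ', Equiv.Perm.mul_apply]
    by_cases hm : G.rot ((G.rot ^ n) e) ∈ G.darts X
    · exact ⟨⟨_, hm⟩, rfl⟩
    · rw [← G.cut_rot_inl_of_notMem hm, tail_rot]
      exact ih

theorem exists_cut_tail_inr_eq (e : G.darts X) :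
    ∃ c : G.darts X, (G.cut X).tail (.inr e) = (G.cut X).tail (.inl (c : D)) := by
  refine ⟨(firstReturn G.rot (G.darts X)).symm (G.oppDart X e), ?_⟩
  rw [← cut_tail_inr]
  congr 2
  rw [nextDart, Equiv.apply_symm_apply]
  exact Subtype.ext (G.opp_opp _).symm

theorem cut_tail_eq_of_untouched {d e : D} (h : G.tail d = G.tail e)
    (hd : G.tail d ∈ G.untouched X) :
    (G.cut X).tail (.inl d) = (G.cut X).tail (.inl e) := by
  obtain ⟨n, rfl⟩ := (G.tail_eq_iff.1 h).exists_nat_pow_eq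
  clear h
  induction n with
  | zero => rfl
  | succ n ih =>
    rw [pow_succ', Equiv.Perm.mul_apply, ← G.cut_rot_inl_of_notMem, tail_rot]
    · exact ih
    · exact hd _ (by rw [tail_rot, tail_rot_pow])

theorem tail_eq_of_cut {d e : D} (h : (G.cut X).tail (.inl d) = (G.cut X).tail (.inl e)) :
    G.tail d = G.tail e := by
  refine eq_of_sameCycle (τ := (G.cut X).rot)
    -- `inr x` runs opposite to `x`, so its tail lies over the head of `x`.
    (f := Sum.elim G.tail fun x : G.darts X => G.head x) ?_ ((G.cut X).tail_eq_iff.1 h)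
  rintro (x | x)
  · by_cases hm : G.rot x ∈ G.darts X
    · rw [G.cut_rot_inl_of_mem hm, Sum.elim_inr, Sum.elim_inl]
      exact (G.head_opp _).trans (G.tail_rot x)
    · rw [G.cut_rot_inl_of_notMem hm, Sum.elim_inl, Sum.elim_inl, tail_rot]
  · obtain ⟨c, rfl⟩ : ∃ c, x = G.oppDart X (G.nextDart X c) := by
      refine ⟨(firstReturn G.rot (G.darts X)).symm (G.oppDart X x), ?_⟩
      rw [nextDart, Equiv.apply_symm_apply]
      exact Subtype.ext (G.opp_opp _).symm
    rw [cut_rot_inr, Sum.elim_inl, Sum.elim_inr]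
    exact (G.tail_eq_iff.2 (sameCycle_firstReturn c)).trans (G.head_opp _).symm

/-- A vertex met by `X` splits into its sectors, which the darts of `X` label by their first dart.
The other vertices survive unchanged. -/
theorem card_cut_vertex :
    Nat.card (G.cut X).Vertex = (G.darts X).ncard + (G.untouched X).ncard := by
  let Φ : G.darts X ⊕ G.untouched X → (G.cut X).Vertex :=
    Sum.elim (fun c => (G.cut X).tail (.inl (c : D))) fun v => (G.cut X).tail (.inl v.1.out)
  have hout : ∀ v : G.Vertex, G.tail v.out = v := fun v => Quotient.out_eq v
  have hΦ : Function.Bijective Φ := by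
    constructor
    · rintro (c | v) (c' | v') h
      · exact congrArg _ (G.cut_tail_inl_injOn c c' h)
      · have := G.tail_eq_of_cut h
        rw [hout] at this
        exact absurd c.2 (v'.2 _ this)
      · have := G.tail_eq_of_cut h
        rw [hout] at this
        exact absurd c'.2 (v.2 _ this.symm)
      · have := G.tail_eq_of_cut h
        rw [hout, hout] at this
        exact congrArg _ (Subtype.ext this)
    · intro v
      obtain ⟨d | d, rfl⟩ := (G.cut X).exists_tail v
      · by_cases hd : G.tail d ∈ G.untouched X
        · exact ⟨.inr ⟨_, hd⟩, G.cut_tail_eq_of_untouched (hout _) (by rwa [hout])⟩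
        · have : ∃ e, G.tail e = G.tail d ∧ G.edge e ∈ X := by
            by_contra h
            push Not at h
            exact hd h
          obtain ⟨e, he, heX⟩ := this
          obtain ⟨c, hc⟩ := G.exists_cut_tail_eq (X := X) heX he.symm
          exact ⟨.inl c, hc.symm⟩
      · obtain ⟨c, hc⟩ := G.exists_cut_tail_inr_eq d
        exact ⟨.inl c, hc.symm⟩
  rw [← Nat.card_congr (Equiv.ofBijective Φ hΦ), Nat.card_sum, Nat.card_coe_set_eq,
    Nat.card_coe_set_eq]

theorem card_cut_dart : Nat.card (G.CutDart X) = Nat.card D + (G.darts X).ncard := by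
  rw [Nat.card_sum, Nat.card_coe_set_eq]

theorem card_cut_face (hX : (G.darts X).Nonempty)
    (h : ∀ d e : G.darts X, (G.cut X).face (.inr d) = (G.cut X).face (.inr e)) :
    Nat.card (G.cut X).Face = Nat.card G.Face + 1 := by
  obtain ⟨d₀, hd₀⟩ := hX
  let Φ : Option G.Face → (G.cut X).Face :=
    fun o => o.elim ((G.cut X).face (.inr ⟨d₀, hd₀⟩)) (G.cutFace X)
  have hΦ : Function.Bijective Φ := by
    constructor
    · rintro (_ | f) (_ | f') hf
      · rfl
      · obtain ⟨d, rfl⟩ := G.exists_face f'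
        exact absurd hf.symm (G.cut_face_inl_ne_inr d _)
      · obtain ⟨d, rfl⟩ := G.exists_face f
        exact absurd hf (G.cut_face_inl_ne_inr d _)
      · exact congrArg _ (G.cutFace_injective hf)
    · intro f
      rcases G.cut_face_cases f with ⟨f', rfl⟩ | ⟨d, rfl⟩
      · exact ⟨some f', rfl⟩
      · exact ⟨none, h _ _⟩
  rw [← Nat.card_congr (Equiv.ofBijective Φ hΦ), Finite.card_option]

theorem ncard_cutBoundary (hX : (G.darts X).Nonempty)
    (h : ∀ d e : G.darts X, (G.cut X).face (.inr d) = (G.cut X).face (.inr e)) (B : Set G.Face) :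
    (G.cutBoundary X B).ncard = B.ncard + 1 := by
  obtain ⟨d₀, hd₀⟩ := hX
  have h1 : (Set.range fun d : G.darts X => (G.cut X).face (.inr d)) =
      {(G.cut X).face (.inr ⟨d₀, hd₀⟩)} := by
    ext f
    constructor
    · rintro ⟨d, rfl⟩; exact h _ _
    · rintro rfl; exact ⟨_, rfl⟩
  rw [cutBoundary, h1, Set.ncard_union_eq, Set.ncard_image_of_injective _ G.cutFace_injective,
    Set.ncard_singleton]
  rw [Set.disjoint_singleton_right]
  rintro ⟨f, -, hf⟩
  obtain ⟨d, rfl⟩ := G.exists_face f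
  exact G.cut_face_inl_ne_inr d _ hf

variable {G}

/-- The boundary walk of the single new face passes along all copies of edges of `X`, so it leads
from one copy of a cut edge to the other. -/
theorem Connected.cut (hG : G.Connected) (hX : (G.darts X).Nonempty)
    (h : ∀ d e : G.darts X, (G.cut X).face (.inr d) = (G.cut X).face (.inr e)) :
    (G.cut X).Connected := by
  obtain ⟨d₀, hd₀⟩ := hX
  have : Nonempty (G.CutDart X) := ⟨.inl d₀⟩
  refine connected_of_closed fun A h1 h2 hA => ?_
  have hnew : ∀ d e : G.darts X, Sum.inr d ∈ A → Sum.inr e ∈ A := by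
    intro d e hd
    obtain ⟨n, hn⟩ := ((G.cut X).face_eq_iff.1 (h d e)).exists_nat_pow_eq
    rw [← hn]
    clear hn
    induction n with
    | zero => exact hd
    | succ n ih => rw [pow_succ', Equiv.Perm.mul_apply]; exact h2 _ ih
  have hopp : ∀ d : D, Sum.inl d ∈ A → Sum.inl (G.opp d) ∈ A := by
    intro d hd
    by_cases hdX : d ∈ G.darts X
    · have h3 := h1 _ hd
      rw [G.cut_opp_inl_of_mem hdX] at h3
      have h4 := h1 _ (hnew _ (G.oppDart X ⟨d, hdX⟩) h3)
      rwa [cut_opp_inr] at h4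
    · have h3 := h1 _ hd
      rwa [G.cut_opp_inl_of_notMem hdX] at h3
  have hne : {d : D | Sum.inl d ∈ A}.Nonempty := by
    obtain ⟨d | d, hd⟩ := hA
    · exact ⟨d, hd⟩
    · exact ⟨d, h1 _ hd⟩
  have hall := Set.eq_univ_iff_forall.1 (hG.eq_univ (A := {d : D | Sum.inl d ∈ A}) hopp
    (fun d hd => h2 _ hd) hne)
  have hinr : ∀ d : G.darts X, Sum.inr d ∈ A := by
    intro d
    have := h1 _ (hall d)
    rwa [G.cut_opp_inl_of_mem d.2] at this
  refine Set.eq_univ_of_forall ?_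
  rintro (d | d)
  exacts [hall d, hinr d]

/-- `hcard` says that `X` has one edge more than it has vertices. Cutting then adds one vertex more
than edges, and one face, which raises the Euler characteristic by 2. -/
theorem HasGenus.cut {g : ℤ} (hG : G.HasGenus g) (hX : (G.darts X).Nonempty)
    (h : ∀ d e : G.darts X, (G.cut X).face (.inr d) = (G.cut X).face (.inr e))
    (hcard : 2 * Nat.card G.Vertex + 2 = 2 * (G.untouched X).ncard + (G.darts X).ncard) :
    (G.cut X).HasGenus (g - 1) := by
  refine ⟨hG.1.cut hX h, ?_⟩
  have h1 := G.card_cut_vertex (X := X)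
  have h2 := (G.cut X).card_dart
  have h3 := G.card_cut_face hX h
  have h4 := G.card_dart
  have h5 := G.card_cut_dart (X := X)
  have h6 := hG.2
  have h7 : 0 < (G.darts X).ncard := (Set.ncard_pos (Set.toFinite _)).2 hX
  have h8 := G.ncard_darts X
  omega

end CutVertices

/-! ### Successors of darts when a cut along `C` is refined to a cut along `X`. -/

section Sectors

variable {D : Type*} [Finite D] {G : EmbGraph D} {C X : Set G.Edge}

/-- If one dart of `X` lies strictly inside a sector of `C ⊆ X`, it is the successor of the first
dart of the sector, and it is followed by the successor of the latter in `C`. -/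
theorem nextDart_of_sector (hCX : C ⊆ X) (a : G.darts C) {p : D} (hp : p ∈ G.darts X)
    (hpC : p ∉ G.darts C) (hsec : (G.cut C).tail (.inl p) = (G.cut C).tail (.inl (a : D)))
    (huniq : ∀ q ∈ G.darts X, q ∉ G.darts C →
      (G.cut C).tail (.inl q) = (G.cut C).tail (.inl (a : D)) → q = p) :
    (G.nextDart X ⟨a, hCX a.2⟩ : D) = p ∧ (G.nextDart X ⟨p, hp⟩ : D) = G.nextDart C a := by
  obtain ⟨N, hN, hb, hmin⟩ := firstReturn_spec G.rot a
  obtain ⟨k, rfl, hk⟩ := G.cut_tail_inl_eq a hsec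
  have hk0 : 0 < k := by
    rcases Nat.eq_zero_or_pos k with rfl | h
    · exact absurd a.2 hpC
    · exact h
  have hkN : k < N := by
    by_contra h
    exact hk N hN (by omega) (hb ▸ (firstReturn G.rot (G.darts C) a).2)
  have hinj : ∀ i, 0 < i → i < N → (G.rot ^ i) (a : D) ∈ G.darts X → i = k := by
    intro i hi hiN hiX
    have h1 : (G.rot ^ i) (a : D) = (G.rot ^ k) (a : D) :=
      huniq _ hiX (hmin i hi hiN) (G.cut_tail_rot_pow a fun j hj hji => hmin j hj (by omega))
    -- A repetition before the first return would bring `a` back to itself too early.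
    have key : ∀ x y : ℕ, x < y → y < N → (G.rot ^ x) (a : D) ≠ (G.rot ^ y) (a : D) := by
      intro x y hxy hy h
      obtain ⟨z, rfl⟩ := Nat.exists_eq_add_of_lt hxy
      rw [add_assoc, pow_add, Equiv.Perm.mul_apply] at h
      have := (G.rot ^ x).injective h
      exact hmin (z + 1) (by omega) (by omega) (this ▸ a.2)
    rcases lt_trichotomy i k with h | h | h
    · exact absurd h1 (key i k h hkN)
    · exact h
    · exact absurd h1.symm (key k i h hiN)
  constructor
  · exact congrArg Subtype.val (firstReturn_eq (y := ⟨_, hp⟩) hk0 rfl fun i hi hik hiX => by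
      have := hinj i hi (by omega) hiX
      omega)
  · refine congrArg Subtype.val (firstReturn_eq (x := (⟨_, hp⟩ : G.darts X))
      (y := ⟨_, hCX (G.nextDart C a).2⟩) (n := N - k) (by omega) ?_ fun i hi hik hiX => ?_)
    · rw [← Equiv.Perm.mul_apply, ← pow_add, Nat.sub_add_cancel hkN.le]
      exact hb
    · rw [← Equiv.Perm.mul_apply, ← pow_add] at hiX
      have := hinj (i + k) (by omega) (by omega) hiX
      omega

theorem nextDart_of_empty_sector (hCX : C ⊆ X) (a : G.darts C)
    (hempty : ∀ q ∈ G.darts X, q ∉ G.darts C →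
      (G.cut C).tail (.inl q) ≠ (G.cut C).tail (.inl (a : D))) :
    (G.nextDart X ⟨a, hCX a.2⟩ : D) = G.nextDart C a := by
  obtain ⟨N, hN, hb, hmin⟩ := firstReturn_spec G.rot a
  refine congrArg Subtype.val (firstReturn_eq (x := (⟨a, hCX a.2⟩ : G.darts X))
      (y := ⟨_, hCX (G.nextDart C a).2⟩) hN hb fun i hi hiN hiX => ?_)
  exact hempty _ hiX (hmin i hi hiN) (G.cut_tail_rot_pow a fun j hj hji => hmin j hj (by omega))

theorem nextDart_of_pair {a b : G.darts X} (hab : a ≠ b) (ht : G.tail (a : D) = G.tail (b : D))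
    (h : ∀ q ∈ G.darts X, G.tail q = G.tail (a : D) → q = a ∨ q = b) :
    G.nextDart X a = b := by
  have h1 : G.nextDart X a ≠ a := firstReturn_ne hab (G.tail_eq_iff.1 ht)
  rcases h _ (G.nextDart X a).2 (G.tail_eq_iff.2 (sameCycle_firstReturn a)).symm with h2 | h2
  · exact absurd (Subtype.ext h2) h1
  · exact Subtype.ext h2

theorem IsCycleParam.nextDart {n : ℕ} {c : ZMod n → D} (hc : G.IsCycleParam C c) (i : ZMod n) :
    (G.nextDart C ⟨c (i + 1), hc.mem _⟩ : D) = G.opp (c i) ∧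
      (G.nextDart C ⟨G.opp (c i), hc.mem_opp _⟩ : D) = c (i + 1) := by
  have hne : c (i + 1) ≠ G.opp (c i) := hc.ne_opp _ _
  have ht : G.tail (G.opp (c i)) = G.tail (c (i + 1)) := hc.head_eq i
  constructor
  · exact congrArg Subtype.val (nextDart_of_pair (a := ⟨c (i + 1), hc.mem _⟩)
      (b := ⟨G.opp (c i), hc.mem_opp _⟩) (fun h => hne (congrArg Subtype.val h)) ht.symm
      fun q hq hqt => hc.eq_or_of_tail hq hqt)
  · exact congrArg Subtype.val (nextDart_of_pair (a := ⟨G.opp (c i), hc.mem_opp _⟩)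
      (b := ⟨c (i + 1), hc.mem _⟩) (fun h => hne (congrArg Subtype.val h).symm) ht
      fun q hq hqt => (hc.eq_or_of_tail hq (hqt.trans ht)).symm)

end Sectors

end EmbGraph

namespace EmbGraph

/-! ### Cutting along a cycle and an arc between its two sides. -/

section Arc

variable {D : Type*} [Finite D] {G : EmbGraph D} {C X : Set G.Edge}

/-- `p 0, …, p (ℓ - 1)` are the darts of a path in `G` cut along the cycle `C` from one copy of `C`
to the other that only meets the copies of `C` at its ends; `u` lists its vertices. -/
structure IsArcParam (G : EmbGraph D) (C : Set G.Edge) {n : ℕ} (c : ZMod n → D) (x y : ZMod n)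
    (p : ℕ → D) (ℓ : ℕ) (u : ℕ → (G.cut C).Vertex) : Prop where
  pos : 0 < ℓ
  notMem : ∀ i < ℓ, G.edge (p i) ∉ C
  tail_eq : ∀ i < ℓ, (G.cut C).tail (.inl (p i)) = u i
  head_eq : ∀ i < ℓ, (G.cut C).tail (.inl (G.opp (p i))) = u (i + 1)
  inj : ∀ i j, i ≤ ℓ → j ≤ ℓ → u i = u j → i = j
  start : u 0 = (G.cut C).tail (.inl (c x))
  finish : u ℓ = (G.cut C).tail (.inl (G.opp (c y)))
  interior : ∀ i, 0 < i → i < ℓ → ∀ a : G.darts C, u i ≠ (G.cut C).tail (.inl (a : D))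

namespace IsArcParam

variable {n : ℕ} {c : ZMod n → D} {x y : ZMod n} {p : ℕ → D} {ℓ : ℕ}
  {u : ℕ → (G.cut C).Vertex}

/-- The arc enters the left copy of the cycle only with its first dart: its interior avoids both
copies and its end lies on the right copy. -/
theorem eq_of_tail_pos (h : G.IsArcParam C c x y p ℓ u) (hc : G.IsCycleParam C c)
    (hX : ∀ d, G.edge d ∈ X ↔ G.edge d ∈ C ∨ ∃ i < ℓ, d = p i ∨ d = G.opp (p i)) {q : D}
    (hq : q ∈ G.darts X) (hqC : q ∉ G.darts C) {i : ZMod n}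
    (ht : (G.cut C).tail (.inl q) = (G.cut C).tail (.inl (c i))) : q = p 0 ∧ i = x := by
  obtain ⟨k, hk, rfl | rfl⟩ := ((hX q).1 hq).resolve_left hqC
  · rw [h.tail_eq k hk] at ht
    rcases Nat.eq_zero_or_pos k with rfl | h0
    · rw [h.start] at ht
      have := G.cut_tail_inl_injOn ⟨_, hc.mem x⟩ ⟨_, hc.mem i⟩ ht
      exact ⟨rfl, (hc.inj (congrArg Subtype.val this)).symm⟩
    · exact absurd ht (h.interior k h0 hk ⟨_, hc.mem i⟩)
  · rw [h.head_eq k hk] at ht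
    rcases (show k + 1 ≤ ℓ from hk).lt_or_eq with h0 | h0
    · exact absurd ht (h.interior (k + 1) (by omega) h0 ⟨_, hc.mem i⟩)
    · rw [h0, h.finish] at ht
      have := G.cut_tail_inl_injOn ⟨_, hc.mem_opp y⟩ ⟨_, hc.mem i⟩ ht
      exact absurd (congrArg Subtype.val this).symm (hc.ne_opp _ _)

theorem eq_of_tail_neg (h : G.IsArcParam C c x y p ℓ u) (hc : G.IsCycleParam C c)
    (hX : ∀ d, G.edge d ∈ X ↔ G.edge d ∈ C ∨ ∃ i < ℓ, d = p i ∨ d = G.opp (p i)) {q : D}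
    (hq : q ∈ G.darts X) (hqC : q ∉ G.darts C) {i : ZMod n}
    (ht : (G.cut C).tail (.inl q) = (G.cut C).tail (.inl (G.opp (c i)))) :
    q = G.opp (p (ℓ - 1)) ∧ i = y := by
  obtain ⟨k, hk, rfl | rfl⟩ := ((hX q).1 hq).resolve_left hqC
  · rw [h.tail_eq k hk] at ht
    rcases Nat.eq_zero_or_pos k with rfl | h0
    · rw [h.start] at ht
      have := G.cut_tail_inl_injOn ⟨_, hc.mem x⟩ ⟨_, hc.mem_opp i⟩ ht
      exact absurd (congrArg Subtype.val this) (hc.ne_opp _ _)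
    · exact absurd ht (h.interior k h0 hk ⟨_, hc.mem_opp i⟩)
  · rw [h.head_eq k hk] at ht
    rcases (show k + 1 ≤ ℓ from hk).lt_or_eq with h0 | h0
    · exact absurd ht (h.interior (k + 1) (by omega) h0 ⟨_, hc.mem_opp i⟩)
    · have hk' : k = ℓ - 1 := by omega
      rw [h0, h.finish] at ht
      have := G.cut_tail_inl_injOn ⟨_, hc.mem_opp y⟩ ⟨_, hc.mem_opp i⟩ ht
      exact ⟨by rw [hk'], (hc.inj (G.opp.injective (congrArg Subtype.val this))).symm⟩

theorem untouched (h : G.IsArcParam C c x y p ℓ u) {i : ℕ} (hi : 0 < i) (hiℓ : i < ℓ) :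
    G.tail (p i) ∈ G.untouched C := by
  intro d hd hdC
  obtain ⟨a, ha⟩ := G.exists_cut_tail_eq (X := C) hdC hd.symm
  rw [h.tail_eq i hiℓ] at ha
  exact h.interior i hi hiℓ a ha

theorem eq_of_tail_interior (h : G.IsArcParam C c x y p ℓ u)
    (hX : ∀ d, G.edge d ∈ X ↔ G.edge d ∈ C ∨ ∃ i < ℓ, d = p i ∨ d = G.opp (p i)) {i : ℕ}
    (hi : i + 1 < ℓ) {q : D} (hq : q ∈ G.darts X) (ht : G.tail q = G.tail (p (i + 1))) :
    q = p (i + 1) ∨ q = G.opp (p i) := by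
  have hunt := h.untouched (Nat.succ_pos i) hi
  have hqC : q ∉ G.darts C := hunt q ht
  have ht' := G.cut_tail_eq_of_untouched (X := C) ht (by rwa [ht])
  rw [h.tail_eq _ hi] at ht'
  obtain ⟨k, hk, rfl | rfl⟩ := ((hX q).1 hq).resolve_left hqC
  · rw [h.tail_eq k hk] at ht'
    rw [h.inj _ _ (by omega) (by omega) ht']
    exact Or.inl rfl
  · rw [h.head_eq k hk] at ht'
    have := h.inj _ _ (by omega) (by omega) ht'
    rw [show k = i by omega]
    exact Or.inr rfl

theorem tail_opp (h : G.IsArcParam C c x y p ℓ u) {i : ℕ} (hi : i + 1 < ℓ) :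
    G.tail (G.opp (p i)) = G.tail (p (i + 1)) :=
  G.tail_eq_of_cut (by rw [h.head_eq i (by omega), h.tail_eq _ hi])

theorem ne_opp (h : G.IsArcParam C c x y p ℓ u) {i j : ℕ} (hi : i < ℓ) (hj : j < ℓ) :
    p i ≠ G.opp (p j) := by
  intro hij
  have h1 := h.head_eq j hj
  rw [← hij, h.tail_eq i hi] at h1
  have h2 := h.head_eq i hi
  rw [hij, G.opp_opp, h.tail_eq j hj] at h2
  have h3 := h.inj _ _ (by omega) (by omega) h1
  have h4 := h.inj _ _ (by omega) (by omega) h2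
  omega

/-- Cutting along a cycle and an arc that joins its two sides makes a single hole. -/
theorem cut_face_eq [NeZero n] (h : G.IsArcParam C c x y p ℓ u) (hc : G.IsCycleParam C c)
    (hX : ∀ d, G.edge d ∈ X ↔ G.edge d ∈ C ∨ ∃ i < ℓ, d = p i ∨ d = G.opp (p i))
    (a b : G.darts X) : (G.cut X).face (.inr a) = (G.cut X).face (.inr b) := by
  classical
  have hCX : C ⊆ X := fun e he => by
    obtain ⟨d, rfl⟩ := G.exists_edge e
    exact (hX d).2 (Or.inl he)
  -- `F` records the new face along each dart of `X`. The contour of `X` has four pieces, the two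
  -- sides of the cycle and the two sides of the arc; `F` is shown constant on each, and then the
  -- corners at the ends of the arc link them.
  set F : D → Option (G.cut X).Face :=
    fun d => if hd : d ∈ G.darts X then some ((G.cut X).face (.inr ⟨d, hd⟩)) else none with hF
  have hFX : ∀ d : G.darts X, F d = some ((G.cut X).face (.inr d)) := fun d => dif_pos d.2
  have rule : ∀ (d : G.darts X) (e : D), (G.nextDart X d : D) = e → F d = F (G.opp e) := by
    rintro d _ rfl
    rw [hFX, ← cut_face_inr, ← hFX]
    rfl
  have hpX : ∀ i < ℓ, p i ∈ G.darts X := fun i hi => (hX _).2 (Or.inr ⟨i, hi, Or.inl rfl⟩)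
  have hpX' : ∀ i < ℓ, G.opp (p i) ∈ G.darts X :=
    fun i hi => (hX _).2 (Or.inr ⟨i, hi, Or.inr rfl⟩)
  have hℓ : ℓ - 1 < ℓ := by have := h.pos; omega
  -- The step from `c i` to `c (i + 1)` turns in the left sector at the tail of `c (i + 1)`; the arc
  -- occupies this sector only for `i + 1 = x`.
  have hl : ∀ i, i ≠ x - 1 → F (c (i + 1)) = F (c i) := by
    intro i hi
    have h1 := nextDart_of_empty_sector hCX ⟨c (i + 1), hc.mem _⟩ fun q hq hqC ht =>
      hi (by rw [← (h.eq_of_tail_pos hc hX hq hqC ht).2]; ring)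
    rw [(hc.nextDart i).1] at h1
    have := rule _ _ h1
    rwa [G.opp_opp] at this
  have hr : ∀ i, i ≠ y → F (G.opp (c (i + 1))) = F (G.opp (c i)) := by
    intro i hi
    have h1 := nextDart_of_empty_sector hCX ⟨G.opp (c i), hc.mem_opp _⟩ fun q hq hqC ht =>
      hi (h.eq_of_tail_neg hc hX hq hqC ht).2
    rw [(hc.nextDart i).2] at h1
    exact (rule _ _ h1).symm
  have hL : ∀ i, F (c i) = F (c x) := by
    intro i
    rw [eq_of_succ_of_ne (fun i => F (c i)) (x - 1) hl i]
    simp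
  have hR : ∀ i, F (G.opp (c i)) = F (G.opp (c (y + 1))) :=
    eq_of_succ_of_ne (fun i => F (G.opp (c i))) y hr
  have hx := nextDart_of_sector hCX ⟨c x, hc.mem x⟩ (hpX 0 h.pos) (h.notMem 0 h.pos)
    (by rw [h.tail_eq 0 h.pos, h.start]) fun q hq hqC ht => (h.eq_of_tail_pos hc hX hq hqC ht).1
  have hx1 := rule _ _ hx.1
  have hx2 := rule _ _ (hx.2.trans (by
    have := (hc.nextDart (x - 1)).1
    simp only [sub_add_cancel] at this
    exact this))
  rw [G.opp_opp, hL] at hx2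
  have hy := nextDart_of_sector hCX ⟨G.opp (c y), hc.mem_opp y⟩ (hpX' (ℓ - 1) hℓ)
    (fun hm => h.notMem (ℓ - 1) hℓ ((G.opp_mem_darts C _).2 hm))
    (by rw [h.head_eq _ hℓ, Nat.sub_add_cancel h.pos, h.finish])
    fun q hq hqC ht => (h.eq_of_tail_neg hc hX hq hqC ht).1
  have hy1 := rule _ _ hy.1
  have hy2 := rule _ _ (hy.2.trans (hc.nextDart y).2)
  rw [G.opp_opp] at hy1
  have hp : ∀ i < ℓ, F (p i) = F (p 0) := by
    intro i
    induction i with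
    | zero => exact fun _ => rfl
    | succ i ih =>
      intro hi
      rw [← ih (by omega)]
      have := nextDart_of_pair (a := ⟨p (i + 1), hpX _ hi⟩) (b := ⟨G.opp (p i), hpX' i (by omega)⟩)
        (fun h' => h.ne_opp hi (show i < ℓ by omega) (congrArg Subtype.val h'))
        (h.tail_opp hi).symm (fun q hq ht => h.eq_of_tail_interior hX hi hq ht)
      have := rule _ _ (congrArg Subtype.val this)
      rwa [G.opp_opp] at this
  have hp' : ∀ i < ℓ, F (G.opp (p i)) = F (G.opp (p 0)) := by
    intro i
    induction i with
    | zero => exact fun _ => rfl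
    | succ i ih =>
      intro hi
      rw [← ih (by omega)]
      have := nextDart_of_pair (b := ⟨p (i + 1), hpX _ hi⟩) (a := ⟨G.opp (p i), hpX' i (by omega)⟩)
        (fun h' => h.ne_opp hi (show i < ℓ by omega) (congrArg Subtype.val h').symm)
        (h.tail_opp hi) (fun q hq ht =>
          (h.eq_of_tail_interior hX hi hq (ht.trans (h.tail_opp hi))).symm)
      exact (rule _ _ (congrArg Subtype.val this)).symm
  -- One side of the arc links the two sides of the cycle; `hx1` attaches the other side of the arc.
  have e1 : F (G.opp (c y)) = F (c x) := by
    rw [← hx2, ← hp _ hℓ, ← hy1]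
  have hall : ∀ d : G.darts X, F d = F (c x) := by
    rintro ⟨d, hd⟩
    rcases (hX d).1 hd with hdC | ⟨i, hi, rfl | rfl⟩
    · obtain ⟨i, rfl | rfl⟩ := (hc.mem_iff d).1 hdC
      · exact hL i
      · change F (G.opp (c i)) = _
        rw [hR, ← hR y, e1]
    · change F (p i) = _
      rw [hp i hi, hx2]
    · change F (G.opp (p i)) = _
      rw [hp' i hi]
      exact hx1.symm
  have := (hall a).trans (hall b).symm
  rw [hFX, hFX] at this
  exact Option.some_injective _ this

/-- A cycle of length `n` with an arc of length `ℓ` has `n + ℓ` edges but only `n + ℓ - 1` vertices,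
since the ends of the arc are vertices of the cycle. -/
theorem card_vertex [NeZero n] (h : G.IsArcParam C c x y p ℓ u) (hc : G.IsCycleParam C c)
    (hX : ∀ d, G.edge d ∈ X ↔ G.edge d ∈ C ∨ ∃ i < ℓ, d = p i ∨ d = G.opp (p i)) :
    2 * Nat.card G.Vertex + 2 = 2 * (G.untouched X).ncard + (G.darts X).ncard := by
  have hzmod : (Set.univ : Set (ZMod n)).ncard = n := by rw [Set.ncard_univ, Nat.card_zmod]
  have h1 : X.ncard = n + ℓ := by
    have hXeq : X = Set.range (fun i => G.edge (c i)) ∪ (fun i => G.edge (p i)) '' Set.Iio ℓ := by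
      refine G.edgeSet_ext fun d => ?_
      rw [hX, hc.mem_iff]
      refine or_congr ?_ ?_
      · refine exists_congr fun i => ?_
        exact (G.edge_eq_iff (d := c i) (e := d)).symm
      · refine exists_congr fun i => and_congr Iff.rfl ?_
        exact (G.edge_eq_iff (d := p i) (e := d)).symm
    rw [hXeq, Set.ncard_union_eq, ← Set.image_univ, Set.ncard_image_of_injective, hzmod,
      Set.InjOn.ncard_image]
    · congr 1
      rw [← Finset.coe_Iio, Set.ncard_coe_finset, Nat.card_Iio]
    · intro i hi j hj hij
      rcases G.edge_eq_iff.1 hij with h' | h'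
      · have := h.tail_eq j hj
        rw [h', h.tail_eq i hi] at this
        exact h.inj i j (le_of_lt hi) (le_of_lt hj) this
      · exact absurd h' (h.ne_opp hj hi)
    · intro i j hij
      rcases G.edge_eq_iff.1 hij with h' | h'
      · exact (hc.inj h').symm
      · exact absurd h' (hc.ne_opp _ _)
    · rw [Set.disjoint_left]
      rintro _ ⟨i, rfl⟩ ⟨j, hj, hij⟩
      have hij' : G.edge (p j) = G.edge (c i) := hij
      exact h.notMem j hj (hij' ▸ hc.mem i)
  have h2 : (G.untouched X)ᶜ.ncard = n + (ℓ - 1) := by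
    have heq : (G.untouched X)ᶜ = Set.range (fun i => G.tail (c i)) ∪
        (fun i => G.tail (p i)) '' Set.Ioo 0 ℓ := by
      ext v
      rw [Set.mem_compl_iff]
      constructor
      · intro hv
        have : ∃ d, G.tail d = v ∧ G.edge d ∈ X := by
          by_contra h'
          push Not at h'
          exact hv h'
        obtain ⟨d, rfl, hd⟩ := this
        rcases (hX d).1 hd with hdC | ⟨i, hi, rfl | rfl⟩
        · obtain ⟨i, rfl | rfl⟩ := (hc.mem_iff d).1 hdC
          · exact Or.inl ⟨i, rfl⟩
          · exact Or.inl ⟨i + 1, (hc.head_eq i).symm⟩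
        · rcases Nat.eq_zero_or_pos i with rfl | h0
          · refine Or.inl ⟨x, ?_⟩
            exact G.tail_eq_of_cut (by rw [h.tail_eq 0 hi, h.start])
          · exact Or.inr ⟨i, ⟨h0, hi⟩, rfl⟩
        · rcases (show i + 1 ≤ ℓ from hi).lt_or_eq with h0 | h0
          · exact Or.inr ⟨i + 1, ⟨by omega, h0⟩, (h.tail_opp h0).symm⟩
          · refine Or.inl ⟨y + 1, ?_⟩
            have : G.tail (G.opp (p i)) = G.tail (G.opp (c y)) :=
              G.tail_eq_of_cut (by rw [h.head_eq i hi, h0, h.finish])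
            exact ((hc.head_eq y).symm.trans this.symm)
      · rintro (⟨i, rfl⟩ | ⟨i, hi, rfl⟩) hv
        · exact hv _ rfl ((hX _).2 (Or.inl (hc.mem i)))
        · exact hv _ rfl ((hX _).2 (Or.inr ⟨i, hi.2, Or.inl rfl⟩))
    rw [heq, Set.ncard_union_eq, ← Set.image_univ, Set.ncard_image_of_injective, hzmod,
      Set.InjOn.ncard_image]
    · congr 1
      rw [← Finset.coe_Ioo, Set.ncard_coe_finset, Nat.card_Ioo]
      omega
    · intro i hi j hj hij
      have := G.cut_tail_eq_of_untouched (X := C) hij (h.untouched hi.1 hi.2)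
      rw [h.tail_eq i hi.2, h.tail_eq j hj.2] at this
      exact h.inj i j hi.2.le hj.2.le this
    · exact fun i j hij => hc.tail_inj i j hij
    · rw [Set.disjoint_left]
      rintro _ ⟨i, rfl⟩ ⟨j, hj, hij⟩
      exact h.untouched hj.1 hj.2 (c i) hij.symm (hc.mem i)
  have h3 := Set.ncard_add_ncard_compl (G.untouched X)
  have h4 := G.ncard_darts X
  have h5 := h.pos
  omega

end IsArcParam

end Arc

end EmbGraph

namespace EmbGraph

/-! ### Crossing, bounding near one side, and the tight cycle. -/

section Sides

variable {D : Type*} {G : EmbGraph D}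

theorem SameSide.mem_iff {U : Set G.Face} {f f' : G.Face} (h : G.SameSide (G.bd U) f f') :
    f ∈ U ↔ f' ∈ U := by
  induction h with
  | rel f f' h =>
    obtain ⟨d, hd, rfl, rfl⟩ := h
    by_contra hcon
    exact hd (G.mem_bd.2 hcon)
  | refl => exact Iff.rfl
  | symm _ _ _ ih => exact ih.symm
  | trans _ _ _ _ _ ih ih' => exact ih.trans ih'

/-- An edge incident to `U` with both faces in one component has them both in `U`, and `U` is a
single component by `sameSide`. -/
theorem not_crosses [Finite D] {w : G.Edge → ℝ} (hG : G.Connected) (hw : ∀ e, 0 ≤ w e)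
    {a b : G.Face} {U : Set G.Face} (h : G.IsTheMinSeparating w a b (G.bd U)) (ha : a ∈ U)
    (hb : b ∉ U) {Y : Set G.Edge} (hY : Y ⊆ G.incident U) : ¬ G.Crosses Y (G.bd U) := by
  rintro ⟨d, e, hd, he, hdd, hee, hde⟩
  have h1 := hdd.mem_iff
  have h2 := hee.mem_iff
  have h3 := G.mem_incident.1 (hY hd)
  have h4 := G.mem_incident.1 (hY he)
  have h5 : G.face d ∈ U := by tauto
  have h6 : G.face e ∈ U := by tauto
  exact hde (((h.sameSide hG hw ha hb h5).symm).trans _ _ _ (h.sameSide hG hw ha hb h6))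

/-- A face of `U` has its whole boundary in `incident U`, so it is also a boundary walk of the
neighbourhood. The indicator of `W` is the required witness. -/
theorem chain_bd_mem_subBd {U W : Set G.Face} (hW : W ⊆ U) :
    G.chain (G.bd W) ∈ G.subBd (G.incident U) := by
  classical
  rw [mem_subBd]
  have hout : ∀ d, G.edge d ∉ G.incident U → G.face d ∉ W ∧ G.face (G.opp d) ∉ W := by
    intro d hd
    rw [mem_incident, not_or] at hd
    exact ⟨fun h => hd.1 (hW h), fun h => hd.2 (hW h)⟩
  refine ⟨fun d => if G.face d ∈ W then 1 else 0, fun d => ?_, fun d => ?_⟩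
  · by_cases hd : G.edge d ∈ G.incident U
    · rw [G.subNext_of_mem hd]
      beta_reduce
      rw [face_next]
    · rw [G.subNext_of_notMem hd]
      beta_reduce
      rw [face_next, if_neg (hout d hd).1, if_neg (hout d hd).2]
  · by_cases hd : G.edge d ∈ G.incident U
    · rw [G.partOpp_of_mem hd, chain, mem_bd]
      by_cases h1 : G.face d ∈ W <;> by_cases h2 : G.face (G.opp d) ∈ W <;>
        simp [h1, h2, CharTwo.add_self_eq_zero]
    · rw [G.partOpp_of_notMem hd, chain, mem_bd, if_neg]
      · exact (CharTwo.add_self_eq_zero _).symm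
      · have := hout d hd
        tauto

theorem symmDiff_subset_incident {U W : Set G.Face} {c : Set G.Edge} (hc : c ⊆ G.incident U) :
    symmDiff c (G.bd (W ∩ U)) ⊆ G.incident U := by
  intro e he
  obtain ⟨d, rfl⟩ := G.exists_edge e
  rcases he with h | h
  · exact hc h.1
  · have := G.mem_bd.1 h.1
    rw [mem_incident]
    by_contra hcon
    rw [not_or] at hcon
    exact this (iff_of_false (fun h => hcon.1 h.2) fun h => hcon.2 h.2)

/-- Remove simple cycles one at a time. If all of them were in `M`, so would be their sum. -/
theorem exists_simpleCycle_notMem [Fintype D] (M : Submodule (ZMod 2) (D → ZMod 2)) (m : ℕ)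
    {X : Set G.Edge} (hm : X.ncard = m) (hX : ∀ φ, G.bdry (G.chain X) φ = 0)
    (hM : G.chain X ∉ M) : ∃ C ⊆ X, G.IsSimpleCycle C ∧ G.chain C ∉ M := by
  induction m using Nat.strong_induction_on generalizing X with
  | _ m ih =>
    have hne : X.Nonempty := by
      by_contra h
      rw [Set.not_nonempty_iff_eq_empty] at h
      apply hM
      have : G.chain X = 0 := by ext d; simp [chain, h]
      rw [this]
      exact M.zero_mem
    obtain ⟨C, hCX, hC⟩ := exists_simpleCycle hX hne
    by_cases hCM : G.chain C ∈ M
    · have hsub : symmDiff X C ⊆ X := by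
        rintro e (h | h)
        · exact h.1
        · exact absurd (hCX h.1) h.2
      have hlt : (symmDiff X C).ncard < m := by
        rw [← hm]
        refine Set.ncard_lt_ncard ⟨hsub, fun h => ?_⟩ (Set.toFinite _)
        obtain ⟨x, L, hL, -, -, -, rfl⟩ := hC
        obtain ⟨d, hd⟩ := List.exists_mem_of_ne_nil L hL
        have hdC : G.edge d ∈ G.walkEdges L := mem_walkEdges.2 (Or.inl hd)
        rcases h (hCX hdC) with h' | h'
        · exact h'.2 hdC
        · exact h'.2 (hCX hdC)
      obtain ⟨C', hC', h'⟩ := ih _ hlt rfl (X := symmDiff X C)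
        (fun φ => by rw [chain_symmDiff, bdry_add, hX, bdry_simpleCycle hC, add_zero])
        (fun h => hM (by
          rw [chain_symmDiff] at h
          have := M.sub_mem h hCM
          rwa [add_sub_cancel_right] at this))
      exact ⟨C', hC'.trans hsub, h'⟩
    · exact ⟨C, hCX, hC, hCM⟩

theorem IsWalk.end_unique {x y y' : G.Vertex} {L : List D} (h : G.IsWalk x y L)
    (h' : G.IsWalk x y' L) : y = y' := by
  induction L generalizing x with
  | nil => exact Eq.trans (Eq.symm h) h'
  | cons d L ih => exact ih h.2 h'.2

theorem IsPath.exists_prefix {x y v : G.Vertex} {L : List D} (h : G.IsPath x y L)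
    (hv : v ∈ L.map G.tail ++ [y]) : ∃ P, G.IsPath x v P ∧ P <+: L := by
  induction L generalizing x with
  | nil =>
    have : v = y := by simpa using hv
    subst this
    exact ⟨[], ⟨h.1, by simp⟩, List.prefix_refl _⟩
  | cons d L ih =>
    by_cases hvx : v = x
    · subst hvx
      exact ⟨[], ⟨rfl, by simp⟩, List.nil_prefix⟩
    · have hnd := h.2
      rw [List.map_cons, List.cons_append, List.nodup_cons, h.1.1] at hnd
      rw [List.map_cons, List.cons_append, List.mem_cons, h.1.1] at hv
      have hv' := hv.resolve_left hvx
      obtain ⟨P, hP, hpre⟩ := ih h.of_cons hv'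
      refine ⟨d :: P, ⟨⟨h.1.1, hP.1⟩, ?_⟩, List.cons_prefix_cons.2 ⟨rfl, hpre⟩⟩
      rw [List.map_cons, List.cons_append, List.nodup_cons, h.1.1]
      refine ⟨fun hx => ?_, hP.2⟩
      rcases List.mem_append.1 hx with hx | hx
      · exact hnd.1 (List.mem_append_left _ ((hpre.map _).subset hx))
      · rw [List.mem_singleton.1 hx] at hnd
        exact hnd.1 hv'

variable [Finite D] {w : G.Edge → ℝ}

/-- A lightest simple cycle, among those in `incident U` that do not bound there, is tight. -/
theorem exists_tight_cycle (hw : ∀ e, 0 ≤ w e) {a b : G.Face} {U : Set G.Face}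
    (h : G.IsTheMinSeparating w a b (G.bd U)) (ha : a ∈ U) (hb : b ∉ U) {C₀ : Set G.Edge}
    (hC₀ : G.IsSimpleCycle C₀) (hC₀U : C₀ ⊆ G.incident U)
    (hC₀B : G.chain C₀ ∉ G.subBd (G.incident U)) :
    ∃ C, G.IsSimpleCycle C ∧ C ⊆ G.incident U ∧ G.chain C ∉ G.subBd (G.incident U) ∧
      G.IsTightCycle w C := by
  have := Fintype.ofFinite D
  obtain ⟨C, ⟨hC, hCU, hCB⟩, hmin⟩ := Set.exists_min_image
    {C | G.IsSimpleCycle C ∧ C ⊆ G.incident U ∧ G.chain C ∉ G.subBd (G.incident U)}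
    (G.weight w) (Set.toFinite _) ⟨C₀, hC₀, hC₀U, hC₀B⟩
  refine ⟨C, hC, hCU, hCB, ?_⟩
  rintro x L hL ⟨W, hW⟩
  -- Complementing does not change the boundary, so `W` may be taken to miss `b`; then `U ∪ W`
  -- separates `a` from `b`.
  obtain ⟨W, hW, hbW⟩ : ∃ W, G.bd W = symmDiff C (G.walkChain L) ∧ b ∉ W := by
    by_cases hbW : b ∈ W
    · exact ⟨Wᶜ, by rw [bd_compl, hW], fun h => h hbW⟩
    · exact ⟨W, hW, hbW⟩
  have h1 := weight_uncross hw hCU W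
  have h2 := h.weight_le (T := G.bd (U ∪ W)) ⟨_, Or.inl ha, by simp [hb, hbW], rfl⟩
  rw [hW, symmDiff_symmDiff_cancel_left] at h1
  have h3 := (weight_mono hw (walkChain_subset L)).trans (weight_walkEdges_le hw L)
  have hmem := chain_bd_mem_subBd (G := G) (U := U) (W := W ∩ U) Set.inter_subset_right
  -- `C` changed by the boundary of faces of `U` still does not bound near `U`, so it contains a
  -- competitor of `C`.
  obtain ⟨C', hC's, hC', hC'B⟩ := exists_simpleCycle_notMem (G.subBd (G.incident U)) _ rfl
    (X := symmDiff C (G.bd (W ∩ U)))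
    (fun φ => by rw [chain_symmDiff, bdry_add, bdry_simpleCycle hC, bdry_bd, add_zero])
    (fun h => hCB (by
      rw [chain_symmDiff] at h
      have := Submodule.sub_mem _ h hmem
      rwa [add_sub_cancel_right] at this))
  have h4 := hmin C' ⟨hC', hC's.trans (symmDiff_subset_incident hCU), hC'B⟩
  have h5 := weight_mono hw hC's
  linarith

end Sides

/-! ### The two copies of a nonbounding cycle and a walk between them. -/

section Handle

variable {D : Type*} [Finite D] {G : EmbGraph D} {C : Set G.Edge} {n : ℕ} {c : ZMod n → D}

namespace IsCycleParam

theorem cut_tail_inr_pos (hc : G.IsCycleParam C c) (i : ZMod n) :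
    (G.cut C).tail (.inr ⟨c i, hc.mem i⟩) = (G.cut C).tail (.inl (c (i + 1))) := by
  rw [← G.cut_tail_inr ⟨c (i + 1), hc.mem _⟩]
  congr 2
  refine Subtype.ext ?_
  change c i = G.opp (G.nextDart C ⟨c (i + 1), hc.mem _⟩ : D)
  rw [(hc.nextDart i).1, G.opp_opp]

theorem cut_tail_inr_neg (hc : G.IsCycleParam C c) (i : ZMod n) :
    (G.cut C).tail (.inr ⟨G.opp (c (i + 1)), hc.mem_opp _⟩) =
      (G.cut C).tail (.inl (G.opp (c i))) := by
  rw [← G.cut_tail_inr ⟨G.opp (c i), hc.mem_opp _⟩]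
  congr 2
  refine Subtype.ext ?_
  change G.opp (c (i + 1)) = G.opp (G.nextDart C ⟨G.opp (c i), hc.mem_opp _⟩ : D)
  rw [(hc.nextDart i).2]

/-- The two copies of a cycle bound distinct new faces. -/
theorem cut_face_ne (hc : G.IsCycleParam C c) (i j : ZMod n) :
    (G.cut C).face (.inr ⟨c i, hc.mem i⟩) ≠
      (G.cut C).face (.inr ⟨G.opp (c j), hc.mem_opp j⟩) := by
  intro h
  have := eq_of_sameCycle (τ := (G.cut C).next)
    -- The direction of a dart along the cycle is kept by the boundary walks of the new faces.
    (f := Sum.elim (fun _ : D => False) fun e : G.darts C => ∃ i, (e : D) = c i) (by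
      rintro (x | ⟨x, hx⟩)
      · rfl
      · rw [cut_next_inr, Sum.elim_inr, Sum.elim_inr]
        obtain ⟨i, rfl | rfl⟩ := (hc.mem_iff x).1 hx
        · obtain ⟨k, rfl⟩ : ∃ k, i = k + 1 := ⟨i - 1, by ring⟩
          refine propext (iff_of_true ⟨k, ?_⟩ ⟨_, rfl⟩)
          change G.opp (G.nextDart C ⟨c (k + 1), hx⟩ : D) = _
          rw [(hc.nextDart k).1, G.opp_opp]
        · refine propext (iff_of_false ?_ ?_)
          · rintro ⟨k, hk⟩
            change G.opp (G.nextDart C ⟨G.opp (c i), hx⟩ : D) = _ at hk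
            rw [(hc.nextDart i).2] at hk
            exact hc.ne_opp _ _ hk.symm
          · rintro ⟨k, hk⟩
            exact hc.ne_opp _ _ hk.symm) ((G.cut C).face_eq_iff.1 h)
  simp only [Sum.elim_inr, eq_iff_iff] at this
  obtain ⟨k, hk⟩ := this.1 ⟨i, rfl⟩
  exact hc.ne_opp _ _ hk.symm

/-- A copy of an edge of the cycle stays on one copy of the cycle. -/
theorem cut_ends (hc : G.IsCycleParam C c) {a : G.CutDart C}
    (ha : G.cutProj C ((G.cut C).edge a) ∈ C) :
    ((∃ i, (G.cut C).tail a = (G.cut C).tail (.inl (c i))) ∧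
      ∃ i, (G.cut C).head a = (G.cut C).tail (.inl (c i))) ∨
    ((∃ i, (G.cut C).tail a = (G.cut C).tail (.inl (G.opp (c i)))) ∧
      ∃ i, (G.cut C).head a = (G.cut C).tail (.inl (G.opp (c i)))) := by
  have hneg : ∀ i, ∃ j, (G.cut C).tail (.inr ⟨G.opp (c i), hc.mem_opp i⟩) =
      (G.cut C).tail (.inl (G.opp (c j))) := by
    intro i
    obtain ⟨k, rfl⟩ : ∃ k, i = k + 1 := ⟨i - 1, by ring⟩
    exact ⟨k, hc.cut_tail_inr_neg k⟩
  rcases a with d | ⟨d, hd⟩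
  · have hd : d ∈ G.darts C := ha
    have hh : (G.cut C).head (.inl d) = (G.cut C).tail (.inr ⟨d, hd⟩) := by
      rw [head, G.cut_opp_inl_of_mem hd]
    rw [hh]
    obtain ⟨i, rfl | rfl⟩ := (hc.mem_iff d).1 hd
    · exact Or.inl ⟨⟨i, rfl⟩, ⟨_, hc.cut_tail_inr_pos i⟩⟩
    · exact Or.inr ⟨⟨i, rfl⟩, hneg i⟩
  · have hh : (G.cut C).head (.inr ⟨d, hd⟩) = (G.cut C).tail (.inl d) := rfl
    rw [hh]
    obtain ⟨i, rfl | rfl⟩ := (hc.mem_iff d).1 hd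
    · exact Or.inl ⟨⟨_, hc.cut_tail_inr_pos i⟩, ⟨i, rfl⟩⟩
    · exact Or.inr ⟨hneg i, ⟨i, rfl⟩⟩

theorem mem_incident_cutUp {U : Set G.Face} {d : D} (hd : G.edge d ∈ G.incident U) :
    (G.cut C).edge (.inl d) ∈ (G.cut C).incident (G.cutUp C U) := by
  rw [mem_incident]
  by_cases hdC : d ∈ G.darts C
  · rw [G.cut_opp_inl_of_mem hdC]
    exact Or.inr (G.inr_mem_cutUp _)
  · rw [G.cut_opp_inl_of_notMem hdC, inl_mem_cutUp, inl_mem_cutUp]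
    exact G.mem_incident.1 hd

/-- If the cycle does not bound in a neighbourhood of `incident U`, then its two copies are joined
by a walk there. -/
theorem exists_walk (hc : G.IsCycleParam C c) {U : Set G.Face} (hCU : C ⊆ G.incident U)
    (hCB : G.chain C ∉ G.subBd (G.incident U)) :
    ∃ i j L, (G.cut C).IsWalk ((G.cut C).tail (.inl (c i)))
      ((G.cut C).tail (.inl (G.opp (c j)))) L ∧
      ∀ d ∈ L, (G.cut C).edge d ∈ (G.cut C).incident (G.cutUp C U) := by
  classical
  by_contra hcon
  push Not at hcon
  apply hCB
  -- `R` is what can be reached near `U` from the left copy of `C`. If it misses the right copy, the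
  -- function that marks darts with tail in `R` exhibits `C` as a boundary near `U`: it differs
  -- across edges of `C` and agrees across all others.
  set R : Set (G.cut C).Vertex := {v | ∃ i L, (G.cut C).IsWalk ((G.cut C).tail (.inl (c i))) v L ∧
    ∀ d ∈ L, (G.cut C).edge d ∈ (G.cut C).incident (G.cutUp C U)} with hR
  have step : ∀ d, (G.cut C).edge d ∈ (G.cut C).incident (G.cutUp C U) →
      (G.cut C).tail d ∈ R → (G.cut C).head d ∈ R := by
    rintro d hd ⟨i, L, hL, hL'⟩
    refine ⟨i, L ++ [d], hL.concat, fun e he => ?_⟩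
    rcases List.mem_append.1 he with he | he
    · exact hL' e he
    · rw [List.mem_singleton.1 he]; exact hd
  have step' : ∀ d, (G.cut C).edge d ∈ (G.cut C).incident (G.cutUp C U) →
      ((G.cut C).head d ∈ R ↔ (G.cut C).tail d ∈ R) := fun d hd =>
    ⟨fun h => by
      have := step ((G.cut C).opp d) (by rwa [edge_opp]) h
      rwa [head_opp] at this, step d hd⟩
  have hpos : ∀ i, (G.cut C).tail (.inl (c i)) ∈ R := fun i => ⟨i, [], rfl, by simp⟩
  have hneg : ∀ j, (G.cut C).tail (.inl (G.opp (c j))) ∉ R := by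
    rintro j ⟨i, L, hL, hL'⟩
    obtain ⟨d, hd, hd'⟩ := hcon i j L hL
    exact hd' (hL' d hd)
  have hnext : ∀ d : D, (G.cut C).tail (.inl (G.next d)) = (G.cut C).head (.inl d) :=
    fun d => (G.cut C).tail_next (.inl d)
  rw [mem_subBd]
  refine ⟨fun d => if (G.cut C).tail (.inl d) ∈ R then 1 else 0, fun d => ?_, fun d => ?_⟩
  · by_cases hd : G.edge d ∈ G.incident U
    · rw [G.subNext_of_mem hd]
      beta_reduce
      rw [hnext]
      exact if_congr (step' _ (mem_incident_cutUp hd)) rfl rfl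
    -- Away from `incident U` the boundary walk turns about a vertex without passing a dart of `C`,
    -- so it stays at one vertex of the cut graph.
    · have hdC : G.opp d ∉ G.darts C := fun h => hd (hCU ((G.opp_mem_darts C d).2 h))
      rw [G.subNext_of_notMem hd]
      beta_reduce
      rw [hnext, head, G.cut_opp_inl_of_notMem hdC, G.opp_opp]
  · by_cases hdC : G.edge d ∈ C
    · rw [G.partOpp_of_mem (hCU hdC), G.chain_eq_one.2 hdC]
      obtain ⟨i, rfl | rfl⟩ := (hc.mem_iff d).1 hdC
      · beta_reduce
        rw [if_pos (hpos i), if_neg (hneg i), add_zero]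
      · beta_reduce
        rw [G.opp_opp, if_pos (hpos i), if_neg (hneg i), zero_add]
    · have h0 : G.chain C d = 0 := if_neg hdC
      rw [h0]
      by_cases hd : G.edge d ∈ G.incident U
      · have h1 := step' _ (mem_incident_cutUp (C := C) hd)
        rw [head, G.cut_opp_inl_of_notMem hdC] at h1
        rw [G.partOpp_of_mem hd]
        beta_reduce
        rw [if_congr h1 rfl rfl]
        exact (CharTwo.add_self_eq_zero _).symm
      · rw [G.partOpp_of_notMem hd]
        exact (CharTwo.add_self_eq_zero _).symm

end IsCycleParam

end Handle

end EmbGraph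

namespace EmbGraph

/-! ### The tight path, and assembly of the handle. -/

section Handle

variable {D : Type*} {G : EmbGraph D}

theorem IsWalk.start_unique {x x' y y' : G.Vertex} {L : List D} (hL : L ≠ []) (h : G.IsWalk x y L)
    (h' : G.IsWalk x' y' L) : x = x' := by
  cases L with
  | nil => exact absurd rfl hL
  | cons d L => exact h.1.symm.trans h'.1

variable [Finite D] {w : G.Edge → ℝ} {C : Set G.Edge} {U : Set G.Face} {n : ℕ} {c : ZMod n → D}

/-- `L` is a path near `U` that joins the two copies of a cycle. -/
def IsJoin (G : EmbGraph D) (C : Set G.Edge) (U : Set G.Face) {n : ℕ} (c : ZMod n → D)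
    (x y : ZMod n) (L : List (G.CutDart C)) : Prop :=
  (G.cut C).IsPath ((G.cut C).tail (.inl (c x))) ((G.cut C).tail (.inl (G.opp (c y)))) L ∧
    ∀ d ∈ L, (G.cut C).edge d ∈ (G.cut C).incident (G.cutUp C U)

/-- `L` is a lightest path near `U` that joins the two copies of a cycle, with the least possible
number of edges among those. -/
structure IsMinJoin (G : EmbGraph D) (w : G.Edge → ℝ) (C : Set G.Edge) (U : Set G.Face) {n : ℕ}
    (c : ZMod n → D) (x y : ZMod n) (L : List (G.CutDart C)) : Prop where
  isJoin : G.IsJoin C U c x y L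
  le : ∀ i j L', G.IsJoin C U c i j L' →
    (G.cut C).walkWeight (G.cutWeight C w) L ≤ (G.cut C).walkWeight (G.cutWeight C w) L'
  length_le : ∀ i j L', G.IsJoin C U c i j L' →
    (G.cut C).walkWeight (G.cutWeight C w) L' ≤ (G.cut C).walkWeight (G.cutWeight C w) L →
      L.length ≤ L'.length

/-- Paths do not repeat darts, so there are finitely many. The number of edges is a second key
because weights may vanish, and a lightest path may then touch a copy of `C` midway. -/
theorem exists_isMinJoin (w : G.Edge → ℝ) (h : ∃ x y L, G.IsJoin C U c x y L) :
    ∃ x y L, G.IsMinJoin w C U c x y L := by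
  classical
  have := Fintype.ofFinite (G.CutDart C)
  have hfin : {L : List (G.CutDart C) | L.Nodup}.Finite :=
    Set.finite_coe_iff.1 (inferInstanceAs (Finite {L : List (G.CutDart C) // L.Nodup}))
  obtain ⟨L, ⟨x, y, hL⟩, hmin⟩ := Set.exists_min_image {L | ∃ x y, G.IsJoin C U c x y L}
    (fun L => toLex ((G.cut C).walkWeight (G.cutWeight C w) L, L.length))
    (hfin.subset fun L ⟨_, _, hL⟩ => hL.1.nodup) (by
      obtain ⟨x, y, L, hL⟩ := h
      exact ⟨L, x, y, hL⟩)
  have hmin' : ∀ i j L', G.IsJoin C U c i j L' → _ := fun i j L' hL' =>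
    Prod.Lex.toLex_le_toLex.1 (hmin L' ⟨i, j, hL'⟩)
  refine ⟨x, y, L, hL, fun i j L' hL' => ?_, fun i j L' hL' hle => ?_⟩
  · rcases hmin' i j L' hL' with h | h
    · exact h.le
    · exact h.1.le
  · rcases hmin' i j L' hL' with h | h
    · exact absurd hle (not_le.2 h)
    · exact h.2

theorem edge_mem_projWalk {P : List (G.CutDart C)} {d : D} :
    G.edge d ∈ G.projWalk C P ↔ ∃ a ∈ P, G.cutProj C ((G.cut C).edge a) = G.edge d := by
  constructor
  · rintro ⟨e, he, h⟩
    obtain ⟨a, ha, rfl⟩ := List.mem_map.1 he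
    exact ⟨a, ha, h⟩
  · rintro ⟨a, ha, h⟩
    exact ⟨_, List.mem_map_of_mem ha, h⟩

theorem projWalk_subset_incident {P : List (G.CutDart C)} (hCU : C ⊆ G.incident U)
    (hP : ∀ d ∈ P, (G.cut C).edge d ∈ (G.cut C).incident (G.cutUp C U)) :
    G.projWalk C P ⊆ G.incident U := by
  intro e he
  obtain ⟨d, rfl⟩ := G.exists_edge e
  obtain ⟨a, ha, h⟩ := edge_mem_projWalk.1 he
  rw [← h]
  rcases a with a | a
  · by_cases haC : a ∈ G.darts C
    · exact hCU haC
    · have := (G.cut C).mem_incident.1 (hP _ ha)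
      rw [G.cut_opp_inl_of_notMem haC, inl_mem_cutUp, inl_mem_cutUp] at this
      exact G.mem_incident.2 this
  · exact hCU a.2

namespace IsMinJoin

variable {x y : ZMod n} {P : List (G.CutDart C)}

/-- The uncrossing argument for the tight cycle, in G cut along `C` with `cutUp C U` in place of
`U`. All new faces lie in `cutUp C U ∪ W`, so its boundary is at least as heavy as that of a
separating set of G, and hence as `bd U`. -/
theorem isTightPath (hP : G.IsMinJoin w C U c x y P) (hw : ∀ e, 0 ≤ w e) {a b : G.Face}
    (h : G.IsTheMinSeparating w a b (G.bd U)) (ha : a ∈ U) (hb : b ∉ U)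
    (hCU : C ⊆ G.incident U) :
    (G.cut C).IsTightPath (G.cutWeight C w) ((G.cut C).tail (.inl (c x)))
      ((G.cut C).tail (.inl (G.opp (c y)))) P := by
  have := Fintype.ofFinite (G.CutDart C)
  have hw' : ∀ e, 0 ≤ G.cutWeight C w e := fun e => hw _
  refine ⟨hP.isJoin.1, ?_⟩
  rintro - - - - Q hQ ⟨W, -, hW⟩
  obtain ⟨W, hW, hbW⟩ : ∃ W, (G.cut C).bd W =
      symmDiff ((G.cut C).walkChain P) ((G.cut C).walkChain Q) ∧ G.cutFace C b ∉ W := by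
    by_cases hbW : G.cutFace C b ∈ W
    · exact ⟨Wᶜ, by rw [bd_compl, hW], fun h => h hbW⟩
    · exact ⟨W, hW, hbW⟩
  have hPU : (G.cut C).walkChain P ⊆ (G.cut C).incident (G.cutUp C U) := by
    intro e he
    obtain ⟨d, hd, rfl⟩ := List.mem_map.1 (walkChain_subset P he)
    exact hP.isJoin.2 d hd
  have h1 := weight_uncross hw' hPU W
  rw [hW, symmDiff_symmDiff_cancel_left, weight_bd_cutUp hCU] at h1
  have h2 := weight_bd_le_cut hw (W := G.cutUp C U ∪ W) fun _ e _ => Or.inl (G.inr_mem_cutUp e)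
  have h3 : G.weight w (G.bd U) ≤ G.weight w (G.bd {f | G.cutFace C f ∈ G.cutUp C U ∪ W}) := by
    refine h.weight_le ⟨_, ?_, ?_, rfl⟩
    · obtain ⟨d, rfl⟩ := G.exists_face a
      exact Or.inl ((G.inl_mem_cutUp).2 ha)
    · obtain ⟨d, rfl⟩ := G.exists_face b
      rintro (h | h)
      · exact hb ((G.inl_mem_cutUp).1 h)
      · exact hbW h
  -- Adding a boundary keeps the end points, so the modified chain still contains a path between
  -- them, and this path stays near `U`.
  obtain ⟨L, hL, hLs⟩ := exists_walk_of_bdry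
    (X := symmDiff ((G.cut C).walkChain P) ((G.cut C).bd (W ∩ G.cutUp C U))) fun φ => by
      rw [chain_symmDiff, bdry_add, bdry_bd, add_zero, bdry_walkChain _ hP.isJoin.1.1]
  obtain ⟨P', hP', hsub⟩ := hL.exists_path
  have hP's : ∀ d ∈ P', (G.cut C).edge d ∈
      symmDiff ((G.cut C).walkChain P) ((G.cut C).bd (W ∩ G.cutUp C U)) :=
    fun d hd => hLs d (hsub.subset hd)
  have h4 := hP.le x y P' ⟨hP', fun d hd => symmDiff_subset_incident hPU (hP's d hd)⟩
  rw [walkWeight_eq hP'.nodup_edges] at h4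
  have h5 := weight_mono hw' (X := (G.cut C).walkEdges P') fun e he => by
    obtain ⟨d, hd, rfl⟩ := List.mem_map.1 he
    exact hP's d hd
  have h6 := (weight_mono hw' (walkChain_subset Q)).trans (weight_walkEdges_le hw' Q)
  linarith

theorem exists_isArcParam (hP : G.IsMinJoin w C U c x y P) (hw : ∀ e, 0 ≤ w e)
    (hc : G.IsCycleParam C c) : ∃ p ℓ u, G.IsArcParam C c x y p ℓ u ∧
      ∀ d, G.edge d ∈ G.projWalk C P ↔ ∃ i < ℓ, d = p i ∨ d = G.opp (p i) := by
  have hne : ∀ i j, (G.cut C).tail (.inl (c i)) ≠ (G.cut C).tail (.inl (G.opp (c j))) := by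
    intro i j hij
    have := G.cut_tail_inl_injOn ⟨_, hc.mem i⟩ ⟨_, hc.mem_opp j⟩ hij
    exact hc.ne_opp i j (congrArg Subtype.val this)
  obtain ⟨u, hu0, huℓ, hu, hinj⟩ := hP.isJoin.1.exists_vertices
  have hpos : 0 < P.length := by
    rcases Nat.eq_zero_or_pos P.length with h | h
    · rw [h, hu0] at huℓ
      exact absurd huℓ (hne x y)
    · exact h
  have hw' : ∀ e, 0 ≤ G.cutWeight C w e := fun e => hw _
  have hmem : ∀ i, i < P.length → u i ∈ P.map (G.cut C).tail ++
      [(G.cut C).tail (.inl (G.opp (c y)))] := fun i hi => by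
    rw [← (hu i hi).1]
    exact List.mem_append_left _ (List.mem_map_of_mem (List.getElem_mem hi))
  -- From an inner vertex on the left copy the rest of the path is itself a join; up to an inner
  -- vertex on the right copy the beginning is one. Either has fewer edges and no more weight.
  have hint : ∀ i, 0 < i → i < P.length → ∀ a : G.darts C,
      u i ≠ (G.cut C).tail (.inl (a : D)) := by
    rintro i hi hiℓ ⟨a, ha⟩ hia
    have key : ∀ j k L, L.Sublist P → (G.cut C).IsPath ((G.cut C).tail (.inl (c j)))
        ((G.cut C).tail (.inl (G.opp (c k)))) L → L = P := fun j k L hs hL =>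
      hs.eq_of_length_le (hP.length_le j k L ⟨hL, fun d hd => hP.isJoin.2 d (hs.subset hd)⟩
        (walkWeight_le_of_sublist hw' hs))
    obtain ⟨k, rfl | rfl⟩ := (hc.mem_iff a).1 ha
    · obtain ⟨L, hL, hs⟩ := hP.isJoin.1.exists_suffix (hmem i hiℓ)
      rw [hia] at hL
      have := key _ _ _ hs.sublist hL
      subst this
      have h0 := IsWalk.start_unique (List.ne_nil_of_length_pos hpos) hL.1 hP.isJoin.1.1
      rw [← hia, ← hu0] at h0
      have := hinj hiℓ.le (Nat.zero_le _) h0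
      omega
    · obtain ⟨L, hL, hs⟩ := hP.isJoin.1.exists_prefix (hmem i hiℓ)
      rw [hia] at hL
      have := key _ _ _ hs.sublist hL
      subst this
      have h0 := hL.1.end_unique hP.isJoin.1.1
      rw [← hia, ← huℓ] at h0
      have := hinj hiℓ.le (le_refl L.length) h0
      omega
  have hp : ∀ i, ∃ d : D, ∀ hi : i < P.length, P[i] = .inl d ∧ G.edge d ∉ C := by
    intro i
    by_cases hi : i < P.length
    -- A copy of an edge of `C` has both ends on the same copy of `C`. On the left copy its head, on
    -- the right copy its tail, would be a forbidden vertex of the path.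
    · have hnC : G.cutProj C ((G.cut C).edge P[i]) ∉ C := by
        intro h
        rcases hc.cut_ends h with ⟨-, k, hk⟩ | ⟨⟨k, hk⟩, -⟩
        · rw [(hu i hi).2] at hk
          rcases (show i + 1 ≤ P.length from hi).lt_or_eq with h0 | h0
          · exact hint _ (Nat.succ_pos i) h0 ⟨_, hc.mem k⟩ hk
          · rw [h0, huℓ] at hk
            exact hne _ _ hk.symm
        · rw [(hu i hi).1] at hk
          rcases Nat.eq_zero_or_pos i with h0 | h0
          · rw [h0, hu0] at hk
            exact hne _ _ hk
          · exact hint _ h0 hi ⟨_, hc.mem_opp k⟩ hk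
      rcases hPi : P[i] with d | d
      · rw [hPi] at hnC
        exact ⟨d, fun _ => ⟨hPi, hnC⟩⟩
      · rw [hPi] at hnC
        exact absurd d.2 hnC
    · exact ⟨c x, fun h => absurd h hi⟩
  choose p hp using hp
  refine ⟨p, P.length, u, ⟨hpos, fun i hi => (hp i hi).2, fun i hi => ?_, fun i hi => ?_,
    fun i j hi hj hij => hinj hi hj hij, hu0, huℓ, hint⟩, fun d => ?_⟩
  · rw [← (hp i hi).1]
    exact (hu i hi).1
  · rw [← G.cut_opp_inl_of_notMem (hp i hi).2, ← (hp i hi).1]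
    exact (hu i hi).2
  · rw [edge_mem_projWalk]
    constructor
    · rintro ⟨a, ha, h⟩
      obtain ⟨i, hi, rfl⟩ := List.mem_iff_getElem.1 ha
      rw [(hp i hi).1] at h
      exact ⟨i, hi, G.edge_eq_iff.1 h⟩
    · rintro ⟨i, hi, h⟩
      refine ⟨P[i], List.getElem_mem hi, ?_⟩
      rw [(hp i hi).1]
      exact G.edge_eq_iff.2 h

end IsMinJoin

/-- A cycle near `U` that does not bound there yields a handle near `U`. -/
theorem exists_tight_cycle_path (hw : ∀ e, 0 ≤ w e) {g : ℤ} (hg : G.HasGenus g) (B : Set G.Face)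
    {a b : G.Face} (h : G.IsTheMinSeparating w a b (G.bd U)) (ha : a ∈ U) (hb : b ∉ U)
    {C₀ : Set G.Edge} (hC₀ : G.IsSimpleCycle C₀) (hC₀U : C₀ ⊆ G.incident U)
    (hC₀B : G.chain C₀ ∉ G.subBd (G.incident U)) :
    ∃ (C : Set G.Edge) (P : List (G.CutDart C)),
      G.IsSimpleCycle C ∧ G.IsTightCycle w C ∧ G.IsTightCycleToCyclePath w C P ∧
      ((G.cut (C ∪ G.projWalk C P)).HasGenus (g - 1) ∧
        (G.cutBoundary (C ∪ G.projWalk C P) B).ncard = B.ncard + 1) ∧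
      (¬ G.Crosses C (G.bd U) ∧ ¬ G.Crosses (G.projWalk C P) (G.bd U)) ∧
      G.IsTheMinSeparatingInCut w (C ∪ G.projWalk C P) a b (G.bd U) := by
  obtain ⟨C, hC, hCU, hCB, htight⟩ := exists_tight_cycle hw h ha hb hC₀ hC₀U hC₀B
  obtain ⟨n, _, c, hc⟩ := hC.exists_param
  obtain ⟨x, y, P, hP⟩ : ∃ x y P, G.IsMinJoin w C U c x y P := by
    refine exists_isMinJoin w ?_
    obtain ⟨i, j, L, hL, hLU⟩ := hc.exists_walk hCU hCB
    obtain ⟨L', hL', hs⟩ := hL.exists_path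
    exact ⟨i, j, L', hL', fun d hd => hLU d (hs.subset hd)⟩
  obtain ⟨p, ℓ, u, harc, hproj⟩ := hP.exists_isArcParam hw hc
  have hX : ∀ d, G.edge d ∈ C ∪ G.projWalk C P ↔
      G.edge d ∈ C ∨ ∃ i < ℓ, d = p i ∨ d = G.opp (p i) :=
    fun d => or_congr Iff.rfl (hproj d)
  have hPU := projWalk_subset_incident hCU hP.isJoin.2
  have hface := harc.cut_face_eq hc hX
  have hne : (G.darts (C ∪ G.projWalk C P)).Nonempty := ⟨c x, Or.inl (hc.mem x)⟩
  -- The shifts by one arise because `inr d` starts at the head of `d`: the left copy of the tail of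
  -- `c x` is the tail of the new dart over `c (x - 1)`, and similarly on the right.
  refine ⟨C, P, hC, htight, ⟨⟨_, hc.mem (x - 1)⟩, ⟨_, hc.mem_opp (y + 1)⟩, hc.cut_face_ne _ _, ?_⟩,
    ⟨hg.cut hne hface (harc.card_vertex hc hX), G.ncard_cutBoundary hne hface B⟩,
    ⟨not_crosses hg.1 hw h ha hb hCU, not_crosses hg.1 hw h ha hb hPU⟩,
    h.inCut hw ha hb (Set.union_subset hCU hPU) hface⟩
  rw [hc.cut_tail_inr_pos, hc.cut_tail_inr_neg, sub_add_cancel]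
  exact hP.isTightPath hw h ha hb hCU

end Handle

end EmbGraph

theorem mainTheorem6 {D : Type*} [Finite D] (G : EmbGraph D)
    (w : G.Edge → ℝ) (hw : ∀ e, 0 ≤ w e)
    (g b : ℕ) (hg : G.HasGenus g) (B : Set G.Face) (hB : B.ncard = b)
    (s t : G.Face) (S : Set G.Edge) (hS : G.IsTheMinSeparating w s t S)
    (hdec : ∃ 𝒞 : Set (Set G.Edge), G.IsCycleDecomposition S 𝒞 ∧ 𝒞.ncard ≤ g) :
    ∃ (C : Set G.Edge) (P : List (G.CutDart C)),
      G.IsSimpleCycle C ∧ G.IsTightCycle w C ∧ G.IsTightCycleToCyclePath w C P ∧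
      ((G.cut (C ∪ G.projWalk C P)).HasGenus ((g : ℤ) - 1) ∧
        (G.cutBoundary (C ∪ G.projWalk C P) B).ncard = b + 1) ∧
      (¬ G.Crosses C S ∧ ¬ G.Crosses (G.projWalk C P) S) ∧
      G.IsTheMinSeparatingInCut w (C ∪ G.projWalk C P) s t S := by
  have := Fintype.ofFinite D
  obtain ⟨𝒞, h𝒞, hk⟩ := hdec
  obtain ⟨U, hs, ht, rfl⟩ := hS.1
  subst hB
  rcases EmbGraph.exists_cycle_notMem_subBd hg ⟨s, hs⟩ ⟨t, ht⟩ h𝒞 hk with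
    ⟨X, hXU, hX, hXB⟩ | ⟨X, hXU, hX, hXB⟩
  · obtain ⟨C₀, hC₀X, hC₀, hC₀B⟩ := EmbGraph.exists_simpleCycle_notMem _ _ rfl hX hXB
    exact EmbGraph.exists_tight_cycle_path hw hg B hS hs ht hC₀ (hC₀X.trans hXU) hC₀B
  · obtain ⟨C₀, hC₀X, hC₀, hC₀B⟩ := EmbGraph.exists_simpleCycle_notMem _ _ rfl hX hXB
    -- The handle lies on the side of `t`. The whole argument applies with the roles of `s` and `t`
    -- exchanged, and the conclusion is symmetric.
    rw [← G.bd_compl U] at hS ⊢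
    obtain ⟨C, P, h1, h2, h3, h4, h5, h6⟩ := EmbGraph.exists_tight_cycle_path hw hg B hS.symm ht
      (not_not.2 hs) hC₀ (hC₀X.trans hXU) hC₀B
    exact ⟨C, P, h1, h2, h3, h4, h5, h6.symm⟩
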